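/- Let $\mathbf I$ be a finite set of agents, $\mathbf P$ a countable set of propositions and $\mathbf\Sigma$ a finite set of actions. Observation expressions are the regular expressions $\pi ::= \emptyset \mid \varepsilon \mid a \mid \pi\cdot\pi \mid \pi+\pi \mid \pi^*$ ($a\in\mathbf\Sigma$), with language $\mathcal L(\pi)\subseteq\mathbf\Sigma^*$; for a word $w$, $\pi\backslash w$ denotes the residue of $\pi$ by $w$ (an expression with $\mathcal L(\pi\backslash w)=\{v : wv\in\mathcal L(\pi)\}$), and $\mathit{prefixes}(\pi)=\{w : \exists v,\ wv\in\mathcal L(\pi)\}$. An epistemic expectation model is $\mathcal M=\langle S,\sim,V,\mathit{Exp}\rangle$, where $S$ is a non-empty set of worlds, $\sim_i$ is an equivalence relation on $S$ for each $i\in\mathbf I$, $V:S\to 2^{\mathbf P}$, and $\mathit{Exp}$ assigns to each world an observation expression with non-empty language. For a word $w$, the updated model $\mathcal M|_w$ has the worlds $S'=\{s\in S : \mathcal L(\mathit{Exp}(s)\backslash w)\neq\emptyset\}$, the restrictions of $\sim$ and $V$ to $S'$, and the expectations $\mathit{Exp}'(s)=\mathit{Exp}(s)\backslash w$. The formulas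 of public observation logic are $\varphi ::= \top \mid p \mid \neg\varphi \mid \varphi\wedge\varphi \mid K_i\varphi \mid [\pi]\varphi$; the Boolean cases and $K_i$ (truth at all $\sim_i$-related worlds) have their usual semantics, and $\mathcal M,s\models[\pi]\varphi$ iff $\mathcal M|_w,s\models\varphi$ for all $w\in\mathcal L(\pi)\cap\mathit{prefixes}(\mathit{Exp}(s))$. The Word fragment consists of the formulas in which the expression $\pi$ of every modality $[\pi]$ is a single word, i.e. is built from actions $a\in\mathbf\Sigma$ and $\varepsilon$ by concatenation. Theorem. Model checking for the Word fragment is in $\mathsf P$: the problem of deciding, given a finite pointed epistemic expectation model $\mathcal M,s$ (finitely many worlds, finitely many true propositions at each world) and a formula $\varphi$ of the Word fragment, whether $\mathcal M,s\models\varphi$, is decidable by a deterministic Turing machine in time polynomial in the length of the input (in which the finite sets of agents and of actions are part of the input, relations are written as Boolean matrices, and the names of agents, actions, worlds and propositions are written in binary). -/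

import Mathlib

namespace POL

/-! ### Observation expressions

Observation expressions over a set `A` of actions are the regular expressions over `A`; the set of
observations of `π` is the language `π.matches'`. -/

/-- The output function: `ε` if the empty word belongs to the language of `π`, and `∅` otherwise. -/
noncomputable def output {A : Type} (π : RegularExpression A) : RegularExpression A :=
  open Classical in
  if ([] : List A) ∈ π.matches' then RegularExpression.epsilon else RegularExpression.zero

/-- The residue of an observation expression with respect to one action. -/
noncomputable def residueLetter {A : Type} : RegularExpression A → A → RegularExpression A
  | .zero, _ => .zero
  | .epsilon, _ => .zero
  | .char b, a => open Classical in if b = a then .epsilon else .zero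
  | .plus π ρ, a => .plus (residueLetter π a) (residueLetter ρ a)
  | .comp π ρ, a =>
      .plus (.comp (residueLetter π a) ρ) (.comp (output π) (residueLetter ρ a))
  | .star π, a => .comp (residueLetter π a) (.star π)

/-- The residue `π \ w` of an observation expression with respect to a word. -/
noncomputable def residue {A : Type} (π : RegularExpression A) (w : List A) :
    RegularExpression A :=
  w.foldl residueLetter π

/-- The prefixes of the words in the language of `π`. -/
def prefixes {A : Type} (π : RegularExpression A) : Set (List A) :=
  {w | ∃ v, w ++ v ∈ π.matches'}

theorem mem_output {A : Type} (π : RegularExpression A) (x : List A) :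
    x ∈ (output π).matches' ↔ x = [] ∧ ([] : List A) ∈ π.matches' := by
  unfold output
  split_ifs with h
  · simp [RegularExpression.matches', h]
  · simp [RegularExpression.matches', h]

theorem mem_residueLetter {A : Type} (π : RegularExpression A) (a : A) (v : List A) :
    v ∈ (residueLetter π a).matches' ↔ a :: v ∈ π.matches' := by
  induction π generalizing v with
  | zero => simp [residueLetter]
  | epsilon => simp [residueLetter, RegularExpression.matches']
  | char b =>
    change v ∈ (residueLetter (.char b) a).matches' ↔ a :: v ∈ ({[b]} : Set (List A))
    rw [Set.mem_singleton_iff, List.cons.injEq]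
    by_cases h : b = a
    · simp [residueLetter, RegularExpression.matches', h]
    · simp [residueLetter, RegularExpression.matches', h, Ne.symm h]
  | plus π ρ ihπ ihρ =>
    simp only [residueLetter, RegularExpression.matches', Language.add_def] at *
    exact or_congr (ihπ v) (ihρ v)
  | comp π ρ ihπ ihρ =>
    simp only [residueLetter, RegularExpression.matches']
    rw [Language.mem_add, Language.mem_mul, Language.mem_mul, Language.mem_mul]
    constructor
    · rintro (⟨x, hx, y, hy, rfl⟩ | ⟨x, hx, y, hy, rfl⟩)
      · exact ⟨a :: x, (ihπ x).1 hx, y, hy, rfl⟩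
      · obtain ⟨rfl, hnil⟩ := (mem_output π x).1 hx
        exact ⟨[], hnil, a :: y, (ihρ y).1 hy, rfl⟩
    · rintro ⟨x, hx, y, hy, hxy⟩
      cases x with
      | nil =>
        simp only [List.nil_append] at hxy
        subst hxy
        exact Or.inr ⟨[], (mem_output π []).2 ⟨rfl, hx⟩, v, (ihρ v).2 hy, rfl⟩
      | cons b x =>
        simp only [List.cons_append, List.cons.injEq] at hxy
        obtain ⟨rfl, rfl⟩ := hxy
        exact Or.inl ⟨x, (ihπ x).2 hx, y, hy, rfl⟩
  | star π ih =>
    simp only [residueLetter, RegularExpression.matches']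
    rw [Language.mem_mul]
    constructor
    · rintro ⟨x, hx, y, hy, rfl⟩
      obtain ⟨L, rfl, hL⟩ := Language.mem_kstar.1 hy
      refine Language.mem_kstar.2 ⟨(a :: x) :: L, rfl, ?_⟩
      intro z hz
      rcases List.mem_cons.1 hz with rfl | hz
      · exact (ih x).1 hx
      · exact hL z hz
    · intro h
      obtain ⟨L, hL, hmem⟩ := Language.mem_kstar_iff_exists_nonempty.1 h
      cases L with
      | nil => simp at hL
      | cons z L =>
        obtain ⟨hz, hzne⟩ := hmem z (by simp)
        cases z with
        | nil => exact absurd rfl hzne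
        | cons b z =>
          simp only [List.flatten_cons, List.cons_append, List.cons.injEq] at hL
          obtain ⟨rfl, rfl⟩ := hL
          refine ⟨z, (ih z).2 hz, L.flatten, Language.mem_kstar.2 ⟨L, rfl, ?_⟩, rfl⟩
          intro y hy
          exact (hmem y (by simp [hy])).1

theorem mem_residue {A : Type} (π : RegularExpression A) (w v : List A) :
    v ∈ (residue π w).matches' ↔ w ++ v ∈ π.matches' := by
  induction w generalizing π with
  | nil => simp [residue]
  | cons a w ih =>
    have h := ih (residueLetter π a)
    rw [mem_residueLetter] at h
    exact h

/-- A word is a prefix of an expected observation iff the residue is not empty. -/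
theorem mem_prefixes_iff {A : Type} (π : RegularExpression A) (w : List A) :
    w ∈ prefixes π ↔ ∃ v, v ∈ (residue π w).matches' := by
  simp [prefixes, mem_residue]

/-! ### Epistemic expectation models -/

/-- An epistemic expectation model with agents `I`, propositions `P`, actions `A`, and with set of
worlds `S`.  That `S` is non-empty is witnessed by the point of a pointed model. -/
structure Model (I P A S : Type) where
  /-- the accessibility relation of each agent -/
  rel : I → S → S → Prop
  rel_equiv : ∀ i, Equivalence (rel i)
  /-- the valuation -/
  val : S → Set P
  /-- the expected observations -/
  exp : S → RegularExpression A
  exp_nonempty : ∀ s, ∃ v, v ∈ (exp s).matches'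

/-- The worlds of `M` that survive the observation of `w`. -/
def Model.Survivors {I P A S : Type} (M : Model I P A S) (w : List A) : Type :=
  {s : S // ∃ v, v ∈ (residue (M.exp s) w).matches'}

/-- The updated model `M|_w`. -/
noncomputable def Model.update {I P A S : Type} (M : Model I P A S) (w : List A) :
    Model I P A (M.Survivors w) where
  rel i s t := M.rel i s.1 t.1
  rel_equiv i :=
    ⟨fun s => (M.rel_equiv i).refl s.1, fun h => (M.rel_equiv i).symm h,
      fun h h' => (M.rel_equiv i).trans h h'⟩
  val s := M.val s.1
  exp s := residue (M.exp s.1) w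
  exp_nonempty s := s.2

/-! ### Public observation logic -/

/-- Formulas of public observation logic. -/
inductive Formula (I P A : Type) : Type where
  | top : Formula I P A
  | prop (p : P) : Formula I P A
  | neg (φ : Formula I P A) : Formula I P A
  | and (φ ψ : Formula I P A) : Formula I P A
  | know (i : I) (φ : Formula I P A) : Formula I P A
  | box (π : RegularExpression A) (φ : Formula I P A) : Formula I P A

/-- `Holds φ M s` says that `φ` is true at the world `s` of `M`. -/
def Holds {I P A : Type} : Formula I P A → {S : Type} → Model I P A S → S → Prop
  | .top, _, _, _ => True
  | .prop p, _, M, s => p ∈ M.val s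
  | .neg φ, _, M, s => ¬ Holds φ M s
  | .and φ ψ, _, M, s => Holds φ M s ∧ Holds ψ M s
  | .know i φ, _, M, s => ∀ t, M.rel i s t → Holds φ M t
  | .box π φ, _, M, s => ∀ w, w ∈ π.matches' → ∀ h : w ∈ prefixes (M.exp s),
      Holds φ (M.update w) ⟨s, (mem_prefixes_iff (M.exp s) w).1 h⟩

/-- The observation expressions that are a single word: they are built from actions and `ε` by
concatenation. -/
inductive IsWordExpr {A : Type} : RegularExpression A → Prop where
  | char (a : A) : IsWordExpr (.char a)
  | epsilon : IsWordExpr .epsilon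
  | comp {π ρ : RegularExpression A} :
      IsWordExpr π → IsWordExpr ρ → IsWordExpr (.comp π ρ)

/-- The word fragment: the expression in every modality is a single word. -/
def Formula.IsWord {I P A : Type} : Formula I P A → Prop
  | .top => True
  | .prop _ => True
  | .neg φ => φ.IsWord
  | .and φ ψ => φ.IsWord ∧ ψ.IsWord
  | .know _ φ => φ.IsWord
  | .box π φ => IsWordExpr π ∧ φ.IsWord

/-! ### Instances of the model checking problem and their encoding as strings -/

/-- An instance of the model checking problem: finitely many agents, actions and worlds, a model
over them, given by the matrices of the accessibility relations, by the list of the propositions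
that are true at each world and by the expectation at each world, a world of that model, and a
formula.  The set of propositions is `ℕ`. -/
structure Instance where
  numAgents : ℕ
  numActions : ℕ
  numWorlds : ℕ
  rel : Fin numAgents → Fin numWorlds → Fin numWorlds → Bool
  rel_equiv : ∀ i, Equivalence (fun s t => rel i s t = true)
  val : Fin numWorlds → List ℕ
  exp : Fin numWorlds → RegularExpression (Fin numActions)
  exp_nonempty : ∀ s, ∃ v, v ∈ (exp s).matches'
  point : Fin numWorlds
  formula : Formula (Fin numAgents) ℕ (Fin numActions)

/-- The epistemic expectation model of an instance. -/
def Instance.model (X : Instance) :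
    Model (Fin X.numAgents) ℕ (Fin X.numActions) (Fin X.numWorlds) where
  rel i s t := X.rel i s t = true
  rel_equiv := X.rel_equiv
  val s := {p | p ∈ X.val s}
  exp := X.exp
  exp_nonempty := X.exp_nonempty

/-- The alphabet in which instances are written. -/
inductive Token : Type where
  | bit (b : Bool)
  | fin
  | zero | epsilon | char | plus | comp | star
  | top | prop | neg | and | know | box

/-- Numbers are written in binary (least significant bit first), followed by an end marker. -/
def encodeNumber (n : ℕ) : List Token :=
  n.bits.map Token.bit ++ [Token.fin]

/-- Observation expressions are written in Polish notation. -/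
def encodeExpr {k : ℕ} : RegularExpression (Fin k) → List Token
  | .zero => [.zero]
  | .epsilon => [.epsilon]
  | .char a => .char :: encodeNumber a
  | .plus π ρ => .plus :: (encodeExpr π ++ encodeExpr ρ)
  | .comp π ρ => .comp :: (encodeExpr π ++ encodeExpr ρ)
  | .star π => .star :: encodeExpr π

/-- Formulas are written in Polish notation. -/
def encodeFormula {m k : ℕ} : Formula (Fin m) ℕ (Fin k) → List Token
  | .top => [.top]
  | .prop p => .prop :: encodeNumber p
  | .neg φ => .neg :: encodeFormula φ
  | .and φ ψ => .and :: (encodeFormula φ ++ encodeFormula ψ)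
  | .know i φ => .know :: (encodeNumber i ++ encodeFormula φ)
  | .box π φ => .box :: (encodeExpr π ++ encodeFormula φ)

/-- The string of an instance: the numbers of agents, actions and worlds, the matrices of the
relations row by row, the true propositions and the expectation of each world, the distinguished
world, and the formula. -/
def Instance.encode (X : Instance) : List Token :=
  encodeNumber X.numAgents ++ encodeNumber X.numActions ++ encodeNumber X.numWorlds ++
  ((List.finRange X.numAgents).flatMap fun i =>
    (List.finRange X.numWorlds).flatMap fun s =>
      (List.finRange X.numWorlds).map fun t => Token.bit (X.rel i s t)) ++
  ((List.finRange X.numWorlds).flatMap fun s =>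
    ((X.val s).flatMap fun p => Token.prop :: encodeNumber p) ++ encodeExpr (X.exp s)) ++
  encodeNumber X.point ++ encodeFormula X.formula

/-- The model checking problem for the word fragment, as a language: the strings of the instances
`(M, s, φ)` in which `φ` belongs to the word fragment and is true at the world `s` of `M`. -/
def wordModelChecking : Language Token :=
  {x | ∃ X : Instance, X.formula.IsWord ∧ Holds X.formula X.model X.point ∧ X.encode = x}

/-! ### The class P -/

/-- A language is in P if some Turing machine decides membership, of any string, within a number of
steps that is polynomial in the length of the string. -/
def InP {Γ : Type} (L : Language Γ) : Prop :=
  open Classical in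
  Nonempty (Turing.TM2ComputableInPolyTime (fun x : List Γ => x) Computability.encodeBool
    (fun x : List Γ => decide (x ∈ L)))

end POL

namespace POL
open Turing Function

/-! ### Stack programs -/

/-! A word expression denotes exactly one word, so `[π]φ` calls for a single update `M|_w` and no
enumeration of observations. A recursion along the formula carries one residual expectation for
every original world and returns the vector of truth values at all worlds. Two points need care: the
residuals must stay small, and the disappearance of worlds must not disturb the indexing.

Unsimplified residues can grow exponentially with the word. An expectation is therefore kept as a
syntax tree whose letter occurrences carry marks, together with a flag for its beginning; a marked
occurrence is one whose letter has just been read. Reading a letter only moves marks (`Term.shift`),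
so the size never changes (`sz_shift`), while the words readable from the marks form the residual
language (`Term.mem_resid_shift`, `State.mem_lang_steps`). Survival of a world is non-emptiness of
that language, which a structural recursion decides (`State.alive_iff`). Worlds that have been
deleted remain in the vectors with dead states, and `restrict` counts them as true: this is the
vacuous truth of `K_i` and `[π]` there. `eval_correct` shows that the vectors are right at the
surviving worlds.

To obtain genuine machine time, structured stack programs are compiled to multi-stack machines
(`Run.steps`). All data are binary trees, serialised on one stack, and `Poly f` says that a program
replaces the topmost tree by its image under `f` in polynomial time, whatever lies below. Such
functions are closed under composition, pairing, case distinction and loops with polynomially many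
rounds and polynomially large states (`Poly.loop`), hence under folds (`Poly.foldl`) and structural
recursion (`Poly.termRec`) with controlled sizes. The decision procedure is a composite of these.

The input may be any string. Parsing is total, and a string is accepted only if the components that
were read encode back to it, pass the syntactic and semantic checks, and evaluate to true
(`check_iff`). -/

/-- Binary trees whose leaves carry tokens: the values handled by stack programs. -/
inductive Tree : Type where
  | leaf (t : Token)
  | node (l r : Tree)

namespace Tree

/-- The number of nodes and leaves. -/
def size : Tree → ℕ
  | leaf _ => 1
  | node l r => l.size + r.size + 1

/-- Trees in Polish notation; `none` stands for an inner node. -/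
def ser : Tree → List (Option Token)
  | leaf t => [some t]
  | node l r => none :: (l.ser ++ r.ser)

theorem length_ser (x : Tree) : x.ser.length = x.size := by
  induction x with
  | leaf => rfl
  | node l r ihl ihr => simp [ser, size, ihl, ihr]

theorem size_pos (x : Tree) : 0 < x.size := by
  cases x <;> simp [size]

end Tree

/-- The stacks: input, output, a main stack of serialised trees, a unary counter, and two
auxiliary stacks. -/
inductive Stack : Type where
  | input | output | main | count | aux (b : Bool)
  deriving DecidableEq

/-- The alphabet of each stack. -/
@[reducible] def Symbol : Stack → Type
  | .input => Token
  | .output => Bool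
  | _ => Option Token

/-- The register holds the last symbol that was read, if there was one. -/
abbrev Reg := Option (Option Token)

/-- The contents of all stacks. -/
abbrev Mem := ∀ k, List (Symbol k)

/-- Structured stack programs. -/
inductive Prog : Type where
  | skip
  | push (k : Stack) (f : Reg → Symbol k)
  | pop (k : Stack) (f : Option (Symbol k) → Reg)
  | peek (k : Stack) (f : Option (Symbol k) → Reg)
  | seq (p q : Prog)
  | ite (c : Reg → Bool) (p q : Prog)
  | loop (c : Reg → Bool) (p : Prog)

/-- `Run p v S v' S' t`: from the register `v` and the stacks `S`, the program `p` reaches `v'`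
and `S'` in `t` steps. -/
inductive Run : Prog → Reg → Mem → Reg → Mem → ℕ → Prop
  | skip {v S} : Run .skip v S v S 1
  | push {k f v S} : Run (.push k f) v S v (update S k (f v :: S k)) 1
  | pop {k f v S} : Run (.pop k f) v S (f (S k).head?) (update S k (S k).tail) 1
  | peek {k f v S} : Run (.peek k f) v S (f (S k).head?) S 1
  | seq {p q v S v' S' v'' S'' t t'} :
      Run p v S v' S' t → Run q v' S' v'' S'' t' → Run (.seq p q) v S v'' S'' (t + t')
  | iteTrue {c p q v S v' S' t} :
      c v = true → Run p v S v' S' t → Run (.ite c p q) v S v' S' (1 + t)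
  | iteFalse {c p q v S v' S' t} :
      c v = false → Run q v S v' S' t → Run (.ite c p q) v S v' S' (1 + t)
  | loopDone {c p v S} : c v = false → Run (.loop c p) v S v S 1
  | loopStep {c p v S v' S' v'' S'' t t'} :
      c v = true → Run p v S v' S' t → Run (.loop c p) v' S' v'' S'' t' →
      Run (.loop c p) v S v'' S'' (1 + t + t')

namespace Prog

/-- The labels of the machine code of a program. -/
def Label : Prog → Type
  | skip => Unit
  | push _ _ => Unit
  | pop _ _ => Unit
  | peek _ _ => Unit
  | seq p q => p.Label ⊕ q.Label
  | ite _ p q => Option (p.Label ⊕ q.Label)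
  | loop _ p => Option p.Label

instance Label.finite : ∀ p : Prog, Finite p.Label
  | skip => inferInstanceAs (Finite Unit)
  | push _ _ => inferInstanceAs (Finite Unit)
  | pop _ _ => inferInstanceAs (Finite Unit)
  | peek _ _ => inferInstanceAs (Finite Unit)
  | seq p q =>
      have := Label.finite p
      have := Label.finite q
      inferInstanceAs (Finite (p.Label ⊕ q.Label))
  | ite _ p q =>
      have := Label.finite p
      have := Label.finite q
      inferInstanceAs (Finite (Option (p.Label ⊕ q.Label)))
  | loop _ p =>
      have := Label.finite p
      inferInstanceAs (Finite (Option p.Label))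

/-- The label where a program starts. -/
def entry : (p : Prog) → p.Label
  | skip => ()
  | push _ _ => ()
  | pop _ _ => ()
  | peek _ _ => ()
  | seq p _ => Sum.inl p.entry
  | ite _ _ _ => none
  | loop _ _ => none

/-- The machine code of a program, with its labels embedded in a type `Λ` by `e`, that continues
at the label `x`. -/
def code {Λ : Type} : (p : Prog) → (e : p.Label → Λ) → (x : Λ) → p.Label → TM2.Stmt Symbol Λ Reg
  | skip, _, x, _ => .goto fun _ => x
  | push k f, _, x, _ => .push k f (.goto fun _ => x)
  | pop k f, _, x, _ => .pop k (fun _ => f) (.goto fun _ => x)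
  | peek k f, _, x, _ => .peek k (fun _ => f) (.goto fun _ => x)
  | seq p q, e, _, .inl l => p.code (fun l => e (.inl l)) (e (.inr q.entry)) l
  | seq _ q, e, x, .inr l => q.code (fun l => e (.inr l)) x l
  | ite c p q, e, _, none =>
      .branch c (.goto fun _ => e (some (.inl p.entry))) (.goto fun _ => e (some (.inr q.entry)))
  | ite _ p _, e, x, some (.inl l) => p.code (fun l => e (some (.inl l))) x l
  | ite _ _ q, e, x, some (.inr l) => q.code (fun l => e (some (.inr l))) x l
  | loop c p, e, x, none => .branch c (.goto fun _ => e (some p.entry)) (.goto fun _ => x)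
  | loop _ p, e, _, some l => p.code (fun l => e (some l)) (e none) l

end Prog

/-! ### Simulation of stack programs by multi-stack machines. -/

/-- The machine code of a program simulates the program. -/
theorem Run.steps {Λ : Type} (M : Λ → TM2.Stmt Symbol Λ Reg) {p : Prog} {v v' : Reg} {S S' : Mem}
    {t : ℕ} (h : Run p v S v' S' t) (e : p.Label → Λ) (x : Λ)
    (hM : ∀ l, M (e l) = p.code e x l) :
    (flip bind (TM2.step M))^[t] (some ⟨some (e p.entry), v, S⟩) = some ⟨some x, v', S'⟩ := by
  have one : ∀ (l : Λ) (v : Reg) (S : Mem),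
      flip bind (TM2.step M) (some ⟨some l, v, S⟩) = some (TM2.stepAux (M l) v S) :=
    fun _ _ _ => rfl
  induction h generalizing x with
  | skip | push | pop | peek =>
    rw [iterate_one, one, hM]
    rfl
  | @seq p q _ _ _ _ _ _ t t' _ _ ih ih' =>
    rw [add_comm, iterate_add_apply]
    have h1 := ih (fun l => e (.inl l)) (e (.inr q.entry)) (fun l => hM (.inl l))
    have h2 := ih' (fun l => e (.inr l)) x (fun l => hM (.inr l))
    exact (congrArg _ h1).trans h2
  | @iteTrue c p q v _ _ _ _ hc _ ih =>
    rw [add_comm, iterate_add_apply, iterate_one, one, hM]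
    have h1 := ih (fun l => e (some (.inl l))) x (fun l => hM (some (.inl l)))
    simpa [Prog.code, Prog.entry, hc] using h1
  | @iteFalse c p q v _ _ _ _ hc _ ih =>
    rw [add_comm, iterate_add_apply, iterate_one, one, hM]
    have h1 := ih (fun l => e (some (.inr l))) x (fun l => hM (some (.inr l)))
    simpa [Prog.code, Prog.entry, hc] using h1
  | loopDone hc =>
    rw [iterate_one, one, hM]
    simp [Prog.code, Prog.entry, hc]
  | @loopStep c p _ _ _ _ _ _ t t' hc _ _ ih ih' =>
    rw [add_comm, iterate_add_apply, add_comm, iterate_add_apply, iterate_one, one, hM]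
    -- The body continues at the loop head `e none`, so what follows it is again a run of the whole
    -- loop with the same embedding and the same exit.
    have h1 := ih (fun l => e (some l)) (e none) (fun l => hM (some l))
    have h2 := ih' e x hM
    simp only [Prog.code, Prog.entry, TM2.stepAux, hc, cond_true]
    exact (congrArg _ h1).trans h2

/-- `Exec p S S' t`: from the stacks `S`, whatever the register holds, the program `p` reaches the
stacks `S'` in at most `t` steps. -/
def Exec (p : Prog) (S S' : Mem) (t : ℕ) : Prop :=
  ∀ v, ∃ v' t', t' ≤ t ∧ Run p v S v' S' t'

theorem Exec.mono {p : Prog} {S S' : Mem} {t t' : ℕ} (h : Exec p S S' t) (ht : t ≤ t') :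
    Exec p S S' t' := fun v => by
  obtain ⟨v', s, hs, hr⟩ := h v
  exact ⟨v', s, hs.trans ht, hr⟩

theorem Exec.seq {p q : Prog} {S S' S'' : Mem} {t t' : ℕ} (h : Exec p S S' t)
    (h' : Exec q S' S'' t') : Exec (.seq p q) S S'' (t + t') := fun v => by
  obtain ⟨v', s, hs, hr⟩ := h v
  obtain ⟨v'', s', hs', hr'⟩ := h' v'
  exact ⟨v'', s + s', by lia, hr.seq hr'⟩

/-! ### The stack layout -/

/-- The stacks with empty input and output. -/
def mem (m c a b : List (Option Token)) : Mem
  | .input => []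
  | .output => []
  | .main => m
  | .count => c
  | .aux false => a
  | .aux true => b

section
variable (m c a b x : List (Option Token))

@[simp] theorem mem_main : mem m c a b .main = m := rfl
@[simp] theorem mem_count : mem m c a b .count = c := rfl
@[simp] theorem mem_aux_false : mem m c a b (.aux false) = a := rfl
@[simp] theorem mem_aux_true : mem m c a b (.aux true) = b := rfl

@[simp] theorem update_main : update (mem m c a b) .main x = mem x c a b := by
  funext k; rcases k with _ | _ | _ | _ | _ | _ <;> rfl

@[simp] theorem update_count : update (mem m c a b) .count x = mem m x a b := by
  funext k; rcases k with _ | _ | _ | _ | _ | _ <;> rfl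

@[simp] theorem update_aux_false : update (mem m c a b) (.aux false) x = mem m c x b := by
  funext k; rcases k with _ | _ | _ | _ | _ | _ <;> rfl

@[simp] theorem update_aux_true : update (mem m c a b) (.aux true) x = mem m c a x := by
  funext k; rcases k with _ | _ | _ | _ | _ | _ <;> rfl

end

/-- The main stack with everything else empty. -/
def onMain (m : List (Option Token)) : Mem := mem m [] [] []

namespace Prog

/-- Push a fixed symbol on the main stack. -/
def pushMain (s : Option Token) : Prog := push .main fun _ => s

/-- The register's symbol. -/
def regSymbol (v : Reg) : Option Token := v.getD none

/-- Pop the symbols of an auxiliary stack and run a program on each of them. -/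
def drain (b : Bool) (p : Prog) : Prog :=
  .seq (pop (.aux b) id) (loop Option.isSome (.seq p (pop (.aux b) id)))

/-- Move an auxiliary stack back to the main stack. -/
def restore (b : Bool) : Prog := drain b (push .main regSymbol)

/-- As `restore false`, with a copy on the second auxiliary stack. -/
def restoreCopy : Prog :=
  drain false (.seq (push .main regSymbol) (push (.aux true) regSymbol))

/-- Move the second auxiliary stack to the first. -/
def auxMove : Prog := drain true (push (.aux false) regSymbol)

/-- Empty the first auxiliary stack. -/
def auxClear : Prog := drain false skip

/-- The body of the loop that moves a tree from the main stack to an auxiliary one. -/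
def lift (b : Bool) : Prog :=
  .seq (pop .main id) (.seq (push (.aux b) regSymbol)
    (.seq (ite (fun v => (regSymbol v).isSome) (pop .count id) (push .count fun _ => none))
      (peek .count id)))

/-- Move the top tree of the main stack to an auxiliary stack, in reverse. -/
def moveTop (b : Bool) : Prog :=
  .seq (push .count fun _ => none) (.seq (peek .count id) (loop Option.isSome (lift b)))

/-- Duplicate the top tree. -/
def dup : Prog := .seq (moveTop false) (.seq restoreCopy (.seq auxMove (restore false)))

/-- Exchange the two top trees. -/
def swap : Prog :=
  .seq (moveTop false) (.seq (moveTop true) (.seq (restore false) (restore true)))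

/-- Remove the top tree. -/
def drop : Prog := .seq (moveTop false) auxClear

end Prog

/-! ### Running times of the stack operations on trees. -/

open Prog

/-- Draining a stack: in `F a d` the stack holds `a`, and `d` has been treated. -/
theorem drain_exec {b : Bool} {p : Prog} {k : ℕ} (F : List (Option Token) → List (Option Token) → Mem)
    (hF : ∀ a d, F a d (.aux b) = a) (hpop : ∀ a a' d, update (F a d) (.aux b) a' = F a' d)
    (hp : ∀ x a d, Run p (some x) (F a d) (some x) (F a (x :: d)) k)
    (a d : List (Option Token)) :
    Exec (drain b p) (F a d) (F [] (a.reverse ++ d)) ((k + 2) * a.length + 2) := by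
  intro v
  have pop' : ∀ v a d, Run (pop (.aux b) id) v (F a d) a.head? (F a.tail d) 1 := by
    intro v a d
    have := Run.pop (k := .aux b) (f := id) (v := v) (S := F a d)
    rwa [hF, hpop] at this
  suffices h : ∀ a d : List (Option Token), ∃ v', Run (loop Option.isSome (.seq p (pop (.aux b) id)))
      a.head? (F a.tail d) v' (F [] (a.reverse ++ d)) ((k + 2) * a.length + 1) by
    obtain ⟨v', h⟩ := h a d
    exact ⟨v', _, le_of_eq (by ring), (pop' v a d).seq h⟩
  intro a
  induction a with
  | nil => exact fun d => ⟨none, Run.loopDone rfl⟩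
  | cons x a ih =>
    intro d
    obtain ⟨v', h⟩ := ih (x :: d)
    refine ⟨v', ?_⟩
    have := Run.loopStep (c := Option.isSome) rfl ((hp x a d).seq (pop' _ a (x :: d))) h
    rw [List.reverse_cons, List.append_assoc, List.length_cons]
    exact (by ring : 1 + (k + 1) + ((k + 2) * a.length + 1) = (k + 2) * (a.length + 1) + 1) ▸ this

theorem restore_false_exec (m c a b : List (Option Token)) :
    Exec (restore false) (mem m c a b) (mem (a.reverse ++ m) c [] b) (3 * a.length + 2) := by
  have h := drain_exec (b := false) (p := push .main regSymbol) (k := 1)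
    (fun a d => mem (d ++ m) c a b) (fun _ _ => rfl) (by simp) (fun x a d => by
      simpa [regSymbol] using
        Run.push (k := .main) (f := regSymbol) (v := some x) (S := mem (d ++ m) c a b))
    a []
  rwa [List.append_nil] at h

theorem restore_true_exec (m c a b : List (Option Token)) :
    Exec (restore true) (mem m c a b) (mem (b.reverse ++ m) c a []) (3 * b.length + 2) := by
  have h := drain_exec (b := true) (p := push .main regSymbol) (k := 1)
    (fun b d => mem (d ++ m) c a b) (fun _ _ => rfl) (by simp) (fun x b d => by
      simpa [regSymbol] using
        Run.push (k := .main) (f := regSymbol) (v := some x) (S := mem (d ++ m) c a b))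
    b []
  rwa [List.append_nil] at h

theorem restoreCopy_exec (m c a b : List (Option Token)) :
    Exec restoreCopy (mem m c a b) (mem (a.reverse ++ m) c [] (a.reverse ++ b))
      (4 * a.length + 2) := by
  have h := drain_exec (b := false) (p := .seq (push .main regSymbol) (push (.aux true) regSymbol))
    (k := 2) (fun a d => mem (d ++ m) c a (d ++ b)) (fun _ _ => rfl) (by simp) (fun x a d => by
      simpa [regSymbol] using
        (Run.push (k := .main) (f := regSymbol) (v := some x) (S := mem (d ++ m) c a (d ++ b))).seq
          (Run.push (k := .aux true) (f := regSymbol))) a []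
  rwa [List.append_nil] at h

theorem auxMove_exec (m c a b : List (Option Token)) :
    Exec auxMove (mem m c a b) (mem m c (b.reverse ++ a) []) (3 * b.length + 2) := by
  have h := drain_exec (b := true) (p := push (.aux false) regSymbol) (k := 1)
    (fun b d => mem m c (d ++ a) b) (fun _ _ => rfl) (by simp) (fun x b d => by
      simpa [regSymbol] using
        Run.push (k := .aux false) (f := regSymbol) (v := some x) (S := mem m c (d ++ a) b)) b []
  rwa [List.append_nil] at h

theorem auxClear_exec (m c a b : List (Option Token)) :
    Exec auxClear (mem m c a b) (mem m c [] b) (3 * a.length + 2) :=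
  drain_exec (fun a _ => mem m c a b) (by simp) (by simp) (fun _ _ _ => Run.skip) a []

/-- One round of `lift b`; in `F m c a` the three lists are on the main stack, the counter and the
auxiliary stack. -/
theorem lift_run {b : Bool} (F : List (Option Token) → List (Option Token) →
      List (Option Token) → Mem)
    (hm : ∀ m c a, F m c a .main = m) (hc : ∀ m c a, F m c a .count = c)
    (ha : ∀ m c a, F m c a (.aux b) = a)
    (hm' : ∀ m c a m', update (F m c a) .main m' = F m' c a)
    (hc' : ∀ m c a c', update (F m c a) .count c' = F m c' a)
    (ha' : ∀ m c a a', update (F m c a) (.aux b) a' = F m c a')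
    (s : Option Token) (m c a : List (Option Token)) (v : Reg) :
    Run (lift b) v (F (s :: m) c a) (if s.isSome then c.tail.head? else some none)
      (F m (if s.isSome then c.tail else none :: c) (s :: a)) 5 := by
  have h1 := Run.pop (k := .main) (f := id) (v := v) (S := F (s :: m) c a)
  have h2 := Run.push (k := .aux b) (f := regSymbol) (v := some s) (S := F m c a)
  have h3 := Run.pop (k := .count) (f := id) (v := some s) (S := F m c (s :: a))
  have h4 := Run.push (k := .count) (f := fun _ => none) (v := some s) (S := F m c (s :: a))
  have h5 := fun v c => Run.peek (k := .count) (f := id) (v := v) (S := F m c (s :: a))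
  rw [hm, hm'] at h1
  rw [ha, ha'] at h2
  rw [hc, hc'] at h3 h4
  simp only [hc] at h5
  cases s with
  | none => exact h1.seq (h2.seq ((Run.iteFalse rfl h4).seq (h5 _ _)))
  | some s => exact h1.seq (h2.seq ((Run.iteTrue rfl h3).seq (h5 _ _)))

/-- Moving a tree from the main stack to an auxiliary one. -/
theorem moveTop_exec {b : Bool} (F : List (Option Token) → List (Option Token) →
      List (Option Token) → Mem)
    (hm : ∀ m c a, F m c a .main = m) (hc : ∀ m c a, F m c a .count = c)
    (ha : ∀ m c a, F m c a (.aux b) = a)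
    (hm' : ∀ m c a m', update (F m c a) .main m' = F m' c a)
    (hc' : ∀ m c a c', update (F m c a) .count c' = F m c' a)
    (ha' : ∀ m c a a', update (F m c a) (.aux b) a' = F m c a')
    (x : Tree) (m a : List (Option Token)) :
    Exec (moveTop b) (F (x.ser ++ m) [] a) (F m [] (x.ser.reverse ++ a)) (6 * x.size + 3) := by
  -- The counter holds, in unary, the number of trees still to be moved: an inner node turns one
  -- pending tree into two, a leaf settles one. The claim is stated for the rest of the loop, so
  -- that the two subtrees of a node can be chained. Each symbol costs 6 steps: the loop test and
  -- the 5 steps of `lift`.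
  have key : ∀ (x : Tree) (m c a : List (Option Token)) (v' : Reg) (S' : Mem) (t : ℕ),
      Run (loop Option.isSome (lift b)) c.head? (F m c (x.ser.reverse ++ a)) v' S' t →
      Run (loop Option.isSome (lift b)) (some none) (F (x.ser ++ m) (none :: c) a) v' S'
        (6 * x.size + t) := by
    intro x
    induction x with
    | leaf s =>
      intro m c a v' S' t h
      exact Run.loopStep rfl (lift_run F hm hc ha hm' hc' ha' (some s) m (none :: c) a _) h
    | node l r ihl ihr =>
      intro m c a v' S' t h
      have h1 := ihr m c (l.ser.reverse ++ none :: a) v' S' t (by simpa [Tree.ser] using h)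
      have h2 := ihl (r.ser ++ m) (none :: c) (none :: a) v' S' _ h1
      have h3 := Run.loopStep (c := Option.isSome) rfl
        (lift_run F hm hc ha hm' hc' ha' none (l.ser ++ (r.ser ++ m)) (none :: c) a (some none)) h2
      have e : 1 + 5 + (6 * l.size + (6 * r.size + t)) = 6 * (Tree.node l r).size + t := by
        simp only [Tree.size]; ring
      rw [e] at h3
      simpa [Tree.ser] using h3
  intro v
  have h1 := Run.push (k := .count) (f := fun _ => none) (v := v) (S := F (x.ser ++ m) [] a)
  have h2 := Run.peek (k := .count) (f := id) (v := v) (S := F (x.ser ++ m) [none] a)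
  rw [hc, hc'] at h1
  rw [hc] at h2
  exact ⟨none, _, le_of_eq (by ring), h1.seq (h2.seq (key x m [] a none _ 1 (Run.loopDone rfl)))⟩

/-- Each transfer between stacks reverses the string. The second copy makes an even number of
transfers in total, so both copies end up in the right order. -/
theorem dup_exec (x : Tree) (m : List (Option Token)) :
    Exec dup (onMain (x.ser ++ m)) (onMain (x.ser ++ (x.ser ++ m))) (16 * x.size + 9) := by
  have h1 := moveTop_exec (b := false) (fun m c a => mem m c a []) (by simp) (by simp) (by simp)
    (by simp) (by simp) (by simp) x m []
  have h2 := restoreCopy_exec m [] (x.ser.reverse) []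
  have h3 := auxMove_exec (x.ser ++ m) [] [] x.ser
  have h4 := restore_false_exec (x.ser ++ m) [] x.ser.reverse []
  simp only [List.append_nil, List.reverse_reverse, List.length_reverse, Tree.length_ser]
    at h1 h2 h3 h4
  exact (h1.seq (h2.seq (h3.seq h4))).mono (by lia)

/-- The two trees wait on different auxiliary stacks, so they can be put back in either order. -/
theorem swap_exec (x y : Tree) (m : List (Option Token)) :
    Exec swap (onMain (x.ser ++ (y.ser ++ m))) (onMain (y.ser ++ (x.ser ++ m)))
      (9 * (x.size + y.size) + 10) := by
  have h1 := moveTop_exec (b := false) (fun m c a => mem m c a []) (by simp) (by simp) (by simp)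
    (by simp) (by simp) (by simp) x (y.ser ++ m) []
  have h2 := moveTop_exec (b := true) (fun m c b => mem m c x.ser.reverse b) (by simp) (by simp)
    (by simp) (by simp) (by simp) (by simp) y m []
  have h3 := restore_false_exec m [] x.ser.reverse y.ser.reverse
  have h4 := restore_true_exec (x.ser ++ m) [] [] y.ser.reverse
  simp only [List.append_nil, List.reverse_reverse, List.length_reverse, Tree.length_ser]
    at h1 h2 h3 h4
  exact (h1.seq (h2.seq (h3.seq h4))).mono (by lia)

theorem drop_exec (x : Tree) (m : List (Option Token)) :
    Exec drop (onMain (x.ser ++ m)) (onMain m) (9 * x.size + 5) := by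
  have h1 := moveTop_exec (b := false) (fun m c a => mem m c a []) (by simp) (by simp) (by simp)
    (by simp) (by simp) (by simp) x m []
  have h2 := auxClear_exec m [] x.ser.reverse []
  simp only [List.append_nil, List.length_reverse, Tree.length_ser] at h1 h2
  exact (h1.seq h2).mono (by lia)

end POL

namespace POL
open Turing Function

/-! ### Functions computed by stack programs in polynomial time -/

/-- Values of the type `α` are represented by trees. -/
class Code (α : Type) where
  enc : α → Tree

open Code

/-- The size of the representation of a value. -/
def sz {α : Type} [Code α] (a : α) : ℕ := (enc a : Tree).size

instance : Code Tree := ⟨id⟩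
instance : Code Token := ⟨.leaf⟩
instance : Code Bool := ⟨fun b => .leaf (.bit b)⟩
instance {α β : Type} [Code α] [Code β] : Code (α × β) := ⟨fun x => .node (enc x.1) (enc x.2)⟩

/-- Lists are right combs that end with `Token.fin`. -/
def encList {α : Type} [Code α] : List α → Tree
  | [] => .leaf .fin
  | a :: l => .node (enc a) (encList l)

instance {α : Type} [Code α] : Code (List α) := ⟨encList⟩

section
variable {α β : Type} [Code α] [Code β]

theorem sz_pos (a : α) : 0 < sz a := Tree.size_pos _

@[simp] theorem sz_token (t : Token) : sz t = 1 := rfl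
@[simp] theorem sz_bool (b : Bool) : sz b = 1 := rfl
@[simp] theorem sz_pair (x : α × β) : sz x = sz x.1 + sz x.2 + 1 := rfl
@[simp] theorem sz_nil : sz ([] : List α) = 1 := rfl
@[simp] theorem sz_cons (a : α) (l : List α) : sz (a :: l) = sz a + sz l + 1 := rfl

@[simp] theorem sz_append (l l' : List α) : sz (l ++ l') + 1 = sz l + sz l' := by
  induction l with
  | nil => simp [add_comm]
  | cons a l ih => simp only [List.cons_append, sz_cons]; lia

theorem length_lt_sz (l : List α) : l.length < sz l := by
  induction l with
  | nil => simp
  | cons a l ih => simp; lia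

theorem sz_le_of_mem {a : α} {l : List α} (h : a ∈ l) : sz a ≤ sz l := by
  induction h with
  | head => simp; lia
  | tail _ _ ih => simp; lia

/-- The size of a list all of whose members are bounded. -/
theorem sz_list_le {l : List α} {B : ℕ} (h : ∀ a ∈ l, sz a ≤ B) :
    sz l ≤ l.length * (B + 1) + 1 := by
  induction l with
  | nil => simp
  | cons a l ih =>
    have h1 := h a (by simp)
    have h2 := ih fun b hb => h b (by simp [hb])
    simp only [sz_cons, List.length_cons]
    linarith [add_mul l.length 1 (B + 1)]

end

theorem eval_mono (q : Polynomial ℕ) {m n : ℕ} (h : m ≤ n) : q.eval m ≤ q.eval n := by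
  induction q using Polynomial.induction_on' with
  | add p q hp hq => simpa using add_le_add hp hq
  | monomial k a => simpa using Nat.mul_le_mul_left a (Nat.pow_le_pow_left h k)

/-- `f` is computed by a stack program in time polynomial in the size of the argument. -/
def Poly {α β : Type} [Code α] [Code β] (f : α → β) : Prop :=
  ∃ (p : Prog) (q : Polynomial ℕ), ∀ a, sz (f a) ≤ q.eval (sz a) ∧
    ∀ m, Exec p (onMain ((enc a).ser ++ m)) (onMain ((enc (f a)).ser ++ m)) (q.eval (sz a))

/-- The register holds the truth value `true`. -/
def Reg.isTrue : Reg → Bool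
  | some (some (.bit true)) => true
  | _ => false

/-- The register holds an inner node. -/
def Reg.isNode : Reg → Bool
  | some none => true
  | _ => false

namespace Poly
variable {α β γ δ : Type} [Code α] [Code β] [Code γ] [Code δ]

/-- Polynomials over `ℕ` have non-negative values, so the sum of a size bound and a time bound
serves as the single polynomial that `Poly` asks for. -/
theorem of_bounds {f : α → β} (p : Prog) (q r : Polynomial ℕ) (hq : ∀ a, sz (f a) ≤ q.eval (sz a))
    (hr : ∀ a m, Exec p (onMain ((enc a).ser ++ m)) (onMain ((enc (f a)).ser ++ m))
      (r.eval (sz a))) : Poly f :=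
  ⟨p, q + r, fun a => ⟨by simpa using (hq a).trans (Nat.le_add_right _ _),
    fun m => (hr a m).mono (by simp)⟩⟩

theorem exists_sz_le {f : α → β} (hf : Poly f) :
    ∃ q : Polynomial ℕ, ∀ a, sz (f a) ≤ q.eval (sz a) := by
  obtain ⟨_, q, h⟩ := hf
  exact ⟨q, fun a => (h a).1⟩

/-- A function on representations gives a function on the represented values. -/
theorem of_enc {F : α → β} (hF : Poly F) {f : γ → δ}
    (h : ∀ c, ∃ a, (enc a : Tree) = enc c ∧ (enc (F a) : Tree) = enc (f c)) : Poly f := by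
  obtain ⟨p, q, hp⟩ := hF
  refine ⟨p, q, fun c => ?_⟩
  obtain ⟨a, h1, h2⟩ := h c
  simpa only [sz, h1, h2] using hp a

protected theorem id : Poly (fun a : α => a) :=
  of_bounds .skip Polynomial.X 1 (by simp) fun _ _ v => ⟨v, 1, by simp, Run.skip⟩

/-- The identity between types with the same representations. -/
theorem cast {f : α → β} (h : ∀ a, (enc (f a) : Tree) = enc a) : Poly f :=
  Poly.id.of_enc fun c => ⟨c, rfl, (h c).symm⟩

/-- The size bound contained in `Poly f` is needed here: it limits the argument on which the second
program runs. -/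
theorem comp {g : β → γ} {f : α → β} (hg : Poly g) (hf : Poly f) : Poly fun a => g (f a) := by
  obtain ⟨p, q, hf⟩ := hf
  obtain ⟨p', q', hg⟩ := hg
  refine of_bounds (.seq p p') (q'.comp q) (q + q'.comp q) (fun a => ?_) fun a m => ?_
  · rw [Polynomial.eval_comp]
    exact (hg (f a)).1.trans (eval_mono _ (hf a).1)
  · refine (((hf a).2 m).seq ((hg (f a)).2 m)).mono ?_
    rw [Polynomial.eval_add, Polynomial.eval_comp]
    exact Nat.add_le_add_left (eval_mono _ (hf a).1) _

theorem pushMain_exec (s : Option Token) (m : List (Option Token)) :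
    Exec (Prog.pushMain s) (onMain m) (onMain (s :: m)) 1 := fun v =>
  ⟨v, 1, le_rfl, by
    simpa [onMain, Prog.pushMain] using
      Run.push (k := .main) (f := fun _ => s) (v := v) (S := onMain m)⟩

theorem pair {f : α → β} {g : α → γ} (hf : Poly f) (hg : Poly g) : Poly fun a => (f a, g a) := by
  obtain ⟨p, q, hf⟩ := hf
  obtain ⟨p', q', hg⟩ := hg
  -- The duplicate is used up by the program of `g`, the original is then brought to the top for the
  -- program of `f`, and a node symbol joins the two results.
  refine of_bounds (.seq .dup (.seq p' (.seq .swap (.seq p (.pushMain none))))) (q + q' + 1)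
    (16 * Polynomial.X + 9 + (q' + (9 * (q' + Polynomial.X) + 10 + (q + 1))))
    (fun a => ?_) fun a m => ?_
  · simpa using add_le_add (hf a).1 (hg a).1
  · have h1 := dup_exec (enc a) m
    have h2 := (hg a).2 ((enc a).ser ++ m)
    have h3 := swap_exec (enc (g a)) (enc a) m
    have h4 := (hf a).2 ((enc (g a)).ser ++ m)
    have h5 := pushMain_exec none ((enc (f a)).ser ++ ((enc (g a)).ser ++ m))
    have := h1.seq (h2.seq (h3.seq (h4.seq h5)))
    have e : none :: ((enc (f a)).ser ++ ((enc (g a)).ser ++ m)) = (enc (f a, g a)).ser ++ m := by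
      simp [enc, Tree.ser]
    rw [e] at this
    refine this.mono ?_
    have := (hg a).1
    simp only [sz] at this ⊢
    simp only [Polynomial.eval_add, Polynomial.eval_mul, Polynomial.eval_ofNat, Polynomial.eval_X,
      Polynomial.eval_one]
    lia

protected theorem fst : Poly fun x : β × γ => x.1 := by
  refine of_bounds (.seq (.pop .main id) (.seq .swap .drop)) Polynomial.X
    (20 * Polynomial.X + 20) (fun x => by simp; lia) fun x m => ?_
  have h1 : Exec (.pop .main id) (onMain ((enc x).ser ++ m))
      (onMain ((enc x.1).ser ++ ((enc x.2).ser ++ m))) 1 := fun v => ⟨_, 1, le_rfl, by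
    simpa [onMain, enc, Tree.ser] using
      Run.pop (k := .main) (f := id) (v := v) (S := onMain ((enc x).ser ++ m))⟩
  refine (h1.seq ((swap_exec _ _ m).seq (drop_exec (enc x.2) _))).mono ?_
  have : sz x = (enc x.1 : Tree).size + (enc x.2 : Tree).size + 1 := rfl
  simp [this]
  lia

theorem popMain_exec (s : Option Token) (m : List (Option Token)) (v : Reg) :
    Run (.pop .main id) v (onMain (s :: m)) (some s) (onMain m) 1 := by
  simpa [onMain] using Run.pop (k := .main) (f := id) (v := v) (S := onMain (s :: m))

protected theorem snd : Poly fun x : β × γ => x.2 := by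
  refine of_bounds (.seq (.pop .main id) .drop) Polynomial.X
    (20 * Polynomial.X + 20) (fun x => by simp; lia) fun x m => ?_
  have h1 : Exec (.pop .main id) (onMain ((enc x).ser ++ m))
      (onMain ((enc x.1).ser ++ ((enc x.2).ser ++ m))) 1 := fun v => ⟨_, 1, le_rfl, by
    simpa [enc, Tree.ser] using popMain_exec none ((enc x.1).ser ++ ((enc x.2).ser ++ m)) v⟩
  refine (h1.seq (drop_exec (enc x.1) _)).mono ?_
  have : sz x = (enc x.1 : Tree).size + (enc x.2 : Tree).size + 1 := rfl
  simp [this]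
  lia

theorem tree_const (x : Tree) : Poly fun _ : α => x := by
  induction x with
  | leaf t =>
    refine of_bounds (.seq .drop (.pushMain (some t))) 1 (9 * Polynomial.X + 5 + 1)
      (fun x => by simp [sz, enc, Tree.size]) fun a m => ?_
    have := (drop_exec (enc a) m).seq (pushMain_exec (some t) m)
    exact this.mono (by simp [sz])
  | node l r ihl ihr => exact (ihl.pair ihr).of_enc fun c => ⟨c, rfl, rfl⟩

protected theorem const (b : β) : Poly fun _ : α => b :=
  (tree_const (α := α) (enc b)).of_enc fun c => ⟨c, rfl, rfl⟩

/-- Functions whose arguments and values are single leaves. -/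
theorem atom {f : α → β} (φ : Token → Token)
    (h : ∀ a, ∃ t, enc a = Tree.leaf t ∧ enc (f a) = Tree.leaf (φ t)) : Poly f := by
  refine of_bounds (.seq (.pop .main id) (.push .main fun v => v.join.map φ)) 1 2 (fun a => ?_)
    fun a m v => ?_
  · obtain ⟨t, _, h⟩ := h a
    simp [sz, h, Tree.size]
  · obtain ⟨t, h1, h2⟩ := h a
    refine ⟨some (some t), 2, by simp, ?_⟩
    have := Run.push (k := .main) (f := fun v => v.join.map φ) (v := some (some t)) (S := onMain m)
    rw [h1, h2]
    exact (popMain_exec (some t) m v).seq (by simpa [onMain] using this)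

/-- No computability of `f` is required: the alphabet is finite, so `f` is part of the transition
table. -/
theorem token_bool {f : Token → Bool} : Poly f := atom (fun t => .bit (f t)) fun t => ⟨t, rfl, rfl⟩

theorem bool_token {f : Bool → Token} : Poly f :=
  atom (fun t => match t with | .bit b => f b | t => t) fun b => ⟨.bit b, rfl, rfl⟩

protected theorem not {f : α → Bool} (hf : Poly f) : Poly fun a => !f a :=
  (atom (fun t => match t with | .bit b => .bit !b | t => t) fun b => ⟨.bit b, rfl, rfl⟩ :
    Poly not).comp hf

/-- Whether a tree is a leaf. -/
def _root_.POL.Tree.isLeaf : Tree → Bool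
  | .leaf _ => true
  | .node _ _ => false

theorem isLeaf : Poly Tree.isLeaf := by
  refine of_bounds (.seq (.pop .main id) (.ite (fun v => v.join.isSome)
    (.pushMain (some (.bit true))) (.seq .drop (.seq .drop (.pushMain (some (.bit false)))))))
    1 (9 * Polynomial.X + 20) (fun a => by simp) fun x m v => ?_
  cases x with
  | leaf t =>
    obtain ⟨v', t', ht, h⟩ := pushMain_exec (some (.bit true)) m (some (some t))
    refine ⟨v', _, ?_, (popMain_exec _ m v).seq (Run.iteTrue rfl h)⟩
    simp
    lia
  | node l r =>
    obtain ⟨v', t', ht, h⟩ := ((drop_exec l (r.ser ++ m)).seq ((drop_exec r m).seq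
      (pushMain_exec (some (.bit false)) m))) (some none)
    refine ⟨v', _, ?_, Run.seq (popMain_exec none _ v) (Run.iteFalse rfl ?_) (t' := 1 + t')⟩
    · simp [sz, enc, Tree.size]
      lia
    · simpa [Tree.ser, enc, Tree.isLeaf] using h

/-- Case distinction; in each case a function between suitable types with the same
representations may be applied. -/
theorem cases {c : α → Bool} {f : β → δ} {g : γ → δ} {r : α → δ} (hc : Poly c) (hf : Poly f)
    (hg : Poly g)
    (ht : ∀ a, c a = true → ∃ b, (enc b : Tree) = enc a ∧ f b = r a)
    (hn : ∀ a, c a = false → ∃ b, (enc b : Tree) = enc a ∧ g b = r a) : Poly r := by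
  obtain ⟨p, q, hc⟩ := hc
  obtain ⟨p', q', hf⟩ := hf
  obtain ⟨p'', q'', hg⟩ := hg
  refine of_bounds (.seq .dup (.seq p (.seq (.pop .main id)
    (.ite Reg.isTrue p' p'')))) (q' + q'')
    (16 * Polynomial.X + q + q' + q'' + 20) (fun a => ?_) fun a m v => ?_
  · cases h : c a with
    | true =>
      obtain ⟨b, h1, h2⟩ := ht a h
      have := (hf b).1
      simp only [sz, h1, h2, Polynomial.eval_add] at this ⊢
      lia
    | false =>
      obtain ⟨b, h1, h2⟩ := hn a h
      have := (hg b).1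
      simp only [sz, h1, h2, Polynomial.eval_add] at this ⊢
      lia
  · obtain ⟨v1, t1, ht1, h1⟩ := dup_exec (enc a) m v
    obtain ⟨v2, t2, ht2, h2⟩ := (hc a).2 ((enc a).ser ++ m) v1
    have h3 := popMain_exec (some (.bit (c a))) ((enc a).ser ++ m) v2
    have main : ∃ v' t', t' ≤ q'.eval (sz a) + q''.eval (sz a) ∧
        Run (.ite Reg.isTrue p' p'') (some (some (.bit (c a))))
          (onMain ((enc a).ser ++ m)) v' (onMain ((enc (r a)).ser ++ m)) (1 + t') := by
      cases h : c a with
      | true =>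
        obtain ⟨b, e1, e2⟩ := ht a h
        obtain ⟨v', t', ht', h'⟩ := (hf b).2 m (some (some (.bit true)))
        simp only [sz, e1, e2] at ht' h'
        exact ⟨v', t', ht'.trans (by simp [sz]), Run.iteTrue rfl h'⟩
      | false =>
        obtain ⟨b, e1, e2⟩ := hn a h
        obtain ⟨v', t', ht', h'⟩ := (hg b).2 m (some (some (.bit false)))
        simp only [sz, e1, e2] at ht' h'
        exact ⟨v', t', ht'.trans (by simp [sz]), Run.iteFalse rfl h'⟩
    obtain ⟨v', t', ht', h'⟩ := main
    refine ⟨v', _, ?_, h1.seq (h2.seq (h3.seq h'))⟩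
    simp only [sz] at *
    simp
    lia

protected theorem cond {c : α → Bool} {f g : α → β} (hc : Poly c) (hf : Poly f) (hg : Poly g) :
    Poly fun a => bif c a then f a else g a :=
  cases hc hf hg (fun a h => ⟨a, rfl, by simp [h]⟩) fun a h => ⟨a, rfl, by simp [h]⟩

protected theorem and {f g : α → Bool} (hf : Poly f) (hg : Poly g) : Poly fun a => f a && g a :=
  cases hf hg (Poly.const false) (fun a h => ⟨a, rfl, by simp [h]⟩)
    fun a h => ⟨a, rfl, by simp [h]⟩

protected theorem or {f g : α → Bool} (hf : Poly f) (hg : Poly g) : Poly fun a => f a || g a :=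
  cases hf (Poly.const true) hg (fun a h => ⟨a, rfl, by simp [h]⟩) fun a h => ⟨a, rfl, by simp [h]⟩

/-! ### Loops -/

/-- `Iter step B n s s'`: after `n` rounds the loop that runs `step` as long as the list in the
state is not empty goes from `s` to `s'`; until then all states have size at most `B`. -/
inductive Iter (step : List β × γ → List β × γ) (B : ℕ) : ℕ → List β × γ → List β × γ → Prop
  | refl (s) : Iter step B 0 s s
  | step {n b l c s'} : sz (b :: l, c) ≤ B → Iter step B n (step (b :: l, c)) s' →
      Iter step B (n + 1) (b :: l, c) s'

theorem Iter.trans {step : List β × γ → List β × γ} {B n n' : ℕ} {s s' s'' : List β × γ}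
    (h : Iter step B n s s') (h' : Iter step B n' s' s'') : Iter step B (n + n') s s'' := by
  induction h with
  | refl => simpa using h'
  | @step n b l c s' hB _ ih =>
    rw [add_right_comm]
    exact .step hB (ih h')

/-- The worklist is the left component of the state, so its emptiness shows in the second symbol of
the serialised state: an inner node for a non-empty list, a leaf otherwise. The test takes 3 steps,
and a round costs at most `k.eval B + 4` because `B` bounds the state before every round. -/
theorem loop {step : List β × γ → List β × γ} (hs : Poly step) {init : α → List β × γ}
    (hi : Poly init) {r : α → γ} (q : Polynomial ℕ)
    (h : ∀ a, sz (r a) ≤ q.eval (sz a) ∧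
      ∃ n ≤ q.eval (sz a), Iter step (q.eval (sz a)) n (init a) ([], r a)) : Poly r := by
  obtain ⟨p, k, hs⟩ := hs
  obtain ⟨p', k', hi⟩ := hi
  set test : Prog := .seq (.pop .main id) (.seq (.peek .main id) (.pushMain none))
  -- The two final pops remove the pair node and the `fin` leaf of the exhausted worklist, leaving
  -- the result alone.
  refine of_bounds (.seq p' (.seq test (.seq (.loop Reg.isNode (.seq p test))
    (.seq (.pop .main id) (.pop .main id))))) q (k' + (3 + (q * (k.comp q + 4) + 1 + 2)))
    (fun a => (h a).1) fun a m v => ?_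
  have htest : ∀ (s : List β × γ) v, Run test v (onMain ((enc s).ser ++ m)) ((enc s.1).ser.head?)
      (onMain ((enc s).ser ++ m)) 3 := by
    intro s v
    have h1 := popMain_exec none ((enc s.1).ser ++ ((enc s.2).ser ++ m)) v
    have h2 := Run.peek (k := .main) (f := id) (v := some none)
      (S := onMain ((enc s.1).ser ++ ((enc s.2).ser ++ m)))
    have h3 := Run.push (k := .main) (f := fun _ => none) (v := (enc s.1).ser.head?)
      (S := onMain ((enc s.1).ser ++ ((enc s.2).ser ++ m)))
    have e : (id (onMain ((enc s.1).ser ++ ((enc s.2).ser ++ m)) .main).head?) =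
        (enc s.1).ser.head? := by
      cases h : (enc s.1 : Tree) <;> simp [onMain, Tree.ser]
    have e' : none :: ((enc s.1).ser ++ ((enc s.2).ser ++ m)) = (enc s).ser ++ m := by
      simp [enc, Tree.ser]
    rw [e] at h2
    simp only [onMain, update_main, mem_main, e'] at h1 h2 h3 ⊢
    exact h1.seq (h2.seq h3)
  have hloop : ∀ n B s s', Iter step B n s s' → s'.1 = [] → ∃ v' t, t ≤ n * (k.eval B + 4) + 1 ∧
      Run (.loop Reg.isNode (.seq p test)) (enc s.1).ser.head?
        (onMain ((enc s).ser ++ m)) v' (onMain ((enc s').ser ++ m)) t := by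
    intro n B s s' hn h'
    induction hn with
    | refl s => exact ⟨_, 1, by simp, Run.loopDone (by rw [h']; rfl)⟩
    | @step n b l c s' hB _ ih =>
      obtain ⟨v', t, ht, hr⟩ := ih h'
      obtain ⟨v1, t1, ht1, h1⟩ := (hs (b :: l, c)).2 m ((enc (b :: l)).ser.head?)
      refine ⟨v', _, ?_, Run.loopStep rfl (h1.seq (htest _ v1)) hr⟩
      have := ht1.trans (eval_mono k hB)
      linarith [add_mul n 1 (k.eval B + 4)]
  obtain ⟨hr, n, hn, hit⟩ := h a
  obtain ⟨v1, t1, ht1, h1⟩ := (hi a).2 m v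
  obtain ⟨v2, t2, ht2, h2⟩ := hloop n _ _ _ hit rfl
  have h3 := popMain_exec none (some .fin :: ((enc (r a)).ser ++ m)) v2
  have h4 := popMain_exec (some .fin) ((enc (r a)).ser ++ m) (some none)
  refine ⟨_, _, ?_, h1.seq ((htest _ v1).seq (h2.seq (h3.seq h4)))⟩
  simp only [Polynomial.eval_add, Polynomial.eval_mul, Polynomial.eval_comp, Polynomial.eval_ofNat,
    Polynomial.eval_one]
  have := Nat.mul_le_mul_right (k.eval (q.eval (sz a)) + 4) hn
  lia

end Poly
end POL

/-! ### Lists and binary numbers in polynomial time. -/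

namespace POL
open Turing Function Code

attribute [fun_prop] Poly

namespace Poly
variable {α β γ δ : Type} [Code α] [Code β] [Code γ] [Code δ]

attribute [fun_prop] Poly.id Poly.const Poly.comp Poly.pair Poly.fst Poly.snd Poly.not Poly.and Poly.or Poly.cond

theorem cons {f : α → β} {g : α → List β} (hf : Poly f) (hg : Poly g) :
    Poly fun a => f a :: g a :=
  (hf.pair hg).of_enc fun c => ⟨c, rfl, rfl⟩
attribute [fun_prop] cons

theorem isLeaf_enc {f : α → β} (hf : Poly f) : Poly fun a => (enc (f a)).isLeaf :=
  isLeaf.comp ((Poly.cast (f := fun b : β => (enc b : Tree)) fun _ => rfl).comp hf)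

/-- A non-empty list and the pair of its head and tail are represented by the same tree, so entering
a branch requires no conversion. -/
theorem listCases {l : α → List β} {f : α → γ} {g : α × β × List β → γ} (hl : Poly l) (hf : Poly f)
    (hg : Poly g) : Poly fun a => (match l a with | [] => f a | b :: t => g (a, b, t) : γ) := by
  have : Poly fun x : α × List β => (match x.2 with | [] => f x.1 | b :: t => g (x.1, b, t) : γ) := by
    refine cases (isLeaf_enc (f := fun x : α × List β => x.2) Poly.snd)
      (hf.comp (f := fun x : α × List β => x.1) Poly.fst) hg ?_ ?_
    · rintro ⟨a, _ | ⟨b, t⟩⟩ h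
      · exact ⟨(a, []), rfl, rfl⟩
      · simp [enc, encList, Tree.isLeaf] at h
    · rintro ⟨a, _ | ⟨b, t⟩⟩ h
      · simp [enc, encList, Tree.isLeaf] at h
      · exact ⟨(a, b, t), rfl, rfl⟩
  exact this.comp (Poly.id.pair hl)

theorem Iter.mono {step : List β × γ → List β × γ} {B B' n : ℕ} {s s' : List β × γ} (hB : B ≤ B')
    (h : Iter step B n s s') : Iter step B' n s s' := by
  induction h with
  | refl => exact .refl _
  | step h _ ih => exact .step (h.trans hB) ih

/-- Folds over lists, if each step adds at most a polynomial of the sizes of the parameters and of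
the current entry to the size of the accumulator. -/
theorem foldl {l : α → List β} {i : α → γ} {s : α → γ → β → γ} (hl : Poly l) (hi : Poly i)
    (hs : Poly fun x : α × γ × β => s x.1 x.2.1 x.2.2) (q : Polynomial ℕ)
    (hq : ∀ a c b, sz (s a c b) ≤ sz c + q.eval (sz a + sz b)) :
    Poly fun a => (l a).foldl (s a) (i a) := by
  -- The step function of a loop is fixed, so the parameter `a` has to travel inside the state and
  -- is projected away at the end.
  suffices h : Poly fun a => (a, (l a).foldl (s a) (i a)) from Poly.snd.comp h
  obtain ⟨p, hp⟩ := hl.exists_sz_le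
  obtain ⟨p', hp'⟩ := hi.exists_sz_le
  set step : List β × α × γ → List β × α × γ := fun x => match x.1 with
    | [] => x
    | b :: t => (t, x.2.1, s x.2.1 x.2.2 b) with hstep
  have hstep' : Poly step := by
    refine listCases (l := fun x : List β × α × γ => x.1) (f := fun x => x)
      (g := fun y : (List β × α × γ) × β × List β => (y.2.2, y.1.2.1, s y.1.2.1 y.1.2.2 y.2.1)) Poly.fst Poly.id ?_
    have : Poly fun y : (List β × α × γ) × β × List β => s y.1.2.1 y.1.2.2 y.2.1 :=
      hs.comp (f := fun y : (List β × α × γ) × β × List β => (y.1.2.1, y.1.2.2, y.2.1))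
        (by fun_prop)
    fun_prop
  refine loop hstep' (init := fun a => (l a, a, i a)) (by fun_prop)
    (p + Polynomial.X + p' + p * q.comp (Polynomial.X + p) + 2) fun a => ?_
  -- Each remaining entry may add at most `q.eval (sz a + sz (l a))`. As growth is additive, the
  -- quantity bounded by `D` never increases during the fold, so `D` bounds every accumulator.
  have key : ∀ (l' : List β) (c : γ) (D : ℕ), (∀ b ∈ l', sz b ≤ sz (l a)) → sz l' ≤ sz (l a) →
      sz c + l'.length * q.eval (sz a + sz (l a)) ≤ D →
      sz (l'.foldl (s a) c) ≤ D ∧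
      Iter step (sz (l a) + sz a + D + 2) l'.length (l', a, c) ([], a, l'.foldl (s a) c) := by
    intro l'
    induction l' with
    | nil => exact fun c D _ _ h => ⟨by simpa using h, .refl _⟩
    | cons b t ih =>
      intro c D h1 h2 h3
      have hb := hq a c b
      have hb' := eval_mono q (Nat.add_le_add_left (h1 b (by simp)) (sz a))
      have e : (b :: t).length * q.eval (sz a + sz (l a)) =
        t.length * q.eval (sz a + sz (l a)) + q.eval (sz a + sz (l a)) := by
        simp [add_mul]
      have := ih (s a c b) D (fun b' hb' => h1 b' (by simp [hb'])) (by simp at h2; lia) (by lia)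
      refine ⟨this.1, Iter.step (by simp at h2 ⊢; lia) this.2⟩
  have hl' := length_lt_sz (l a)
  obtain ⟨h1, h2⟩ := key (l a) (i a) (p'.eval (sz a) + p.eval (sz a) * q.eval (sz a + p.eval (sz a)))
    (fun b hb => sz_le_of_mem hb) le_rfl (add_le_add (hp' a)
      (Nat.mul_le_mul (by have := hp a; lia) (eval_mono q (Nat.add_le_add_left (hp a) _))))
  have hpa := hp a
  refine ⟨by simp; lia, _, ?_, h2.mono (by simp; lia)⟩
  simp
  lia

/-- As `foldl`, with the bound stated for the growth by each entry. -/
theorem foldr {l : α → List β} {i : α → γ} {s : α → β → γ → γ} (hl : Poly l) (hi : Poly i)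
    (hs : Poly fun x : α × β × γ => s x.1 x.2.1 x.2.2) (q : Polynomial ℕ)
    (hq : ∀ a b c, sz (s a b c) ≤ sz c + q.eval (sz a + sz b)) :
    Poly fun a => (l a).foldr (s a) (i a) := by
  -- A right fold is a left fold over the reversed list.
  have hr : Poly fun a => (l a).foldl (fun c b => b :: c) [] :=
    foldl (s := fun _ c b => b :: c) hl (.const []) (by fun_prop) (Polynomial.X + 1)
      fun a c b => by simp; lia
  have := foldl (s := fun a c b => s a b c) hr hi (hs.comp
    (f := fun x : α × γ × β => (x.1, x.2.2, x.2.1)) (by fun_prop)) q fun a c b => hq a b c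
  refine this.of_enc fun a => ⟨a, rfl, ?_⟩
  have e : (l a).foldl (fun c b => b :: c) [] = (l a).reverse := by simp
  rw [e, List.foldl_reverse]

@[fun_prop]
theorem reverse {l : α → List β} (hl : Poly l) : Poly fun a => (l a).reverse := by
  have : Poly fun a => (l a).foldl (fun c b => b :: c) [] :=
    foldl (s := fun _ c b => b :: c) hl (.const []) (by fun_prop) (Polynomial.X + 1)
      fun a c b => by simp; lia
  simpa using this

@[fun_prop]
theorem append {l l' : α → List β} (hl : Poly l) (hl' : Poly l') : Poly fun a => l a ++ l' a := by
  have := foldr (s := fun _ b c => b :: c) hl hl' (by fun_prop) (Polynomial.X + 1)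
      fun a b c => by simp; lia
  simpa using this

theorem map {l : α → List β} {h : α → β → γ} (hl : Poly l)
    (hh : Poly fun x : α × β => h x.1 x.2) : Poly fun a => (l a).map (h a) := by
  obtain ⟨q, hq⟩ := hh.exists_sz_le
  have := foldr (s := fun a b c => h a b :: c) hl (.const [])
    (cons (hh.comp (f := fun x : α × β × List γ => (x.1, x.2.1)) (by fun_prop)) (by fun_prop))
    (q.comp (Polynomial.X + 1) + 1)
    fun a b c => by have := hq (a, b); simp at this ⊢; lia
  refine this.of_enc fun a => ⟨a, rfl, ?_⟩
  congr 1
  induction l a <;> simp_all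

theorem flatMap {l : α → List β} {h : α → β → List γ} (hl : Poly l)
    (hh : Poly fun x : α × β => h x.1 x.2) : Poly fun a => (l a).flatMap (h a) := by
  obtain ⟨q, hq⟩ := hh.exists_sz_le
  have := foldr (s := fun a b c => h a b ++ c) hl (.const [])
    (append (hh.comp (f := fun x : α × β × List γ => (x.1, x.2.1)) (by fun_prop)) (by fun_prop))
    (q.comp (Polynomial.X + 1) + 1)
    fun a b c => by
      have h1 := hq (a, b)
      have h2 := sz_append (h a b) c
      simp only [sz_pair] at h1
      simp only [Polynomial.eval_add, Polynomial.eval_comp, Polynomial.eval_X, Polynomial.eval_one,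
        ← add_assoc]
      lia
  refine this.of_enc fun a => ⟨a, rfl, ?_⟩
  congr 1
  induction l a <;> simp_all

theorem all {l : α → List β} {h : α → β → Bool} (hl : Poly l)
    (hh : Poly fun x : α × β => h x.1 x.2) : Poly fun a => (l a).all (h a) := by
  have hh' := hh.comp (f := fun x : α × β × Bool => (x.1, x.2.1)) (by fun_prop)
  have := foldr (s := fun a b c => h a b && c) hl (.const true) (by fun_prop) 0 (by simp)
  refine this.of_enc fun a => ⟨a, rfl, ?_⟩
  congr 1
  induction l a <;> simp_all

theorem any {l : α → List β} {h : α → β → Bool} (hl : Poly l)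
    (hh : Poly fun x : α × β => h x.1 x.2) : Poly fun a => (l a).any (h a) := by
  have := (all hl (h := fun a b => !h a b) (by fun_prop)).not
  simpa [List.not_all_eq_any_not] using this

/-- Pointwise combination of two lists, if the results are bounded in terms of the entries of the
first. -/
theorem zipWith {l : α → List β} {l' : α → List γ} {h : α → β → γ → δ} (hl : Poly l)
    (hl' : Poly l') (hh : Poly fun x : α × β × γ => h x.1 x.2.1 x.2.2) (q : Polynomial ℕ)
    (hq : ∀ a b c, sz (h a b c) ≤ q.eval (sz a + sz b)) :
    Poly fun a => (l a).zipWith (h a) (l' a) := by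
  set s : α → List δ × List γ → β → List δ × List γ := fun a x b => match x.2 with
    | [] => x
    | c :: t => (h a b c :: x.1, t) with hs
  have hs' : Poly fun x : α × (List δ × List γ) × β => s x.1 x.2.1 x.2.2 := by
    have := hh.comp (f := fun y : (α × (List δ × List γ) × β) × γ × List γ =>
      (y.1.1, y.1.2.2, y.2.1)) (by fun_prop)
    exact listCases (l := fun x : α × (List δ × List γ) × β => x.2.1.2) (f := fun x => x.2.1)
      (g := fun y => (h y.1.1 y.1.2.2 y.2.1 :: y.1.2.1.1, y.2.2)) (by fun_prop) (by fun_prop)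
      (by fun_prop)
  have := foldl (s := s) (i := fun a => ([], l' a)) hl (by fun_prop) hs' q fun a x b => by
    obtain ⟨r, _ | ⟨c, t⟩⟩ := x
    · simp [hs]
    · have := hq a b c
      simp [hs]
      lia
  have e : ∀ a l l' r, (List.foldl (s a) (r, l') l).1 = (l.zipWith (h a) l').reverse ++ r := by
    intro a l
    induction l with
    | nil => simp
    | cons b l ih =>
      rintro (_ | ⟨c, l'⟩) r
      · simpa [hs] using ih [] r
      · simpa [hs] using ih l' (h a b c :: r)
  have h2 := (Poly.fst.comp this).reverse
  simpa [e] using h2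

/-- Equality of lists of equal length and, for longer second lists, failure. -/
theorem list_beq [DecidableEq β] {l l' : α → List β} (hl : Poly l) (hl' : Poly l')
    (hb : Poly fun x : β × β => decide (x.1 = x.2)) : Poly fun a => decide (l a = l' a) := by
  set s : α → Bool × List β → β → Bool × List β := fun a x b => match x.2 with
    | [] => (false, [])
    | c :: t => (x.1 && decide (b = c), t) with hs
  have hs' : Poly fun x : α × (Bool × List β) × β => s x.1 x.2.1 x.2.2 := by
    have := hb.comp (f := fun y : (α × (Bool × List β) × β) × β × List β =>
      (y.1.2.2, y.2.1)) (by fun_prop)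
    exact listCases (l := fun x : α × (Bool × List β) × β => x.2.1.2) (f := fun x => (false, []))
      (g := fun y => (y.1.2.1.1 && decide (y.1.2.2 = y.2.1), y.2.2)) (by fun_prop) (by fun_prop)
      (by fun_prop)
  have := foldl (s := s) (i := fun a => (true, l' a)) hl (by fun_prop) hs' 0 fun a x b => by
    obtain ⟨r, _ | ⟨c, t⟩⟩ := x
    · simp [hs]
    · simp [hs]
      lia
  -- The fold detects a second list that is too short; one that is too long leaves a remainder,
  -- whose representation is not a leaf.
  have e : ∀ a l l' r, ((List.foldl (s a) (r, l') l).1 &&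
      (enc (List.foldl (s a) (r, l') l).2).isLeaf) = (r && decide (l = l')) := by
    intro a l
    induction l with
    | nil => rintro (_ | ⟨c, l'⟩) r <;> simp [enc, encList, Tree.isLeaf]
    | cons b l ih =>
      rintro (_ | ⟨c, l'⟩) r
      · simpa [hs] using ih [] false
      · rw [List.foldl_cons, ih]
        simp [Bool.and_assoc]
  have h2 := (Poly.fst.comp this).and (isLeaf_enc (Poly.snd.comp this))
  simpa [e] using h2

theorem bool_beq : Poly fun x : Bool × Bool => decide (x.1 = x.2) := by
  have : Poly fun x : Bool × Bool => bif x.1 then x.2 else !x.2 := by fun_prop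
  refine this.of_enc fun x => ⟨x, rfl, ?_⟩
  rcases x with ⟨_ | _, _ | _⟩ <;> rfl

/-! ### Binary numbers -/

instance : Code ℕ := ⟨fun n => enc n.bits⟩

@[fun_prop]
theorem bits {f : α → ℕ} (hf : Poly f) : Poly fun a => (f a).bits :=
  (Poly.cast (f := Nat.bits) fun _ => rfl).comp hf

/-- The number with given binary digits, the least significant digit first. -/
def ofBits (l : List Bool) : ℕ := l.foldr Nat.bit 0

theorem ofBits_bits (n : ℕ) : ofBits n.bits = n := by
  induction n using Nat.binaryRec' with
  | zero => simp [ofBits]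
  | bit b n h ih =>
    rw [Nat.bits_append_bit _ _ h]
    exact congrArg (Nat.bit b) ih

-- Digits are compared from the least significant one. The flag says whether the part of `f a` seen
-- so far is smaller than that of `g a`; a later digit overrides it unless the two digits agree.
-- Digits of `g a` that are left over make `g a` larger as soon as one of them is 1.
@[fun_prop]
theorem nat_lt {f g : α → ℕ} (hf : Poly f) (hg : Poly g) : Poly fun a => decide (f a < g a) := by
  set s : Bool × List Bool → Bool → Bool × List Bool := fun x b => match x.2 with
    | [] => (x.1 && !b, [])
    | c :: t => (bif b then x.1 && c else x.1 || c, t) with hs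
  have hs' : Poly fun x : α × (Bool × List Bool) × Bool => s x.2.1 x.2.2 := by
    refine (listCases (l := fun x : α × (Bool × List Bool) × Bool => x.2.1.2)
      (f := fun x => (x.2.1.1 && !x.2.2, ([] : List Bool)))
      (g := fun y : (α × (Bool × List Bool) × Bool) × Bool × List Bool => (bif y.1.2.2 then y.1.2.1.1 && y.2.1 else y.1.2.1.1 || y.2.1, y.2.2))
      (by fun_prop) (by fun_prop) (by fun_prop)).of_enc fun x => ⟨x, rfl, ?_⟩
    rcases x with ⟨a, ⟨r, _ | ⟨c, t⟩⟩, b⟩ <;> rfl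
  have := foldl (s := fun _ => s) (i := fun a => (false, (g a).bits)) hf.bits (by fun_prop) hs' 0
    fun a x b => by
      obtain ⟨r, _ | ⟨c, t⟩⟩ := x
      · simp [hs]
      · simp [hs]
        lia
  -- The flag `r` is the verdict on the lower digits, which counts only if the remaining digits are
  -- equal.
  have e : ∀ l l' r, ((l.foldl s (r, l')).1 || (l.foldl s (r, l')).2.any id) =
      decide (ofBits l < ofBits l' ∨ (ofBits l = ofBits l' ∧ r = true)) := by
    intro l
    induction l with
    | nil =>
      intro l'
      induction l' with
      | nil => simp
      | cons c l' ih =>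
        intro r
        have := ih r
        cases c <;> cases r <;> simp_all [ofBits, Nat.bit] <;> lia
    | cons b l ih =>
      rintro (_ | ⟨c, l'⟩) r <;> (rw [List.foldl_cons, ih])
      · cases b <;> simp [ofBits, Nat.bit]
      · cases b <;> cases c <;> cases r <;> simp [ofBits, Nat.bit] <;> lia
  have h2 := (Poly.fst.comp this).or (any (h := fun _ b => b) (Poly.snd.comp this) (by fun_prop))
  refine h2.of_enc fun a => ⟨a, rfl, ?_⟩
  congr 1
  have := e (f a).bits (g a).bits false
  simp only [ofBits_bits] at this
  exact this.trans (by simp)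

@[fun_prop]
theorem nat_beq {f g : α → ℕ} (hf : Poly f) (hg : Poly g) : Poly fun a => decide (f a = g a) := by
  have : Poly fun a => !decide (f a < g a) && !decide (g a < f a) := by fun_prop
  refine this.of_enc fun a => ⟨a, rfl, ?_⟩
  congr 1
  rcases lt_trichotomy (f a) (g a) with h | h | h
  · simp [h, h.ne]
  · simp [h]
  · simp [h, h.ne']

@[fun_prop]
theorem nat_bit {f : α → Bool} {g : α → ℕ} (hf : Poly f) (hg : Poly g) :
    Poly fun a => Nat.bit (f a) (g a) := by
  -- `Nat.bits` has no leading zeros, so a 0 put below the number 0 must again give the empty list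
  -- of digits.
  have : Poly fun a => bif f a || !decide (g a = 0) then f a :: (g a).bits else [] := by fun_prop
  refine this.of_enc fun a => ⟨a, rfl, ?_⟩
  change (enc _ : Tree) = enc (Nat.bit (f a) (g a)).bits
  congr 1
  by_cases h : g a = 0
  · cases f a <;> simp [h]
  · rw [Nat.bits_append_bit _ _ fun h' => absurd h' h]
    simp [h]

/-- The increment of binary numbers. -/
def incr : List Bool → List Bool
  | [] => [true]
  | true :: l => false :: incr l
  | false :: l => true :: l

theorem bits_succ (n : ℕ) : (n + 1).bits = incr n.bits := by
  induction n using Nat.binaryRec' with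
  | zero => simp [incr]
  | bit b n h ih =>
    rw [Nat.bits_append_bit _ _ h]
    cases b
    · have : Nat.bit false n + 1 = Nat.bit true n := by simp [Nat.bit]
      rw [this, Nat.bits_append_bit _ _ (by simp)]
      rfl
    · have : Nat.bit true n + 1 = Nat.bit false (n + 1) := by simp [Nat.bit]; ring
      rw [this, Nat.bits_append_bit _ _ (by simp), ih]
      rfl

/-- At most one digit is added, which costs a leaf and a node. This makes counters admissible as
accumulators of folds. -/
theorem sz_succ_le (n : ℕ) : sz (n + 1) ≤ sz n + 2 := by
  have : ∀ l, sz (incr l) ≤ sz l + 2 := by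
    intro l
    induction l with
    | nil => simp [incr]
    | cons b l ih => cases b <;> simp [incr]; lia
  have h := this n.bits
  rw [← bits_succ] at h
  exact h

-- Addition with carry: the accumulator holds the carry, initially 1, and the digits produced so far
-- in reverse.
@[fun_prop]
theorem succ {f : α → ℕ} (hf : Poly f) : Poly fun a => f a + 1 := by
  have := foldl (s := fun (_ : α) (x : Bool × List Bool) b => (x.1 && b, (bif x.1 then !b else b) :: x.2))
    (i := fun _ => (true, [])) hf.bits (by fun_prop) (by fun_prop) 2
    fun a x b => by simp; lia
  have e : ∀ (l : List Bool) r c, (fun x : Bool × List Bool => bif x.1 then (true :: x.2).reverse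
      else x.2.reverse) (l.foldl (fun x b => (x.1 && b, (bif x.1 then !b else b) :: x.2)) (c, r)) =
      r.reverse ++ bif c then incr l else l := by
    intro l
    induction l with
    | nil => intro r c; cases c <;> simp [incr]
    | cons b l ih =>
      intro r c
      rw [List.foldl_cons, ih]
      cases b <;> cases c <;> simp [incr]
  have h2 := Poly.comp (g := fun x : Bool × List Bool => bif x.1 then (true :: x.2).reverse
      else x.2.reverse) (by fun_prop) this
  refine h2.of_enc fun a => ⟨a, rfl, ?_⟩
  change _ = (enc (f a + 1).bits : Tree)
  rw [bits_succ]
  congr 1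
  exact e _ _ _

@[fun_prop]
theorem length {l : α → List β} (hl : Poly l) : Poly fun a => (l a).length := by
  have := foldl (s := fun (_ : α) (n : ℕ) (_ : β) => n + 1) (i := fun _ => 0) hl (by fun_prop)
    (by fun_prop) 2 fun _ n _ => by simpa using sz_succ_le n
  refine this.of_enc fun a => ⟨a, rfl, ?_⟩
  congr 1
  induction l a using List.reverseRecOn <;> simp_all

theorem getD {l : α → List β} {i : α → ℕ} {d : α → β} (hl : Poly l) (hi : Poly i) (hd : Poly d) :
    Poly fun a => (l a).getD (i a) (d a) := by
  have := foldl (s := fun (a : α) (x : ℕ × β) b => (x.1 + 1, bif decide (x.1 = i a) then b else x.2))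
    (i := fun a => (0, d a)) hl (by fun_prop)
    (by
      have := hi.comp (f := fun x : α × (ℕ × β) × β => x.1) (by fun_prop)
      fun_prop)
    (Polynomial.X + 2) fun a x b => by
      have := sz_succ_le x.1
      cases decide (x.1 = i a) <;> simp <;> lia
  -- A counter starting at `n` meets the index `i` at entry `i - n` if `n ≤ i`, and never if it has
  -- already passed it.
  have e : ∀ (i : ℕ) (l : List β) (n : ℕ) (r : β), (l.foldl (fun (x : ℕ × β) b =>
      (x.1 + 1, bif decide (x.1 = i) then b else x.2)) (n, r)).2 =
      if n ≤ i then l.getD (i - n) r else r := by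
    intro i l
    induction l with
    | nil => simp
    | cons b l ih =>
      intro n r
      rw [List.foldl_cons, ih]
      rcases lt_trichotomy n i with h | rfl | h
      · obtain ⟨k, hk⟩ := Nat.exists_eq_add_of_lt h
        subst hk
        simp [show n + k + 1 - n = k + 1 by lia, show n + k + 1 - (n + 1) = k by lia,
          show n ≠ n + k + 1 by lia, show n ≤ n + k + 1 by lia]
      · simp
      · simp [show ¬ n + 1 ≤ i by lia, show ¬ n ≤ i by lia, show n ≠ i by lia]
  refine (Poly.snd.comp this).of_enc fun a => ⟨a, rfl, ?_⟩
  congr 1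
  simpa using e (i a) (l a) 0 (d a)

end Poly
end POL

/-! ### Terms and structural recursion in polynomial time. -/

namespace POL
open Turing Function Code

/-- All tokens. -/
def Token.all : List Token :=
  [.bit false, .bit true, .fin, .zero, .epsilon, .char, .plus, .comp, .star, .top, .prop, .neg,
    .and, .know, .box]

theorem Token.mem_all (t : Token) : t ∈ Token.all := by
  rcases t with ⟨_ | _⟩ <;> simp [Token.all]

/-- Binary trees with inner nodes that carry a token, a mark and a number. -/
inductive Term : Type where
  | nil
  | node (a : Token × Bool × ℕ) (x y : Term)

/-- The tree that represents a term. -/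
def encTerm : Term → Tree
  | .nil => .leaf .fin
  | .node a x y => .node (enc a) (.node (encTerm x) (encTerm y))

instance : Code Term := ⟨encTerm⟩

@[simp] theorem sz_term_nil : sz Term.nil = 1 := rfl

@[simp] theorem sz_node (a : Token × Bool × ℕ) (x y : Term) :
    sz (Term.node a x y) = sz a + (sz x + sz y + 1) + 1 := rfl

namespace Poly
variable {α β γ δ : Type} [Code α] [Code β] [Code γ] [Code δ]

/-- Case distinction on a token. -/
theorem switch {c : α → Token} {f : Token → α → β} (hc : Poly c) (hf : ∀ t, Poly (f t)) :
    Poly fun a => f (c a) a := by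
  classical
  -- A chain of tests against the tokens in `L`; the default `f .fin` is never used when `L`
  -- contains all tokens.
  suffices h : ∀ L : List Token, Poly fun a => if c a ∈ L then f (c a) a else f .fin a by
    simpa [Token.mem_all] using h Token.all
  intro L
  induction L with
  | nil => simpa using hf .fin
  | cons t L ih =>
    have := Poly.cond ((token_bool (f := fun s => decide (s = t))).comp hc) (hf t) ih
    refine this.of_enc fun a => ⟨a, rfl, ?_⟩
    by_cases h : c a = t <;> simp [h]

@[fun_prop]
theorem node {f : α → Token × Bool × ℕ} {g h : α → Term} (hf : Poly f) (hg : Poly g)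
    (hh : Poly h) : Poly fun a => Term.node (f a) (g a) (h a) :=
  (hf.pair (hg.pair hh)).of_enc fun a => ⟨a, rfl, rfl⟩

theorem termCases {t : α → Term} {f : α → γ} {g : α × (Token × Bool × ℕ) × Term × Term → γ}
    (ht : Poly t) (hf : Poly f) (hg : Poly g) :
    Poly fun a => (match t a with | .nil => f a | .node b x y => g (a, b, x, y) : γ) := by
  have : Poly fun x : α × Term =>
      (match x.2 with | .nil => f x.1 | .node b y z => g (x.1, b, y, z) : γ) := by
    refine cases (isLeaf_enc (f := fun x : α × Term => x.2) Poly.snd)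
      (hf.comp (f := fun x : α × Term => x.1) Poly.fst) hg ?_ ?_
    · rintro ⟨a, _ | ⟨b, x, y⟩⟩ h
      · exact ⟨(a, .nil), rfl, rfl⟩
      · simp [enc, encTerm, Tree.isLeaf] at h
    · rintro ⟨a, _ | ⟨b, x, y⟩⟩ h
      · simp [enc, encTerm, Tree.isLeaf] at h
      · exact ⟨(a, b, x, y), rfl, rfl⟩
  exact this.comp (Poly.id.pair ht)

/-- Structural recursion on terms with a parameter that may change on the way down but does not
grow, if the results have polynomial size. -/
theorem termRec {f : α → Term → β} {base : α → β} {dl dr : α → Token × Bool × ℕ → Term → Term → α}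
    {g : α → Token × Bool × ℕ → Term → Term → β → β → β} (h0 : ∀ c, f c .nil = base c)
    (h1 : ∀ c a x y, f c (.node a x y) = g c a x y (f (dl c a x y) x) (f (dr c a x y) y))
    (hbase : Poly base)
    (hdl : Poly fun z : α × (Token × Bool × ℕ) × Term × Term => dl z.1 z.2.1 z.2.2.1 z.2.2.2)
    (hdr : Poly fun z : α × (Token × Bool × ℕ) × Term × Term => dr z.1 z.2.1 z.2.2.1 z.2.2.2)
    (hg : Poly fun z : α × (Token × Bool × ℕ) × Term × Term × β × β =>
      g z.1 z.2.1 z.2.2.1 z.2.2.2.1 z.2.2.2.2.1 z.2.2.2.2.2)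
    (hl : ∀ c a x y, sz (dl c a x y) ≤ sz c) (hr : ∀ c a x y, sz (dr c a x y) ≤ sz c)
    (q : Polynomial ℕ) (hq : ∀ c t, sz (f c t) ≤ q.eval (sz c + sz t)) :
    Poly fun z : α × Term => f z.1 z.2 := by
  -- The loop ends with a stack of results. A one-element list and the pair of its entry with
  -- `Token.fin` have the same representation, so the result is a first projection.
  suffices h : Poly fun z : α × Term => [f z.1 z.2] from
    (Poly.fst (β := β) (γ := Token)).comp
      (h.of_enc (f := fun z : α × Term => (f z.1 z.2, Token.fin)) fun z => ⟨z, rfl, rfl⟩)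
  -- The right subterm is evaluated last, so its value lies on top. The cases with fewer than two
  -- values only make the function total.
  let ret : α × (Token × Bool × ℕ) × Term × Term → List (Bool × α × Term) → List β → List (Bool × α × Term) × List β :=
    fun z l v => match v with
      | [] => (l, v)
      | vy :: v' => match v' with
        | [] => (l, v)
        | vx :: v'' => (l, g z.1 z.2.1 z.2.2.1 z.2.2.2 vx vy :: v'')
  -- The recursion is unfolded into a stack of frames. A node is first replaced by its two subterms
  -- followed by itself with the flag set; when it comes back, both values are on the stack and are
  -- combined.
  let visit : Bool × α × Term → List (Bool × α × Term) → List β → List (Bool × α × Term) × List β :=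
    fun fr l v => match fr.2.2 with
      | .nil => (l, base fr.2.1 :: v)
      | .node a x y => bif fr.1 then ret (fr.2.1, a, x, y) l v else
          ((false, dl fr.2.1 a x y, x) :: (false, dr fr.2.1 a x y, y) ::
            (true, fr.2.1, .node a x y) :: l, v)
  let step : List (Bool × α × Term) × List β → List (Bool × α × Term) × List β :=
    fun s => match s.1 with
      | [] => s
      | fr :: l => visit fr l s.2
  have hret : Poly fun z : (α × (Token × Bool × ℕ) × Term × Term) × List (Bool × α × Term) ×
      List β => ret z.1 z.2.1 z.2.2 := by
    have hg' := hg.comp (f := fun y : (((α × (Token × Bool × ℕ) × Term × Term) ×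
      List (Bool × α × Term) × List β) × β × List β) × β × List β =>
      (y.1.1.1.1, y.1.1.1.2.1, y.1.1.1.2.2.1, y.1.1.1.2.2.2, y.2.1, y.1.2.1)) (by fun_prop)
    refine (listCases (l := fun z : (α × (Token × Bool × ℕ) × Term × Term) ×
      List (Bool × α × Term) × List β => z.2.2) (f := fun z => z.2) (by fun_prop) (by fun_prop)
      (listCases (l := fun y => y.2.2) (f := fun y => y.1.2) (by fun_prop) (by fun_prop)
        (((by fun_prop : Poly fun y : (((α × (Token × Bool × ℕ) × Term × Term) ×
          List (Bool × α × Term) × List β) × β × List β) × β × List β => y.1.1.2.1)).pair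
          (hg'.cons (by fun_prop : Poly fun y => y.2.2))))).of_enc fun z => ⟨z, rfl, ?_⟩
    rcases z with ⟨z, l, _ | ⟨v, _ | ⟨v', v''⟩⟩⟩ <;> rfl
  have hvisit : Poly fun z : (Bool × α × Term) × List (Bool × α × Term) × List β =>
      visit z.1 z.2.1 z.2.2 := by
    have h1 := hbase.comp (f := fun z : (Bool × α × Term) × List (Bool × α × Term) × List β =>
      z.1.2.1) (by fun_prop)
    have h2 := hret.comp (f := fun y : ((Bool × α × Term) × List (Bool × α × Term) × List β) ×
      (Token × Bool × ℕ) × Term × Term => ((y.1.1.2.1, y.2), y.1.2)) (by fun_prop)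
    have h3 := hdl.comp (f := fun y : ((Bool × α × Term) × List (Bool × α × Term) × List β) ×
      (Token × Bool × ℕ) × Term × Term => (y.1.1.2.1, y.2)) (by fun_prop)
    have h4 := hdr.comp (f := fun y : ((Bool × α × Term) × List (Bool × α × Term) × List β) ×
      (Token × Bool × ℕ) × Term × Term => (y.1.1.2.1, y.2)) (by fun_prop)
    refine (termCases (t := fun z : (Bool × α × Term) × List (Bool × α × Term) × List β => z.1.2.2)
      (f := fun z => (z.2.1, base z.1.2.1 :: z.2.2))
      (g := fun y => bif y.1.1.1 then ret (y.1.1.2.1, y.2) y.1.2.1 y.1.2.2 else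
        ((false, dl y.1.1.2.1 y.2.1 y.2.2.1 y.2.2.2, y.2.2.1) ::
          (false, dr y.1.1.2.1 y.2.1 y.2.2.1 y.2.2.2, y.2.2.2) ::
          (true, y.1.1.2.1, .node y.2.1 y.2.2.1 y.2.2.2) :: y.1.2.1, y.1.2.2))
      (by fun_prop) (by fun_prop) (by fun_prop)).of_enc fun z => ⟨z, rfl, ?_⟩
    rcases z with ⟨⟨b, c, _ | ⟨a, x, y⟩⟩, l, v⟩ <;> rfl
  have hstep : Poly step := by
    refine (listCases (l := fun s : List (Bool × α × Term) × List β => s.1) (f := fun s => s)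
      (g := fun y => visit y.2.1 y.2.2 y.1.2) (by fun_prop) (by fun_prop)
      (hvisit.comp (f := fun y : (List (Bool × α × Term) × List β) × (Bool × α × Term) ×
        List (Bool × α × Term) => (y.2.1, y.2.2, y.1.2)) (by fun_prop))).of_enc fun s => ⟨s, rfl, ?_⟩
    rcases s with ⟨_ | ⟨fr, l⟩, v⟩ <;> rfl
  refine loop hstep (init := fun z : α × Term => ([(false, z.1, z.2)], [])) (by fun_prop)
    (q + 2 * Polynomial.X + 3 + Polynomial.X * (2 * (2 * Polynomial.X + q + 10))) fun z => ?_
  -- `K`, `T`, `V` bound parameters, terms and values. `D` is an allowance of space per unit of term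
  -- size, ample for the frames and values that one node contributes, so the space needed is at most
  -- that of the stacks below plus `sz t * D`.
  have key : ∀ (K T V D B : ℕ), D = 2 * (K + T + V + 10) →
      (∀ c t, sz c ≤ K → sz t ≤ T → sz (f c t) ≤ V) →
      ∀ (t : Term) (c : α) (l : List (Bool × α × Term)) (v : List β), sz c ≤ K → sz t ≤ T →
        sz l + sz v + sz t * D ≤ B →
        ∃ n ≤ 2 * sz t, Iter step B n ((false, c, t) :: l, v) (l, f c t :: v) := by
    intro K T V D B hD hV t
    induction t with
    | nil =>
      intro c l v hc ht hB
      refine ⟨1, by simp, Iter.step ?_ ?_⟩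
      · simp at hB ⊢
        omega
      · rw [h0]
        exact .refl _
    | node a x y ihx ihy =>
      intro c l v hc ht hB
      have hV' := hV (dl c a x y) x ((hl ..).trans hc)
      have hV'' := hV (dr c a x y) y ((hr ..).trans hc)
      have ha : sz a = sz a.2.2 + 4 := by
        simp
        omega
      have e : sz x * D + sz y * D + 2 * D ≤ sz (Term.node a x y) * D := by
        rw [← add_mul, ← add_mul]
        exact Nat.mul_le_mul_right _ (by simp only [sz_node]; omega)
      have hl' := hl c a x y
      have hr' := hr c a x y
      simp only [sz_node] at ht
      obtain ⟨n, hn, hx⟩ := ihx (dl c a x y)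
        ((false, dr c a x y, y) :: (true, c, .node a x y) :: l) v (hl'.trans hc) (by omega) (by
          simp
          omega)
      obtain ⟨n', hn', hy⟩ := ihy (dr c a x y) ((true, c, .node a x y) :: l)
        (f (dl c a x y) x :: v) (hr'.trans hc) (by omega) (by
          have := hV' (by omega)
          simp
          omega)
      -- Besides the rounds for the subterms, a node takes one round to be expanded and one to
      -- combine the values.
      refine ⟨(n + (n' + (0 + 1))) + 1, by simp only [sz_node]; omega,
        Iter.step (by simp; omega) (hx.trans (hy.trans (Iter.step ?_ ?_)))⟩
      · have := hV' (by omega)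
        have := hV'' (by omega)
        simp
        omega
      · rw [h1]
        exact .refl _
  obtain ⟨n, hn, h⟩ := key (sz z.1) (sz z.2) (q.eval (sz z.1 + sz z.2)) _ _ rfl
    (fun c t hc ht => (hq c t).trans (eval_mono q (add_le_add hc ht))) z.2 z.1 [] [] le_rfl le_rfl
    le_rfl
  have hz := hq z.1 z.2
  have hz' : sz z = sz z.1 + sz z.2 + 1 := rfl
  have hm : q.eval (sz z.1 + sz z.2) ≤ q.eval (sz z) := eval_mono q (by omega)
  have := Nat.mul_le_mul (show sz z.2 ≤ sz z by omega)
    (show 2 * (sz z.1 + sz z.2 + q.eval (sz z.1 + sz z.2) + 10) ≤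
      2 * (2 * sz z + q.eval (sz z) + 10) by omega)
  have hB : (q + 2 * Polynomial.X + 3 + Polynomial.X * (2 * (2 * Polynomial.X + q + 10))).eval
      (sz z) = q.eval (sz z) + 2 * sz z + 3 + sz z * (2 * (2 * sz z + q.eval (sz z) + 10)) := by
    simp only [Polynomial.eval_add, Polynomial.eval_mul, Polynomial.eval_X, Polynomial.eval_ofNat]
  rw [hB]
  refine ⟨by simp only [sz_cons, sz_nil]; omega, n, by omega, h.mono ?_⟩
  simp only [sz_nil]
  omega

end Poly
end POL

namespace POL
open Turing Function Code

/-! ### Syntax checks and residues on terms -/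

namespace Term

def isNil : Term → Bool
  | nil => true
  | node _ _ _ => false

def tok : Term → Token
  | nil => .fin
  | node a _ _ => a.1

def num : Term → ℕ
  | nil => 0
  | node a _ _ => a.2.2

/-- The term represents an expression with letters below `k` and without marks. -/
def isExpr (k : ℕ) : Term → Bool
  | nil => false
  | node a x y => !a.2.1 && match a.1 with
    | .zero | .epsilon => decide (a.2.2 = 0) && (x.isNil && y.isNil)
    | .char => decide (a.2.2 < k) && (x.isNil && y.isNil)
    | .plus | .comp => decide (a.2.2 = 0) && (x.isExpr k && y.isExpr k)
    | .star => decide (a.2.2 = 0) && (x.isExpr k && y.isNil)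
    | _ => false

/-- The term represents a single word with letters below `k`. -/
def isWord (k : ℕ) : Term → Bool
  | nil => false
  | node a x y => !a.2.1 && match a.1 with
    | .epsilon => decide (a.2.2 = 0) && (x.isNil && y.isNil)
    | .char => decide (a.2.2 < k) && (x.isNil && y.isNil)
    | .comp => decide (a.2.2 = 0) && (x.isWord k && y.isWord k)
    | _ => false

/-- The term represents a formula of the word fragment with agents below `m` and letters
below `k`. -/
def isForm (m k : ℕ) : Term → Bool
  | nil => false
  | node a x y => !a.2.1 && match a.1 with
    | .top => decide (a.2.2 = 0) && (x.isNil && y.isNil)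
    | .prop => x.isNil && y.isNil
    | .neg => decide (a.2.2 = 0) && (x.isForm m k && y.isNil)
    | .and => decide (a.2.2 = 0) && (x.isForm m k && y.isForm m k)
    | .know => decide (a.2.2 < m) && (x.isForm m k && y.isNil)
    | .box => decide (a.2.2 = 0) && (x.isWord k && y.isForm m k)
    | _ => false

/-- Whether the empty word belongs to the language of an expression. -/
def nullable : Term → Bool
  | nil => false
  | node a x y => match a.1 with
    | .epsilon | .star => true
    | .plus => x.nullable || y.nullable
    | .comp => x.nullable && y.nullable
    | _ => false

/-- Whether the language of an expression is not empty. -/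
def nonempty : Term → Bool
  | nil => false
  | node a x y => match a.1 with
    | .epsilon | .star | .char => true
    | .plus => x.nonempty || y.nonempty
    | .comp => x.nonempty && y.nonempty
    | _ => false

/-- Whether the empty word can be read from a marked position. -/
def final : Term → Bool
  | nil => false
  | node a x y => match a.1 with
    | .char => a.2.1
    | .plus => x.final || y.final
    | .comp => x.final && y.nullable || y.final
    | .star => x.final
    | _ => false

/-- Whether some word can be read from a marked position. -/
def alive : Term → Bool
  | nil => false
  | node a x y => match a.1 with
    | .char => a.2.1
    | .plus => x.alive || y.alive
    | .comp => x.alive && y.nonempty || y.alive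
    | .star => x.alive
    | _ => false

/-- Move the marks of an expression over the letter `c.2`, where `c.1` tells whether the beginning
of the expression is marked. -/
def shift : Bool × ℕ → Term → Term
  | _, nil => nil
  | c, node a x y => node
      (match a.1 with
        | .char => (.char, c.1 && decide (a.2.2 = c.2), a.2.2)
        | _ => a)
      (x.shift (match a.1 with
        | .star => c.1 || x.final
        | _ => c.1, c.2))
      (y.shift (match a.1 with
        | .comp => c.1 && x.nullable || x.final
        | _ => c.1, c.2))

/-- The word that a word expression consists of. -/
def word : Term → List ℕ
  | nil => []
  | node a x y => match a.1 with
    | .char => [a.2.2]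
    | .comp => x.word ++ y.word
    | _ => []

end Term

/-- A state is a marked expression with a flag that marks its beginning. -/
abbrev State := Bool × Term

namespace State

def step (s : State) (a : ℕ) : State := (false, s.2.shift (s.1, a))

def steps (s : State) (w : List ℕ) : State := w.foldl step s

/-- Whether some word can be read from the state. -/
def alive (s : State) : Bool := s.1 && s.2.nonempty || s.2.alive

end State

/-! ### Syntax checks and the reading of words in polynomial time. -/

namespace Poly
variable {α β γ δ : Type} [Code α] [Code β] [Code γ] [Code δ]

attribute [fun_prop] token_bool bool_token

theorem termCata {f : Term → β} {base : β}
    {g : Token × Bool × ℕ → Term → Term → β → β → β} (h0 : f .nil = base)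
    (h1 : ∀ a x y, f (.node a x y) = g a x y (f x) (f y))
    (hg : Poly fun z : (Token × Bool × ℕ) × Term × Term × β × β =>
      g z.1 z.2.1 z.2.2.1 z.2.2.2.1 z.2.2.2.2)
    (q : Polynomial ℕ) (hq : ∀ t, sz (f t) ≤ q.eval (sz t)) : Poly f := by
  have := termRec (α := Bool) (f := fun _ => f) (base := fun _ => base) (dl := fun c _ _ _ => c)
    (dr := fun c _ _ _ => c) (g := fun _ => g) (fun _ => h0) (fun _ => h1) (by fun_prop)
    (by fun_prop) (by fun_prop) (hg.comp Poly.snd) (by simp) (by simp) q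
    fun c t => (hq t).trans (eval_mono q (by simp))
  exact this.comp (f := fun t => (true, t)) (by fun_prop)

@[fun_prop]
theorem isNil {t : α → Term} (ht : Poly t) : Poly fun a => (t a).isNil := by
  refine (isLeaf_enc ht).of_enc fun a => ⟨a, rfl, ?_⟩
  cases t a <;> rfl

@[fun_prop]
theorem tok {t : α → Term} (ht : Poly t) : Poly fun a => (t a).tok := by
  refine (termCases (g := fun y => y.2.1.1) ht (.const .fin) (by fun_prop)).of_enc
    fun a => ⟨a, rfl, ?_⟩
  cases t a <;> rfl

@[fun_prop]
theorem num {t : α → Term} (ht : Poly t) : Poly fun a => (t a).num := by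
  refine (termCases (g := fun y => y.2.1.2.2) ht (.const 0) (by fun_prop)).of_enc
    fun a => ⟨a, rfl, ?_⟩
  cases t a <;> rfl

@[fun_prop]
theorem nullable {t : α → Term} (ht : Poly t) : Poly fun a => (t a).nullable := by
  refine Poly.comp (g := Term.nullable) ?_ ht
  refine termCata (g := fun a x y rx ry => match a.1 with
    | .epsilon | .star => true
    | .plus => rx || ry
    | .comp => rx && ry
    | _ => false) rfl (fun a x y => rfl) ?_ 1 (by simp)
  refine switch (c := fun z : (Token × Bool × ℕ) × Term × Term × Bool × Bool => z.1.1)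
    (f := fun t z => match t with
      | .epsilon | .star => true
      | .plus => z.2.2.2.1 || z.2.2.2.2
      | .comp => z.2.2.2.1 && z.2.2.2.2
      | _ => false) (by fun_prop) fun t => ?_
  cases t <;> fun_prop

@[fun_prop]
theorem nonempty {t : α → Term} (ht : Poly t) : Poly fun a => (t a).nonempty := by
  refine Poly.comp (g := Term.nonempty) ?_ ht
  refine termCata (g := fun a x y rx ry => match a.1 with
      | .epsilon | .star | .char => true
      | .plus => rx || ry
      | .comp => rx && ry
      | _ => false) rfl (fun a x y => rfl) ?_ 1 (by simp)
  refine switch (c := fun z : (Token × Bool × ℕ) × Term × Term × Bool × Bool => z.1.1)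
    (f := fun t z => match t with
      | .epsilon | .star | .char => true
      | .plus => z.2.2.2.1 || z.2.2.2.2
      | .comp => z.2.2.2.1 && z.2.2.2.2
      | _ => false) (by fun_prop) fun t => ?_
  cases t <;> fun_prop

@[fun_prop]
theorem final {t : α → Term} (ht : Poly t) : Poly fun a => (t a).final := by
  refine Poly.comp (g := Term.final) ?_ ht
  refine termCata (g := fun a x y rx ry => match a.1 with
      | .char => a.2.1
      | .plus => rx || ry
      | .comp => rx && y.nullable || ry
      | .star => rx
      | _ => false) rfl (fun a x y => rfl) ?_ 1 (by simp)
  refine switch (c := fun z : (Token × Bool × ℕ) × Term × Term × Bool × Bool => z.1.1)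
    (f := fun t z => match t with
      | .char => z.1.2.1
      | .plus => z.2.2.2.1 || z.2.2.2.2
      | .comp => z.2.2.2.1 && z.2.2.1.nullable || z.2.2.2.2
      | .star => z.2.2.2.1
      | _ => false) (by fun_prop) fun t => ?_
  cases t <;> fun_prop

@[fun_prop]
theorem alive {t : α → Term} (ht : Poly t) : Poly fun a => (t a).alive := by
  refine Poly.comp (g := Term.alive) ?_ ht
  refine termCata (g := fun a x y rx ry => match a.1 with
      | .char => a.2.1
      | .plus => rx || ry
      | .comp => rx && y.nonempty || ry
      | .star => rx
      | _ => false) rfl (fun a x y => rfl) ?_ 1 (by simp)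
  refine switch (c := fun z : (Token × Bool × ℕ) × Term × Term × Bool × Bool => z.1.1)
    (f := fun t z => match t with
      | .char => z.1.2.1
      | .plus => z.2.2.2.1 || z.2.2.2.2
      | .comp => z.2.2.2.1 && z.2.2.1.nonempty || z.2.2.2.2
      | .star => z.2.2.2.1
      | _ => false) (by fun_prop) fun t => ?_
  cases t <;> fun_prop

theorem isExpr : Poly fun z : (ℕ) × Term => z.2.isExpr z.1 := by
  refine termRec (g := fun c a x y rx ry => !a.2.1 && match a.1 with
      | .zero | .epsilon => decide (a.2.2 = 0) && (x.isNil && y.isNil)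
      | .char => decide (a.2.2 < c) && (x.isNil && y.isNil)
      | .plus | .comp => decide (a.2.2 = 0) && (rx && ry)
      | .star => decide (a.2.2 = 0) && (rx && y.isNil)
      | _ => false) (fun c => rfl) (fun c a x y => rfl) (.const false)
    (dl := fun c _ _ _ => c) (dr := fun c _ _ _ => c) (by fun_prop) (by fun_prop) ?_
    (by simp) (by simp) 1 (by simp)
  refine Poly.and (by fun_prop) (switch
    (c := fun z : (ℕ) × (Token × Bool × ℕ) × Term × Term × Bool × Bool => z.2.1.1)
    (f := fun t z => match t with
      | .zero | .epsilon => decide (z.2.1.2.2 = 0) && (z.2.2.1.isNil && z.2.2.2.1.isNil)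
      | .char => decide (z.2.1.2.2 < z.1) && (z.2.2.1.isNil && z.2.2.2.1.isNil)
      | .plus | .comp => decide (z.2.1.2.2 = 0) && (z.2.2.2.2.1 && z.2.2.2.2.2)
      | .star => decide (z.2.1.2.2 = 0) && (z.2.2.2.2.1 && z.2.2.2.1.isNil)
      | _ => false) (by fun_prop) fun t => ?_)
  cases t <;> fun_prop

theorem isWord : Poly fun z : (ℕ) × Term => z.2.isWord z.1 := by
  refine termRec (g := fun c a x y rx ry => !a.2.1 && match a.1 with
      | .epsilon => decide (a.2.2 = 0) && (x.isNil && y.isNil)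
      | .char => decide (a.2.2 < c) && (x.isNil && y.isNil)
      | .comp => decide (a.2.2 = 0) && (rx && ry)
      | _ => false) (fun c => rfl) (fun c a x y => rfl) (.const false)
    (dl := fun c _ _ _ => c) (dr := fun c _ _ _ => c) (by fun_prop) (by fun_prop) ?_
    (by simp) (by simp) 1 (by simp)
  refine Poly.and (by fun_prop) (switch
    (c := fun z : (ℕ) × (Token × Bool × ℕ) × Term × Term × Bool × Bool => z.2.1.1)
    (f := fun t z => match t with
      | .epsilon => decide (z.2.1.2.2 = 0) && (z.2.2.1.isNil && z.2.2.2.1.isNil)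
      | .char => decide (z.2.1.2.2 < z.1) && (z.2.2.1.isNil && z.2.2.2.1.isNil)
      | .comp => decide (z.2.1.2.2 = 0) && (z.2.2.2.2.1 && z.2.2.2.2.2)
      | _ => false) (by fun_prop) fun t => ?_)
  cases t <;> fun_prop

theorem isForm : Poly fun z : (ℕ × ℕ) × Term => z.2.isForm z.1.1 z.1.2 := by
  refine termRec (f := fun (c : ℕ × ℕ) t => t.isForm c.1 c.2)
    (g := fun (c : ℕ × ℕ) a x y rx ry => !a.2.1 && match a.1 with
      | .top => decide (a.2.2 = 0) && (x.isNil && y.isNil)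
      | .prop => x.isNil && y.isNil
      | .neg => decide (a.2.2 = 0) && (rx && y.isNil)
      | .and => decide (a.2.2 = 0) && (rx && ry)
      | .know => decide (a.2.2 < c.1) && (rx && y.isNil)
      | .box => decide (a.2.2 = 0) && (x.isWord c.2 && ry)
      | _ => false) (fun c => rfl) (fun c a x y => rfl) (.const false)
    (dl := fun c _ _ _ => c) (dr := fun c _ _ _ => c) (by fun_prop) (by fun_prop) ?_
    (by simp) (by simp) 1 (by simp)
  have hw := isWord.comp (f := fun z : (ℕ × ℕ) × (Token × Bool × ℕ) × Term × Term × Bool × Bool =>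
    (z.1.2, z.2.2.1)) (by fun_prop)
  refine Poly.and (by fun_prop) (switch
    (c := fun z : (ℕ × ℕ) × (Token × Bool × ℕ) × Term × Term × Bool × Bool => z.2.1.1)
    (f := fun t z => match t with
      | .top => decide (z.2.1.2.2 = 0) && (z.2.2.1.isNil && z.2.2.2.1.isNil)
      | .prop => z.2.2.1.isNil && z.2.2.2.1.isNil
      | .neg => decide (z.2.1.2.2 = 0) && (z.2.2.2.2.1 && z.2.2.2.1.isNil)
      | .and => decide (z.2.1.2.2 = 0) && (z.2.2.2.2.1 && z.2.2.2.2.2)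
      | .know => decide (z.2.1.2.2 < z.1.1) && (z.2.2.2.2.1 && z.2.2.2.1.isNil)
      | .box => decide (z.2.1.2.2 = 0) && (z.2.2.1.isWord z.1.2 && z.2.2.2.2.2)
      | _ => false) (by fun_prop) fun t => ?_)
  cases t <;> fun_prop

@[fun_prop]
theorem word {t : α → Term} (ht : Poly t) : Poly fun a => (t a).word := by
  refine Poly.comp (g := Term.word) ?_ ht
  refine termCata (g := fun a x y rx ry => match a.1 with
      | .char => [a.2.2]
      | .comp => rx ++ ry
      | _ => []) rfl (fun a x y => rfl) ?_ Polynomial.X fun t => ?_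
  · refine switch (c := fun z : (Token × Bool × ℕ) × Term × Term × List ℕ × List ℕ => z.1.1)
      (f := fun t z => match t with
        | .char => [z.1.2.2]
        | .comp => z.2.2.2.1 ++ z.2.2.2.2
        | _ => []) (by fun_prop) fun t => ?_
    cases t <;> fun_prop
  · rw [Polynomial.eval_X]
    induction t with
    | nil => simp [Term.word]
    | node a x y ihx ihy =>
      obtain ⟨t, b, n⟩ := a
      have := sz_append x.word y.word
      cases t <;> simp [Term.word] <;> omega

-- Only marks change, and both truth values have size 1. Hence reading a word of any length leaves
-- the size of a state unchanged, in contrast to residues.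
@[simp] theorem _root_.POL.sz_shift (c : Bool × ℕ) (t : Term) : sz (t.shift c) = sz t := by
  induction t generalizing c with
  | nil => rfl
  | node a x y ihx ihy =>
    obtain ⟨t, b, n⟩ := a
    cases t <;> simp [Term.shift, ihx, ihy]

theorem shift : Poly fun z : (Bool × ℕ) × Term => z.2.shift z.1 := by
  refine termRec (f := fun c t => t.shift c)
    (g := fun c a x y rx ry => .node (match a.1 with
        | .char => (.char, c.1 && decide (a.2.2 = c.2), a.2.2)
        | _ => a) rx ry)
    (dl := fun c a x _ => (match a.1 with
        | .star => c.1 || x.final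
        | _ => c.1, c.2))
    (dr := fun c a x _ => (match a.1 with
        | .comp => c.1 && x.nullable || x.final
        | _ => c.1, c.2))
    (fun c => rfl) (fun c a x y => rfl) (Poly.const Term.nil) ?_ ?_ ?_ (by simp) (by simp) Polynomial.X
    (by simp)
  · refine pair (switch (c := fun z : (Bool × ℕ) × (Token × Bool × ℕ) × Term × Term => z.2.1.1)
      (f := fun t z => match t with
        | .star => z.1.1 || z.2.2.1.final
        | _ => z.1.1) (by fun_prop) fun t => ?_) (by fun_prop)
    cases t <;> fun_prop
  · refine pair (switch (c := fun z : (Bool × ℕ) × (Token × Bool × ℕ) × Term × Term => z.2.1.1)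
      (f := fun t z => match t with
        | .comp => z.1.1 && z.2.2.1.nullable || z.2.2.1.final
        | _ => z.1.1) (by fun_prop) fun t => ?_) (by fun_prop)
    cases t <;> fun_prop
  · refine node (switch (c := fun z : (Bool × ℕ) × (Token × Bool × ℕ) × Term × Term × Term × Term =>
      z.2.1.1)
      (f := fun t z => match t with
        | .char => (Token.char, z.1.1 && decide (z.2.1.2.2 = z.1.2), z.2.1.2.2)
        | _ => z.2.1) (by fun_prop) fun t => ?_) (by fun_prop) (by fun_prop)
    cases t <;> fun_prop

@[simp] theorem _root_.POL.sz_step (s : State) (a : ℕ) : sz (s.step a) = sz s := by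
  simp [State.step]

@[simp] theorem _root_.POL.sz_steps (s : State) (w : List ℕ) : sz (s.steps w) = sz s := by
  induction w generalizing s with
  | nil => rfl
  | cons a w ih => exact (ih _).trans (sz_step s a)

@[fun_prop]
theorem steps {s : α → State} {w : α → List ℕ} (hs : Poly s) (hw : Poly w) :
    Poly fun a => (s a).steps (w a) := by
  have h := shift.comp (f := fun z : α × State × ℕ => ((z.2.1.1, z.2.2), z.2.1.2)) (by fun_prop)
  exact foldl (s := fun _ s b => s.step b) hw hs ((Poly.const false).pair h) 0
    fun a c b => by rw [sz_step]; simp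

@[fun_prop]
theorem state_alive {s : α → State} (hs : Poly s) : Poly fun a => (s a).alive := by
  simp only [State.alive]
  fun_prop

end Poly
end POL

namespace POL
open Turing Function Code

/-! ### Reading instances -/

/-- The end marker of a number. -/
def Token.isFin : Token → Bool
  | .fin => true
  | _ => false

/-- The truth value of a bit. -/
def Token.bits : Token → List Bool
  | .bit b => [b]
  | _ => []

/-- Whether the token is followed by a number. -/
def Token.hasNumber : Token → Bool
  | .char | .prop | .know => true
  | _ => false

/-- Whether the token begins an observation expression. -/
def Token.isOperator : Token → Bool
  | .zero | .epsilon | .char | .plus | .comp | .star => true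
  | _ => false

/-- The top of a stack of terms. -/
def top : List Term → Term
  | [] => .nil
  | t :: _ => t

/-- Read a token, from the right, with the stack of the terms that were read so far. Numbers are
kept as nodes with the token `fin`, entries of matrices as nodes with the token `bit b`. -/
def readToken (t : Token) (st : List Term) : List Term :=
  match t with
  | .bit b => bif (top st).tok.isFin
      then .node (.fin, false, Nat.bit b (top st).num) .nil .nil :: st.tail
      else .node (.bit b, false, 0) .nil .nil :: st
  | .fin => .node (.fin, false, 0) .nil .nil :: st
  | .zero => .node (.zero, false, 0) .nil .nil :: st
  | .epsilon => .node (.epsilon, false, 0) .nil .nil :: st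
  | .top => .node (.top, false, 0) .nil .nil :: st
  | .char => .node (.char, false, (top st).num) .nil .nil :: st.tail
  | .prop => .node (.prop, false, (top st).num) .nil .nil :: st.tail
  | .star => .node (.star, false, 0) (top st) .nil :: st.tail
  | .neg => .node (.neg, false, 0) (top st) .nil :: st.tail
  | .plus => .node (.plus, false, 0) (top st) (top st.tail) :: st.tail.tail
  | .comp => .node (.comp, false, 0) (top st) (top st.tail) :: st.tail.tail
  | .and => .node (.and, false, 0) (top st) (top st.tail) :: st.tail.tail
  | .box => .node (.box, false, 0) (top st) (top st.tail) :: st.tail.tail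
  | .know => .node (.know, false, (top st).num) (top st.tail) .nil :: st.tail.tail

/-- The stack of terms of a string. -/
def parse (x : List Token) : List Term := x.foldr readToken []

/-- The components of an instance, as they are read. -/
structure Raw where
  agents : ℕ
  actions : ℕ
  worlds : ℕ
  mats : List (List (List Bool))
  infos : List (List ℕ × Term)
  point : ℕ
  formula : Term

/-- Cut a list into pieces of length `n`, beginning at its end. -/
def chunk {β : Type} (n : ℕ) (l : List β) : List (List β) :=
  l.foldr (fun b acc => match acc with
    | [] => [[b]]
    | c :: r => bif decide (c.length = n) then [b] :: c :: r else (b :: c) :: r) []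

/-- Collect the valuations and the expectations of the worlds. -/
def addInfo (t : Term) (ws : List (List ℕ × Term)) : List (List ℕ × Term) :=
  bif t.tok.isOperator then ([], t) :: ws
  else bif t.tok.hasNumber then
    match ws with
    | [] => []
    | w :: r => (t.num :: w.1, w.2) :: r
  else ws

/-- Collect the components of an instance from the list of its terms. -/
def assemble (l : List Term) : Raw where
  agents := (top l).num
  actions := (top l.tail).num
  worlds := (top l.tail.tail).num
  mats := chunk (top l.tail.tail).num (chunk (top l.tail.tail).num (l.flatMap fun t => t.tok.bits))
  infos := l.foldr addInfo []
  point := (top l.reverse.tail).num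
  formula := top l.reverse

/-- The string of a term. -/
def Term.unparse : Term → List Token
  | .nil => []
  | .node a x y =>
      a.1 :: ((bif a.1.hasNumber then encodeNumber a.2.2 else []) ++ (x.unparse ++ y.unparse))

/-- The string of the components of an instance. -/
def Raw.encode (R : Raw) : List Token :=
  encodeNumber R.agents ++ encodeNumber R.actions ++ encodeNumber R.worlds ++
  (R.mats.flatMap fun m => m.flatMap fun r => r.map Token.bit) ++
  (R.infos.flatMap fun w => (w.1.flatMap fun p => Token.prop :: encodeNumber p) ++ w.2.unparse) ++
  encodeNumber R.point ++ R.formula.unparse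

/-- Whether a matrix is the matrix of an equivalence relation. -/
def isEquivMatrix (m : List (List Bool)) : Bool :=
  m.all fun r => decide (r = m.map fun r' => decide (r' = r))

/-- Whether the components are those of an instance with a formula of the word fragment. -/
def Raw.valid (R : Raw) : Bool :=
  decide (R.infos.length = R.worlds) && (decide (R.mats.length = R.agents) &&
  ((R.mats.all fun m => decide (m.length = R.worlds) && isEquivMatrix m) &&
  ((R.infos.all fun w => w.2.isExpr R.actions && w.2.nonempty) &&
  (decide (R.point < R.worlds) && R.formula.isForm R.agents R.actions))))

/-- Truth at the worlds that survive. -/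
def restrict (c : List State) (r : List Bool) : List Bool :=
  c.zipWith (fun s b => !s.alive || b) r

/-- The truth values of a formula at the worlds, if the worlds are in the states `c`. -/
def Raw.eval (R : Raw) : List State → Term → List Bool
  | _, .nil => []
  | c, .node a x y => match a.1 with
    | .top => c.map fun _ => true
    | .prop => R.infos.map fun w => w.1.any fun p => decide (p = a.2.2)
    | .neg => (R.eval c x).map fun b => !b
    | .and => (R.eval c x).zipWith (fun b b' => b && b') (R.eval c y)
    | .know => (R.mats.getD a.2.2 []).map fun r =>
        (r.zipWith (fun e b => !e || b) (restrict c (R.eval c x))).all fun b => b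
    | .box =>
        restrict (c.map fun s => s.steps x.word) (R.eval (c.map fun s => s.steps x.word) y)
    | _ => []

noncomputable instance : DecidableEq Token := Classical.decEq _

/-- The decision procedure. -/
noncomputable def check (x : List Token) : Bool :=
  decide ((assemble (parse x)).encode = x) && ((assemble (parse x)).valid &&
    ((assemble (parse x)).eval ((assemble (parse x)).infos.map fun w => (true, w.2))
      (assemble (parse x)).formula).getD (assemble (parse x)).point false)

/-! ### The decision procedure takes polynomial time -/

instance : Code Raw :=
  ⟨fun R => enc (R.agents, R.actions, R.worlds, R.mats, R.infos, R.point, R.formula)⟩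

namespace Poly
variable {α β γ δ : Type} [Code α] [Code β] [Code γ] [Code δ]

theorem raw {R : α → Raw} (hR : Poly R) : Poly fun a => ((R a).agents, (R a).actions, (R a).worlds,
    (R a).mats, (R a).infos, (R a).point, (R a).formula) :=
  hR.of_enc fun a => ⟨a, rfl, rfl⟩

@[fun_prop]
theorem agents {R : α → Raw} (hR : Poly R) : Poly fun a => (R a).agents :=
  Poly.fst.comp hR.raw

@[fun_prop]
theorem actions {R : α → Raw} (hR : Poly R) : Poly fun a => (R a).actions :=
  Poly.fst.comp (Poly.snd.comp hR.raw)

@[fun_prop]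
theorem worlds {R : α → Raw} (hR : Poly R) : Poly fun a => (R a).worlds :=
  Poly.fst.comp (Poly.snd.comp (Poly.snd.comp hR.raw))

@[fun_prop]
theorem mats {R : α → Raw} (hR : Poly R) : Poly fun a => (R a).mats :=
  Poly.fst.comp (Poly.snd.comp (Poly.snd.comp (Poly.snd.comp hR.raw)))

@[fun_prop]
theorem infos {R : α → Raw} (hR : Poly R) : Poly fun a => (R a).infos :=
  Poly.fst.comp (Poly.snd.comp (Poly.snd.comp (Poly.snd.comp (Poly.snd.comp hR.raw))))

@[fun_prop]
theorem point {R : α → Raw} (hR : Poly R) : Poly fun a => (R a).point :=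
  Poly.fst.comp (Poly.snd.comp (Poly.snd.comp (Poly.snd.comp (Poly.snd.comp (Poly.snd.comp hR.raw)))))

@[fun_prop]
theorem formula {R : α → Raw} (hR : Poly R) : Poly fun a => (R a).formula :=
  Poly.snd.comp (Poly.snd.comp (Poly.snd.comp (Poly.snd.comp (Poly.snd.comp (Poly.snd.comp hR.raw)))))

@[fun_prop]
theorem top {l : α → List Term} (hl : Poly l) : Poly fun a => POL.top (l a) := by
  refine (listCases (g := fun y => y.2.1) hl (.const .nil) (by fun_prop)).of_enc
    fun a => ⟨a, rfl, ?_⟩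
  cases l a <;> rfl

@[fun_prop]
theorem tail {l : α → List β} (hl : Poly l) : Poly fun a => (l a).tail := by
  refine (listCases (g := fun y => y.2.2) hl (.const []) (by fun_prop)).of_enc
    fun a => ⟨a, rfl, ?_⟩
  cases l a <;> rfl

theorem readToken : Poly fun z : Token × List Term => POL.readToken z.1 z.2 := by
  refine switch (f := fun t (z : Token × List Term) => POL.readToken t z.2) (by fun_prop) fun t => ?_
  cases t <;> simp only [POL.readToken] <;> fun_prop

/-- Operands are moved from the stack into the new node, not copied, and a digit lengthens a number
by at most one. So each token adds a constant, and 20 is a generous one; an operand missing from the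
stack is replaced by a `nil` of size 1. -/
theorem parse : Poly POL.parse := by
  have := readToken.comp (f := fun z : List Token × Token × List Term => z.2) (by fun_prop)
  refine foldr (s := fun _ => POL.readToken) (i := fun _ => []) (by fun_prop) (by fun_prop) this 20
    fun _ t st => ?_
  have h1 : ∀ t : Term, sz t.num ≤ sz t := by
    rintro (_ | ⟨⟨t, b, n⟩, x, y⟩)
    · exact le_rfl
    · simp [Term.num]
      omega
  have h2 : ∀ l : List Term, sz (POL.top l) + sz l.tail ≤ sz l + 1 := by
    rintro (_ | ⟨t, l⟩)
    · simp [POL.top]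
    · simp [POL.top]
      omega
  have h3 : ∀ b n, sz (Nat.bit b n) ≤ sz n + 2 := by
    intro b n
    by_cases h : n = 0 → b = true
    · change sz (Nat.bit b n).bits ≤ sz n.bits + 2
      rw [Nat.bits_append_bit _ _ h]
      simp
      omega
    · push Not at h
      obtain ⟨rfl, h⟩ := h
      cases b
      · simp
      · exact absurd rfl h
  have h4 := h1 (POL.top st)
  have h5 := h1 (POL.top st.tail)
  have h6 := h2 st
  have h7 := h2 st.tail
  have h8 : sz 0 = 1 := rfl
  rcases t with b | _ | _ | _ | _ | _ | _ | _ | _ | _ | _ | _ | _ | _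
  · have := h3 b (POL.top st).num
    simp only [POL.readToken]
    cases (POL.top st).tok.isFin <;> simp <;> omega
  all_goals simp [POL.readToken, h8]
  all_goals omega

theorem chunk {n : α → ℕ} {l : α → List β} (hn : Poly n) (hl : Poly l) :
    Poly fun a => POL.chunk (n a) (l a) := by
  refine foldr (s := fun a b (acc : List (List β)) => match acc with
    | [] => [[b]]
    | c :: r => bif decide (c.length = n a) then [b] :: c :: r else (b :: c) :: r) hl (.const [])
    ?_ (Polynomial.X + 3) fun a b acc => ?_
  · have := hn.comp (f := fun y : (α × β × List (List β)) × List β × List (List β) => y.1.1)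
      (by fun_prop)
    refine (listCases (l := fun z : α × β × List (List β) => z.2.2) (f := fun z => [[z.2.1]])
      (g := fun y => bif decide (y.2.1.length = n y.1.1) then [y.1.2.1] :: y.2.1 :: y.2.2
        else (y.1.2.1 :: y.2.1) :: y.2.2) (by fun_prop) (by fun_prop) (by fun_prop)).of_enc
      fun z => ⟨z, rfl, ?_⟩
    rcases z with ⟨a, b, _ | ⟨c, r⟩⟩ <;> rfl
  · rcases acc with _ | ⟨c, r⟩
    · simp
      omega
    · simp
      cases decide (c.length = n a) <;> simp <;> omega

theorem addInfo : Poly fun z : Term × List (List ℕ × Term) => POL.addInfo z.1 z.2 := by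
  have : Poly fun z : Term × List (List ℕ × Term) => bif z.1.tok.hasNumber then
      (match z.2 with
        | [] => []
        | w :: r => (z.1.num :: w.1, w.2) :: r : List (List ℕ × Term)) else z.2 := by
    refine Poly.cond (token_bool.comp (by fun_prop)) ?_ (by fun_prop)
    refine (listCases (l := fun z : Term × List (List ℕ × Term) => z.2)
      (g := fun y => (y.1.1.num :: y.2.1.1, y.2.1.2) :: y.2.2) (by fun_prop) (.const [])
      (by fun_prop)).of_enc fun z => ⟨z, rfl, ?_⟩
    rcases z with ⟨t, _ | ⟨w, r⟩⟩ <;> rfl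
  exact Poly.cond (token_bool.comp (by fun_prop)) (by fun_prop) this

theorem infos_of_terms : Poly fun l : List Term => l.foldr POL.addInfo [] := by
  refine foldr (s := fun _ => POL.addInfo) (i := fun _ => []) (by fun_prop) (by fun_prop)
    (addInfo.comp (f := fun z : List Term × Term × List (List ℕ × Term) => z.2) (by fun_prop))
    (Polynomial.X + 3) fun _ t ws => ?_
  have h : sz t.num ≤ sz t := by
    rcases t with _ | ⟨⟨t, b, n⟩, x, y⟩
    · exact le_rfl
    · simp [Term.num]
      omega
  unfold POL.addInfo
  rcases ws with _ | ⟨w, r⟩ <;> cases t.tok.isOperator <;> cases t.tok.hasNumber <;> simp <;> omega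

theorem assemble : Poly POL.assemble := by
  have h1 : Poly Token.bits := by
    refine switch (f := fun t (_ : Token) => t.bits) (by fun_prop) fun t => ?_
    cases t <;> exact .const _
  have h2 : Poly fun l : List Term => l.flatMap fun t => t.tok.bits :=
    flatMap (by fun_prop) (h1.comp (by fun_prop))
  have h3 := infos_of_terms
  have h4 : Poly fun l : List Term => POL.chunk (POL.top l.tail.tail).num
      (POL.chunk (POL.top l.tail.tail).num (l.flatMap fun t => t.tok.bits)) :=
    chunk (by fun_prop) (chunk (by fun_prop) h2)
  have h5 : Poly fun l : List Term => ((POL.top l).num, (POL.top l.tail).num,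
      (POL.top l.tail.tail).num, POL.chunk (POL.top l.tail.tail).num
      (POL.chunk (POL.top l.tail.tail).num (l.flatMap fun t => t.tok.bits)),
      l.foldr POL.addInfo [], (POL.top l.reverse.tail).num, POL.top l.reverse) := by
    fun_prop
  exact h5.of_enc fun l => ⟨l, rfl, rfl⟩

@[fun_prop]
theorem encodeNumber {n : α → ℕ} (hn : Poly n) : Poly fun a => POL.encodeNumber (n a) := by
  have : Poly fun a => (n a).bits.map Token.bit :=
    map (h := fun _ b => Token.bit b) hn.bits (bool_token.comp (by fun_prop))
  unfold POL.encodeNumber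
  fun_prop

@[fun_prop]
theorem unparse {t : α → Term} (ht : Poly t) : Poly fun a => (t a).unparse := by
  refine Poly.comp (g := Term.unparse) ?_ ht
  refine termCata (g := fun a x y rx ry =>
    a.1 :: ((bif a.1.hasNumber then POL.encodeNumber a.2.2 else []) ++ (rx ++ ry))) rfl
    (fun a x y => rfl) ?_ (2 * Polynomial.X) fun t => ?_
  · have := token_bool (f := Token.hasNumber) |>.comp
      (f := fun z : (Token × Bool × ℕ) × Term × Term × List Token × List Token => z.1.1)
      (by fun_prop)
    fun_prop
  · simp only [Polynomial.eval_mul, Polynomial.eval_ofNat, Polynomial.eval_X]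
    induction t with
    | nil => simp [Term.unparse]
    | node a x y ihx ihy =>
      obtain ⟨t, b, n⟩ := a
      have h1 : sz (POL.encodeNumber n) = sz n + 2 := by
        have h2 : ∀ l : List Bool, sz (l.map Token.bit) = sz l := by
          intro l
          induction l with
          | nil => rfl
          | cons b l ih => simp [ih]
        have := sz_append (n.bits.map Token.bit) [.fin]
        have h3 : sz n.bits = sz n := rfl
        simp only [h2, sz_cons, sz_nil, sz_token] at this
        unfold POL.encodeNumber
        omega
      have h2 := sz_append x.unparse y.unparse
      have h3 := sz_append (POL.encodeNumber n) (x.unparse ++ y.unparse)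
      have h4 := sz_pos n
      cases h : t.hasNumber <;> simp [Term.unparse, h] <;> omega

theorem encode : Poly Raw.encode := by
  unfold Raw.encode
  have h1 : Poly fun R : Raw => R.mats.flatMap fun m => m.flatMap fun r => r.map Token.bit :=
    flatMap (by fun_prop) (flatMap (l := fun x : Raw × List (List Bool) => x.2) (by fun_prop)
      (map (l := fun x : (Raw × List (List Bool)) × List Bool => x.2) (by fun_prop)
        (bool_token.comp (by fun_prop))))
  have h2 : Poly fun R : Raw => R.infos.flatMap fun w =>
      (w.1.flatMap fun p => Token.prop :: POL.encodeNumber p) ++ w.2.unparse :=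
    flatMap (by fun_prop) (append (flatMap (l := fun x : Raw × List ℕ × Term => x.2.1)
      (by fun_prop) (by fun_prop)) (by fun_prop))
  fun_prop

theorem isEquivMatrix {m : α → List (List Bool)} (hm : Poly m) :
    Poly fun a => POL.isEquivMatrix (m a) := by
  refine Poly.comp (g := POL.isEquivMatrix) ?_ hm
  exact all (l := fun m : List (List Bool) => m) (by fun_prop) (list_beq (by fun_prop)
    (map (by fun_prop) (list_beq (by fun_prop) (by fun_prop) bool_beq)) bool_beq)

theorem valid : Poly Raw.valid := by
  unfold Raw.valid
  have h1 : Poly fun R : Raw =>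
      R.mats.all fun m => decide (m.length = R.worlds) && POL.isEquivMatrix m :=
    all (by fun_prop) (Poly.and (by fun_prop) (isEquivMatrix (by fun_prop)))
  have h2 : Poly fun R : Raw => R.infos.all fun w => w.2.isExpr R.actions && w.2.nonempty :=
    all (by fun_prop) (Poly.and (isExpr.comp
      (f := fun z : Raw × List ℕ × Term => (z.1.actions, z.2.2)) (by fun_prop)) (by fun_prop))
  have h3 : Poly fun R : Raw => R.formula.isForm R.agents R.actions :=
    isForm.comp (f := fun R : Raw => ((R.agents, R.actions), R.formula)) (by fun_prop)
  fun_prop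

theorem restrict {c : α → List State} {r : α → List Bool} (hc : Poly c) (hr : Poly r) :
    Poly fun a => POL.restrict (c a) (r a) :=
  zipWith (h := fun _ (s : State) b => !s.alive || b) hc hr (by fun_prop) 1 (by simp)

/-- Every vector is indexed by a list that is already there, namely the states, the worlds' data or
the rows of a matrix, and `zipWith` never lengthens. The bound also covers terms that are not
formulas. -/
theorem _root_.POL.Raw.length_eval_le (R : Raw) (c : List State) (t : Term) :
    (R.eval c t).length ≤ sz R + sz c := by
  have hR : sz R = sz (R.agents, R.actions, R.worlds, R.mats, R.infos, R.point, R.formula) := rfl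
  simp only [sz_pair] at hR
  induction t generalizing c with
  | nil => simp [Raw.eval]
  | node a x y ihx ihy =>
    have h1 := length_lt_sz c
    have h2 := length_lt_sz R.infos
    have h3 := ihx c
    rcases a with ⟨t, b, n⟩
    cases t <;> simp [Raw.eval, POL.restrict] <;> try omega
    have h4 := length_lt_sz (R.mats.getD n [])
    have h5 : sz (R.mats.getD n []) ≤ sz R.mats := by
      by_cases h : n < R.mats.length
      · rw [List.getD_eq_getElem _ _ h]
        exact sz_le_of_mem (List.getElem_mem h)
      · rw [List.getD_eq_default _ _ (by omega)]
        exact sz_pos _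
    simp at h4 h5
    omega

/-- The recursion passes the states down as a parameter. It changes only to the right of a box,
where all states read the word, and this preserves its size, as `termRec` demands. Truth values have
size 1, so the bound on lengths gives one on sizes. -/
theorem eval : Poly fun z : (Raw × List State) × Term => z.1.1.eval z.1.2 z.2 := by
  have hsteps : Poly fun z : (Raw × List State) × Term => z.1.2.map fun s => s.steps z.2.word :=
    map (by fun_prop) (by fun_prop)
  refine termRec (f := fun (c : Raw × List State) t => c.1.eval c.2 t) (base := fun _ => [])
    (g := fun (c : Raw × List State) a x y rx ry => match a.1 with
      | .top => c.2.map fun _ => true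
      | .prop => c.1.infos.map fun w => w.1.any fun p => decide (p = a.2.2)
      | .neg => rx.map fun b => !b
      | .and => rx.zipWith (fun b b' => b && b') ry
      | .know => (c.1.mats.getD a.2.2 []).map fun r =>
          (r.zipWith (fun e b => !e || b) (POL.restrict c.2 rx)).all fun b => b
      | .box => POL.restrict (c.2.map fun s => s.steps x.word) ry
      | _ => [])
    (dl := fun c _ _ _ => c)
    (dr := fun (c : Raw × List State) a x _ => (c.1, match a.1 with
      | .box => c.2.map fun s => s.steps x.word
      | _ => c.2))
    (fun c => rfl) (fun c a x y => ?_) (.const []) (by fun_prop) ?_ ?_ (by simp) ?_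
    (2 * Polynomial.X + 1) fun c t => ?_
  · rcases a with ⟨t, b, n⟩
    cases t <;> rfl
  · refine Poly.pair (by fun_prop) (switch
      (c := fun z : (Raw × List State) × (Token × Bool × ℕ) × Term × Term => z.2.1.1)
      (f := fun t (z : (Raw × List State) × (Token × Bool × ℕ) × Term × Term) => match t with
        | .box => z.1.2.map fun s : State => s.steps z.2.2.1.word
        | _ => z.1.2) (by fun_prop) fun t => ?_)
    have := hsteps.comp (f := fun z : (Raw × List State) × (Token × Bool × ℕ) × Term × Term =>
      (z.1, z.2.2.1)) (by fun_prop)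
    cases t <;> fun_prop
  · refine switch (c := fun z : (Raw × List State) × (Token × Bool × ℕ) × Term × Term ×
      List Bool × List Bool => z.2.1.1)
      (f := fun t (z : (Raw × List State) × (Token × Bool × ℕ) × Term × Term ×
        List Bool × List Bool) => match t with
      | .top => z.1.2.map fun _ => true
      | .prop => z.1.1.infos.map fun w : List ℕ × Term => w.1.any fun p => decide (p = z.2.1.2.2)
      | .neg => z.2.2.2.2.1.map fun b => !b
      | .and => z.2.2.2.2.1.zipWith (fun b b' => b && b') z.2.2.2.2.2
      | .know => (z.1.1.mats.getD z.2.1.2.2 []).map fun r : List Bool =>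
          (r.zipWith (fun e b => !e || b) (POL.restrict z.1.2 z.2.2.2.2.1)).all fun b => b
      | .box => POL.restrict (z.1.2.map fun s : State => s.steps z.2.2.1.word) z.2.2.2.2.2
      | _ => []) (by fun_prop) fun t => ?_
    cases t with
    | top => exact map (by fun_prop) (.const true)
    | prop => exact map (by fun_prop) (any (by fun_prop) (by fun_prop))
    | neg => exact map (by fun_prop) (by fun_prop)
    | and => exact zipWith (by fun_prop) (by fun_prop) (by fun_prop) 1 (by simp)
    | know =>
      exact map (getD (by fun_prop) (by fun_prop) (.const [])) (all (zipWith (by fun_prop)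
        (restrict (by fun_prop) (by fun_prop)) (by fun_prop) 1 (by simp)) (by fun_prop))
    | box => exact restrict (map (by fun_prop) (by fun_prop)) (by fun_prop)
    | _ => exact .const []
  · rintro ⟨R, c⟩ ⟨t, b, n⟩ x y
    have : sz (c.map fun s => s.steps x.word) = sz c := by
      induction c with
      | nil => rfl
      | cons s c ih => rw [List.map_cons, sz_cons, sz_cons, ih, sz_steps]
    cases t <;> simp [-sz_steps, this]
  · have h1 := c.1.length_eval_le c.2 t
    have h2 := sz_list_le (l := c.1.eval c.2 t) (B := 1) (by simp)
    simp
    omega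

theorem check : Poly POL.check := by
  have h1 : Poly fun x : List Token => POL.assemble (POL.parse x) := assemble.comp parse
  have h2 := encode.comp h1
  have h3 := valid.comp h1
  have h4 : Poly fun x : List Token => (POL.assemble (POL.parse x)).eval
      ((POL.assemble (POL.parse x)).infos.map fun w => (true, w.2))
      (POL.assemble (POL.parse x)).formula :=
    eval.comp (f := fun x : List Token => ((POL.assemble (POL.parse x),
      (POL.assemble (POL.parse x)).infos.map fun w => (true, w.2)),
      (POL.assemble (POL.parse x)).formula))
      ((h1.pair (map h1.infos (by fun_prop))).pair h1.formula)
  have h5 : Poly fun x : Token × Token => decide (x.1 = x.2) :=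
    switch (f := fun t (x : Token × Token) => decide (t = x.2)) (by fun_prop)
      fun t => (token_bool (f := fun s => decide (t = s))).comp (by fun_prop)
  exact Poly.and (list_beq h2 .id h5) (Poly.and h3 (getD h4 h1.point (.const false)))

end Poly
end POL

namespace POL
open Turing Function Code

/-! ### The languages of marked expressions -/

theorem cons_mem_mul {A : Type} {L M : Language A} {a : A} {v : List A} :
    a :: v ∈ L * M ↔ (∃ x, a :: x ∈ L ∧ ∃ y ∈ M, x ++ y = v) ∨ [] ∈ L ∧ a :: v ∈ M := by
  rw [Language.mem_mul]
  constructor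
  · rintro ⟨_ | ⟨b, x⟩, hx, y, hy, h⟩
    · simp only [List.nil_append] at h
      exact Or.inr ⟨hx, h ▸ hy⟩
    · simp only [List.cons_append, List.cons.injEq] at h
      obtain ⟨rfl, rfl⟩ := h
      exact Or.inl ⟨x, hx, y, hy, rfl⟩
  · rintro (⟨x, hx, y, hy, rfl⟩ | ⟨hx, hy⟩)
    · exact ⟨_, hx, y, hy, rfl⟩
    · exact ⟨_, hx, _, hy, rfl⟩

open scoped Computability in
-- Empty factors can be dropped from a decomposition, after which the first letter belongs to the
-- first factor.
theorem cons_mem_kstar {A : Type} {L : Language A} {a : A} {v : List A} :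
    a :: v ∈ L∗ ↔ ∃ x, a :: x ∈ L ∧ ∃ y ∈ L∗, x ++ y = v := by
  constructor
  · intro h
    obtain ⟨K, hK, hmem⟩ := Language.mem_kstar_iff_exists_nonempty.1 h
    rcases K with _ | ⟨_ | ⟨b, z⟩, K⟩
    · simp at hK
    · exact absurd rfl (hmem [] (by simp)).2
    · simp only [List.flatten_cons, List.cons_append, List.cons.injEq] at hK
      obtain ⟨rfl, rfl⟩ := hK
      exact ⟨z, (hmem _ (by simp)).1, _,
        Language.mem_kstar.2 ⟨K, rfl, fun y hy => (hmem y (by simp [hy])).1⟩, rfl⟩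
  · rintro ⟨x, hx, y, hy, rfl⟩
    rw [← Language.one_add_self_mul_kstar_eq_kstar]
    exact Or.inr (Language.mem_mul.2 ⟨_, hx, y, hy, rfl⟩)

theorem nil_mem_mul {A : Type} {L M : Language A} : [] ∈ L * M ↔ [] ∈ L ∧ [] ∈ M := by
  simp [Language.mem_mul]

theorem mem_language_map {A B : Type} {f : A → B} {L : Language A} {v : List B} :
    v ∈ Language.map f L ↔ ∃ u ∈ L, u.map f = v := Iff.rfl

theorem exists_mem_mul {A : Type} {L M : Language A} :
    (∃ v, v ∈ L * M) ↔ (∃ v, v ∈ L) ∧ ∃ v, v ∈ M := by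
  simp only [Language.mem_mul]
  constructor
  · rintro ⟨_, x, hx, y, hy, rfl⟩
    exact ⟨⟨x, hx⟩, y, hy⟩
  · rintro ⟨⟨x, hx⟩, y, hy⟩
    exact ⟨_, x, hx, y, hy, rfl⟩

theorem exists_mem_add {A : Type} {L M : Language A} :
    (∃ v, v ∈ L + M) ↔ (∃ v, v ∈ L) ∨ ∃ v, v ∈ M := by
  simp only [Language.mem_add, exists_or]

namespace Term
open scoped Computability

/-- The language of an expression. -/
def lang : Term → Language ℕ
  | nil => 0
  | node a x y => match a.1 with
    | .epsilon => 1
    | .char => {[a.2.2]}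
    | .plus => x.lang + y.lang
    | .comp => x.lang * y.lang
    | .star => x.lang∗
    | _ => 0

/-- The words that can be read from the marked positions of an expression. -/
def resid : Term → Language ℕ
  | nil => 0
  | node a x y => match a.1 with
    | .char => if a.2.1 then 1 else 0
    | .plus => x.resid + y.resid
    | .comp => x.resid * y.lang + y.resid
    | .star => x.resid * x.lang∗
    | _ => 0

theorem nullable_iff (t : Term) : t.nullable = true ↔ [] ∈ t.lang := by
  induction t with
  | nil => simp [nullable, lang]
  | node a x y hx hy =>
    rcases a with ⟨t, b, n⟩
    cases t <;> simp only [nullable, lang, hx, hy, nil_mem_mul, Language.mem_add, Language.mem_one,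
      Language.nil_mem_kstar, Bool.and_eq_true, Bool.or_eq_true] <;> try simp
    exact fun h => by cases h

theorem nonempty_iff (t : Term) : t.nonempty = true ↔ ∃ v, v ∈ t.lang := by
  induction t with
  | nil => simp [nonempty, lang]
  | node a x y hx hy =>
    rcases a with ⟨t, b, n⟩
    cases t <;> simp only [nonempty, lang, hx, hy, exists_mem_mul, exists_mem_add, Bool.and_eq_true,
      Bool.or_eq_true, true_iff] <;> try simp
    · exact ⟨[n], rfl⟩
    · exact ⟨[], Language.nil_mem_kstar _⟩

theorem final_iff (t : Term) : t.final = true ↔ [] ∈ t.resid := by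
  induction t with
  | nil => simp [final, resid]
  | node a x y hx hy =>
    rcases a with ⟨t, b, n⟩
    cases t <;> simp only [final, resid, hx, hy, nil_mem_mul, Language.mem_add, nullable_iff,
      Language.nil_mem_kstar, Bool.and_eq_true, Bool.or_eq_true] <;> try simp
    cases b <;> simp [Language.mem_one]

theorem alive_iff (t : Term) : t.alive = true ↔ ∃ v, v ∈ t.resid := by
  induction t with
  | nil => simp [alive, resid]
  | node a x y hx hy =>
    rcases a with ⟨t, b, n⟩
    cases t <;> simp only [alive, resid, hx, hy, exists_mem_mul, exists_mem_add, Bool.and_eq_true,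
      Bool.or_eq_true, nonempty_iff] <;> try simp
    · cases b <;> simp [Language.mem_one]
    · exact fun _ _ => ⟨[], Language.nil_mem_kstar _⟩

theorem lang_shift (c : Bool × ℕ) (t : Term) : (t.shift c).lang = t.lang := by
  induction t generalizing c with
  | nil => rfl
  | node a x y hx hy =>
    rcases a with ⟨t, b, n⟩
    cases t <;> simp [lang, shift, hx, hy]

/-- The flags handed down by `shift` mark the subexpressions in which the next letter may begin. In
a concatenation it falls into the left factor, or into the right one if the left can be exhausted,
either from its marks (`final`) or from a marked beginning by the empty word (`nullable`). In a
star, the body may start afresh when the whole expression starts or when a round can end. -/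
theorem mem_resid_shift (c : Bool × ℕ) (t : Term) (v : List ℕ) :
    v ∈ (t.shift c).resid ↔ c.2 :: v ∈ t.resid ∨ c.1 = true ∧ c.2 :: v ∈ t.lang := by
  induction t generalizing c v with
  | nil => simp [shift, resid, lang]
  | node a x y hx hy =>
    rcases a with ⟨t, b, n⟩
    rcases c with ⟨m, a⟩
    cases t
    case char =>
      have h : a :: v ∈ ({[n]} : Language ℕ) ↔ n = a ∧ v = [] := by
        change a :: v = [n] ↔ _
        simp [eq_comm]
      simp only [shift, resid, lang, h]
      cases m <;> cases b <;> by_cases h : n = a <;> simp [h, Language.mem_one]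
    case plus =>
      simp only [shift, resid, lang, Language.mem_add, hx, hy]
      tauto
    case comp =>
      simp only [shift, resid, lang, Language.mem_add, hy, cons_mem_mul, lang_shift,
        Bool.or_eq_true, Bool.and_eq_true, nullable_iff, final_iff]
      simp only [Language.mem_mul]
      grind
    case star =>
      simp only [shift, resid, lang, cons_mem_mul, cons_mem_kstar, lang_shift]
      simp only [Language.mem_mul, hx, Bool.or_eq_true, final_iff]
      grind
    all_goals simp [shift, resid, lang, Language.mem_one]

end Term

namespace State

/-- The words that can be read from a state. -/
def lang (s : State) : Language ℕ := {v | v ∈ s.2.resid ∨ s.1 = true ∧ v ∈ s.2.lang}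

theorem mem_lang {s : State} {v : List ℕ} :
    v ∈ s.lang ↔ v ∈ s.2.resid ∨ s.1 = true ∧ v ∈ s.2.lang := Iff.rfl

/-- States follow the same law as residues (`mem_residue`), and this is all that is used of them. -/
theorem mem_lang_steps (s : State) (w v : List ℕ) : v ∈ (s.steps w).lang ↔ w ++ v ∈ s.lang := by
  induction w generalizing s with
  | nil => rfl
  | cons a w ih =>
    refine (ih (s.step a)).trans ?_
    simp [mem_lang, step, Term.mem_resid_shift]

theorem alive_iff (s : State) : s.alive = true ↔ ∃ v, v ∈ s.lang := by
  simp only [alive, mem_lang, Bool.or_eq_true, Bool.and_eq_true, Term.nonempty_iff, Term.alive_iff,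
    exists_or, exists_and_left]
  exact or_comm

end State

/-! ### Terms of expressions and formulas -/

/-- The term of an expression. -/
def exprTerm {k : ℕ} : RegularExpression (Fin k) → Term
  | .zero => .node (.zero, false, 0) .nil .nil
  | .epsilon => .node (.epsilon, false, 0) .nil .nil
  | .char a => .node (.char, false, a) .nil .nil
  | .plus π ρ => .node (.plus, false, 0) (exprTerm π) (exprTerm ρ)
  | .comp π ρ => .node (.comp, false, 0) (exprTerm π) (exprTerm ρ)
  | .star π => .node (.star, false, 0) (exprTerm π) .nil

/-- The term of a formula. -/
def formulaTerm {m k : ℕ} : Formula (Fin m) ℕ (Fin k) → Term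
  | .top => .node (.top, false, 0) .nil .nil
  | .prop p => .node (.prop, false, p) .nil .nil
  | .neg φ => .node (.neg, false, 0) (formulaTerm φ) .nil
  | .and φ ψ => .node (.and, false, 0) (formulaTerm φ) (formulaTerm ψ)
  | .know i φ => .node (.know, false, i) (formulaTerm φ) .nil
  | .box π φ => .node (.box, false, 0) (exprTerm π) (formulaTerm φ)

/-- Renaming letters is a homomorphism of semirings of languages that commutes with the star. -/
theorem lang_exprTerm {k : ℕ} (π : RegularExpression (Fin k)) :
    (exprTerm π).lang = Language.map Fin.val π.matches' := by
  induction π with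
  | zero => exact (map_zero _).symm
  | epsilon => exact (map_one _).symm
  | char a => exact (Set.image_singleton (f := List.map Fin.val) (a := [a])).symm
  | plus π ρ h h' =>
    simp only [exprTerm, Term.lang, h, h']
    exact (map_add (Language.map Fin.val) _ _).symm
  | comp π ρ h h' =>
    simp only [exprTerm, Term.lang, h, h']
    exact (map_mul (Language.map Fin.val) _ _).symm
  | star π h =>
    simp only [exprTerm, Term.lang, h]
    exact (Language.map_kstar _ _).symm

theorem resid_exprTerm {k : ℕ} (π : RegularExpression (Fin k)) : (exprTerm π).resid = 0 := by
  induction π <;> simp_all [exprTerm, Term.resid]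

theorem mem_lang_exprTerm {k : ℕ} (π : RegularExpression (Fin k)) (v : List ℕ) :
    v ∈ State.lang (true, exprTerm π) ↔ v ∈ Language.map Fin.val π.matches' := by
  simp [State.mem_lang, resid_exprTerm, lang_exprTerm]

theorem nonempty_exprTerm {k : ℕ} (π : RegularExpression (Fin k)) :
    (exprTerm π).nonempty = true ↔ ∃ v, v ∈ π.matches' := by
  rw [Term.nonempty_iff, lang_exprTerm]
  exact Set.image_nonempty

/-- A word expression has exactly one word. -/
theorem IsWordExpr.matches_eq {k : ℕ} {π : RegularExpression (Fin k)} (h : IsWordExpr π) :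
    ∃ w : List (Fin k), (exprTerm π).word = w.map Fin.val ∧ ∀ v, v ∈ π.matches' ↔ v = w := by
  induction h with
  | char a => exact ⟨[a], rfl, fun v => Iff.rfl⟩
  | epsilon => exact ⟨[], rfl, fun v => Iff.rfl⟩
  | comp _ _ h h' =>
    obtain ⟨w, hw, h⟩ := h
    obtain ⟨w', hw', h'⟩ := h'
    refine ⟨w ++ w', by simp [exprTerm, Term.word, hw, hw'], fun v => ?_⟩
    simp [RegularExpression.matches', Language.mem_mul, h, h', eq_comm]

theorem Term.eq_nil {t : Term} (h : t.isNil = true) : t = .nil := by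
  cases t
  · rfl
  · cases h

theorem isExpr_exprTerm {k : ℕ} (π : RegularExpression (Fin k)) :
    (exprTerm π).isExpr k = true := by
  induction π <;> simp_all [exprTerm, Term.isExpr, Term.isNil]

/-- The checks that marks are absent and unused numbers are 0 make the term literally equal to that
of an expression, so nothing is lost when an instance is rebuilt. -/
theorem Term.exists_expr {k : ℕ} {t : Term} (h : t.isExpr k = true) :
    ∃ π : RegularExpression (Fin k), exprTerm π = t := by
  induction t with
  | nil => cases h
  | node a x y hx hy =>
    rcases a with ⟨t, b, n⟩
    cases t <;> simp [isExpr] at h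
    · obtain ⟨rfl, rfl, h, h'⟩ := h
      exact ⟨.zero, by rw [eq_nil h, eq_nil h']; rfl⟩
    · obtain ⟨rfl, rfl, h, h'⟩ := h
      exact ⟨.epsilon, by rw [eq_nil h, eq_nil h']; rfl⟩
    · obtain ⟨rfl, hn, h, h'⟩ := h
      exact ⟨.char ⟨n, hn⟩, by rw [eq_nil h, eq_nil h']; rfl⟩
    · obtain ⟨rfl, rfl, h, h'⟩ := h
      obtain ⟨π, rfl⟩ := hx h
      obtain ⟨ρ, rfl⟩ := hy h'
      exact ⟨.plus π ρ, rfl⟩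
    · obtain ⟨rfl, rfl, h, h'⟩ := h
      obtain ⟨π, rfl⟩ := hx h
      obtain ⟨ρ, rfl⟩ := hy h'
      exact ⟨.comp π ρ, rfl⟩
    · obtain ⟨rfl, rfl, h, h'⟩ := h
      obtain ⟨π, rfl⟩ := hx h
      exact ⟨.star π, by rw [eq_nil h']; rfl⟩

theorem IsWordExpr.isWord {k : ℕ} {π : RegularExpression (Fin k)} (h : IsWordExpr π) :
    (exprTerm π).isWord k = true := by
  induction h <;> simp_all [exprTerm, Term.isWord, Term.isNil]

theorem Term.exists_wordExpr {k : ℕ} {t : Term} (h : t.isWord k = true) :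
    ∃ π : RegularExpression (Fin k), IsWordExpr π ∧ exprTerm π = t := by
  induction t with
  | nil => cases h
  | node a x y hx hy =>
    rcases a with ⟨t, b, n⟩
    cases t <;> simp [isWord] at h
    · obtain ⟨rfl, rfl, h, h'⟩ := h
      exact ⟨.epsilon, .epsilon, by rw [eq_nil h, eq_nil h']; rfl⟩
    · obtain ⟨rfl, hn, h, h'⟩ := h
      exact ⟨.char ⟨n, hn⟩, .char _, by rw [eq_nil h, eq_nil h']; rfl⟩
    · obtain ⟨rfl, rfl, h, h'⟩ := h
      obtain ⟨π, hπ, rfl⟩ := hx h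
      obtain ⟨ρ, hρ, rfl⟩ := hy h'
      exact ⟨.comp π ρ, .comp hπ hρ, rfl⟩

theorem Formula.IsWord.isForm {m k : ℕ} {φ : Formula (Fin m) ℕ (Fin k)} (h : φ.IsWord) :
    (formulaTerm φ).isForm m k = true := by
  induction φ <;> simp_all [formulaTerm, Term.isForm, Term.isNil, Formula.IsWord, IsWordExpr.isWord]

theorem Term.exists_formula {m k : ℕ} {t : Term} (h : t.isForm m k = true) :
    ∃ φ : Formula (Fin m) ℕ (Fin k), φ.IsWord ∧ formulaTerm φ = t := by
  induction t with
  | nil => cases h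
  | node a x y hx hy =>
    rcases a with ⟨t, b, n⟩
    cases t <;> simp [isForm] at h
    · obtain ⟨rfl, rfl, h, h'⟩ := h
      exact ⟨.top, trivial, by rw [eq_nil h, eq_nil h']; rfl⟩
    · obtain ⟨rfl, h, h'⟩ := h
      exact ⟨.prop n, trivial, by rw [eq_nil h, eq_nil h']; rfl⟩
    · obtain ⟨rfl, rfl, h, h'⟩ := h
      obtain ⟨φ, hφ, rfl⟩ := hx h
      exact ⟨.neg φ, hφ, by rw [eq_nil h']; rfl⟩
    · obtain ⟨rfl, rfl, h, h'⟩ := h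
      obtain ⟨φ, hφ, rfl⟩ := hx h
      obtain ⟨ψ, hψ, rfl⟩ := hy h'
      exact ⟨.and φ ψ, ⟨hφ, hψ⟩, rfl⟩
    · obtain ⟨rfl, hn, h, h'⟩ := h
      obtain ⟨φ, hφ, rfl⟩ := hx h
      exact ⟨.know ⟨n, hn⟩ φ, hφ, by rw [eq_nil h']; rfl⟩
    · obtain ⟨rfl, rfl, h, h'⟩ := h
      obtain ⟨π, hπ, rfl⟩ := exists_wordExpr h
      obtain ⟨φ, hφ, rfl⟩ := hy h'
      exact ⟨.box π φ, ⟨hπ, hφ⟩, rfl⟩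

/-! ### The truth values are correct -/

/-- The components of an instance. -/
def Instance.raw (X : Instance) : Raw where
  agents := X.numAgents
  actions := X.numActions
  worlds := X.numWorlds
  mats := (List.finRange X.numAgents).map fun i => (List.finRange X.numWorlds).map fun s =>
    (List.finRange X.numWorlds).map fun t => X.rel i s t
  infos := (List.finRange X.numWorlds).map fun s => (X.val s, exprTerm (X.exp s))
  point := X.point
  formula := formulaTerm X.formula

theorem zipWith_map_map {α β γ δ : Type} (f : β → γ → δ) (g : α → β) (h : α → γ) (l : List α) :
    (l.map g).zipWith f (l.map h) = l.map fun a => f (g a) (h a) := by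
  induction l with
  | nil => rfl
  | cons a l ih => simp [ih]

theorem restrict_map {n : ℕ} (c : Fin n → State) (r : Fin n → Bool) :
    restrict ((List.finRange n).map c) ((List.finRange n).map r) =
      (List.finRange n).map fun j => !(c j).alive || r j :=
  zipWith_map_map _ _ _ _

theorem getD_map_finRange {α : Type} {n : ℕ} (f : Fin n → α) (i : Fin n) (d : α) :
    ((List.finRange n).map f).getD i d = f i := by
  simp [List.getD]

/-- `M` stands for the model after some updates, and `e` sends its worlds to the original ones, over
which states and truth values are always indexed. The invariant is that states at worlds of `M` have
the current expectation as their language and that only worlds of `M` have live states. Values at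
dead indices are arbitrary; both modalities mask them. -/
theorem eval_correct (X : Instance) (φ : Formula (Fin X.numAgents) ℕ (Fin X.numActions))
    (hφ : φ.IsWord) {S : Type} (M : Model (Fin X.numAgents) ℕ (Fin X.numActions) S)
    (e : S → Fin X.numWorlds) (hrel : ∀ i s t, M.rel i s t ↔ X.rel i (e s) (e t) = true)
    (hval : ∀ s p, p ∈ M.val s ↔ p ∈ X.val (e s)) (c : Fin X.numWorlds → State)
    (hlang : ∀ s, (c (e s)).lang = Language.map Fin.val (M.exp s).matches')
    (halive : ∀ j, (c j).alive = true → ∃ s, e s = j) :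
    ∃ r : Fin X.numWorlds → Bool, X.raw.eval ((List.finRange _).map c) (formulaTerm φ) =
      (List.finRange _).map r ∧ ∀ s, r (e s) = true ↔ Holds φ M s := by
  have hc : ∀ s, (c (e s)).alive = true := fun s => by
    rw [State.alive_iff, hlang]
    obtain ⟨v, hv⟩ := M.exp_nonempty s
    exact ⟨_, mem_language_map.2 ⟨v, hv, rfl⟩⟩
  induction φ generalizing S c with
  | top => exact ⟨fun _ => true, by simp [formulaTerm, Raw.eval], fun s => by simp [Holds]⟩
  | prop p =>
    refine ⟨fun j => (X.val j).any fun q => decide (q = p),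
      by simp [formulaTerm, Raw.eval, Instance.raw, Function.comp_def], fun s => ?_⟩
    simp [Holds, hval]
  | neg φ ih =>
    obtain ⟨r, hr, h⟩ := ih hφ M e hrel hval c hlang halive hc
    refine ⟨fun j => !r j, by simp [formulaTerm, Raw.eval, hr, Function.comp_def], fun s => ?_⟩
    simp [Holds, ← h]
  | and φ ψ ih ih' =>
    obtain ⟨r, hr, h⟩ := ih hφ.1 M e hrel hval c hlang halive hc
    obtain ⟨r', hr', h'⟩ := ih' hφ.2 M e hrel hval c hlang halive hc
    refine ⟨fun j => r j && r' j,
      by simp only [formulaTerm, Raw.eval, hr, hr', zipWith_map_map], fun s => ?_⟩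
    simp [Holds, ← h, ← h']
  | know i φ ih =>
    obtain ⟨r, hr, h⟩ := ih hφ M e hrel hval c hlang halive hc
    refine ⟨fun j => (List.finRange _).all fun j' => !X.rel i j j' || (!(c j').alive || r j'),
      ?_, fun s => ?_⟩
    · simp only [formulaTerm, Raw.eval, hr, restrict_map]
      simp only [Instance.raw, getD_map_finRange, List.map_map]
      congr 1
      funext j
      simp [Function.comp_def]
    · simp only [Holds, ← h, hrel, List.all_eq_true, List.mem_finRange, true_imp_iff]
      constructor
      · intro H t ht
        simpa [ht, hc] using H (e t)
      · intro H j
        cases h1 : X.rel i (e s) j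
        · rfl
        cases h2 : (c j).alive
        · rfl
        -- A live index comes from a world of `M`, so letting `j` range over all original worlds
        -- tests nothing beyond `M`.
        obtain ⟨t, rfl⟩ := halive j h2
        simpa using H t h1
  | box π φ ih =>
    obtain ⟨w, hw, hπ⟩ := hφ.1.matches_eq
    have hlang' : ∀ s, ((c (e s)).steps (w.map Fin.val)).lang =
        Language.map Fin.val (residue (M.exp s) w).matches' := by
      intro s
      ext v
      rw [State.mem_lang_steps, hlang, mem_language_map, mem_language_map]
      constructor
      · rintro ⟨u, hu, h⟩
        -- The letters of `w` are recovered from their numbers because `Fin.val` is injective.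
        obtain ⟨u1, u2, rfl, h1, rfl⟩ := List.map_eq_append_iff.1 h
        obtain rfl := Fin.val_injective.list_map h1
        exact ⟨u2, (mem_residue _ _ _).2 hu, rfl⟩
      · rintro ⟨u, hu, rfl⟩
        exact ⟨w ++ u, (mem_residue _ _ _).1 hu, by simp⟩
    have hsurv : ∀ s, ((c (e s)).steps (w.map Fin.val)).alive = true ↔
        ∃ v, v ∈ (residue (M.exp s) w).matches' := by
      intro s
      rw [State.alive_iff, hlang']
      exact Set.image_nonempty
    obtain ⟨r, hr, h⟩ := ih hφ.2 (M.update w) (fun s => e s.1) (fun i s t => hrel i s.1 t.1)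
      (fun s => hval s.1) (fun j => (c j).steps (w.map Fin.val)) (fun s => hlang' s.1)
      (fun j hj => by
        -- A continuation after `w` gives one before `w`, so the index was live already and belongs
        -- to a world `s` of `M`; being still live, `s` survives the update.
        have : (c j).alive = true := by
          obtain ⟨v, hv⟩ := (State.alive_iff _).1 hj
          exact (State.alive_iff _).2 ⟨_, (State.mem_lang_steps _ _ _).1 hv⟩
        obtain ⟨s, rfl⟩ := halive j this
        exact ⟨⟨s, (hsurv s).1 hj⟩, rfl⟩)
      (fun s => (hsurv s.1).2 s.2)
    -- Where `w` is not a prefix of an expected observation, the state has died and the box holds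
    -- vacuously.
    refine ⟨fun j => !((c j).steps (w.map Fin.val)).alive || r j, ?_, fun s => ?_⟩
    · simp only [formulaTerm, Raw.eval, hw, List.map_map, Function.comp_def, hr, restrict_map]
    · simp only [Holds, hπ, Bool.or_eq_true, Bool.not_eq_true', forall_eq]
      constructor
      · intro H hs
        rw [← h ⟨s, _⟩]
        refine H.resolve_left ?_
        simpa using (hsurv s).2 ((mem_prefixes_iff _ _).1 hs)
      · intro H
        refine or_iff_not_imp_left.2 fun hs => ?_
        have hs' := (hsurv s).1 (by simpa using hs)
        exact (h ⟨s, hs'⟩).2 (H ((mem_prefixes_iff _ _).2 hs'))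

theorem eval_raw (X : Instance) (h : X.formula.IsWord) :
    (X.raw.eval (X.raw.infos.map fun w => (true, w.2)) X.raw.formula).getD X.raw.point false = true
      ↔ Holds X.formula X.model X.point := by
  obtain ⟨r, hr, h⟩ := eval_correct X X.formula h X.model id (fun _ _ _ => Iff.rfl)
    (fun _ _ => Iff.rfl) (fun j => (true, exprTerm (X.exp j)))
    (fun s => Set.ext fun v => mem_lang_exprTerm _ v) (fun j _ => ⟨j, rfl⟩)
  rw [← h X.point, show (X.raw.infos.map fun w => (true, w.2)) = (List.finRange _).map fun j =>
    (true, exprTerm (X.exp j)) by simp [Instance.raw, Function.comp_def]]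
  change (X.raw.eval _ (formulaTerm X.formula)).getD X.point false = true ↔ _
  rw [hr, getD_map_finRange]
  rfl

end POL

namespace POL
open Turing Function Code

/-! ### Strings of instances are read correctly -/

/-- The terms of the true propositions and of the expectation of a world. -/
def infoTerms (w : List ℕ × Term) : List Term :=
  w.1.map (fun p => .node (.prop, false, p) .nil .nil) ++ [w.2]

theorem unparse_exprTerm {k : ℕ} (π : RegularExpression (Fin k)) :
    (exprTerm π).unparse = encodeExpr π := by
  induction π <;>
    simp_all [exprTerm, Term.unparse, encodeExpr, Token.hasNumber]

theorem unparse_formulaTerm {m k : ℕ} (φ : Formula (Fin m) ℕ (Fin k)) :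
    (formulaTerm φ).unparse = encodeFormula φ := by
  induction φ <;>
    simp_all [formulaTerm, Term.unparse, encodeFormula, Token.hasNumber, unparse_exprTerm]

theorem encode_raw (X : Instance) : X.raw.encode = X.encode := by
  simp [Raw.encode, Instance.raw, Instance.encode, List.flatMap_map, unparse_exprTerm,
    unparse_formulaTerm, List.map_map, Function.comp_def]

theorem read_number (n : ℕ) (st : List Term) :
    (encodeNumber n).foldr readToken st = .node (.fin, false, n) .nil .nil :: st := by
  suffices h : ∀ l : List Bool, (l.map Token.bit ++ [Token.fin]).foldr readToken st =
      .node (.fin, false, Poly.ofBits l) .nil .nil :: st by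
    rw [encodeNumber, h, Poly.ofBits_bits]
  intro l
  induction l with
  | nil => rfl
  | cons b l ih =>
    rw [List.map_cons, List.cons_append, List.foldr_cons, ih]
    rfl

theorem read_expr {k : ℕ} (π : RegularExpression (Fin k)) (st : List Term) :
    (encodeExpr π).foldr readToken st = exprTerm π :: st := by
  induction π generalizing st <;>
    simp_all [encodeExpr, exprTerm, read_number, readToken, top, Term.num]

theorem read_formula {m k : ℕ} (φ : Formula (Fin m) ℕ (Fin k)) (st : List Term) :
    (encodeFormula φ).foldr readToken st = formulaTerm φ :: st := by
  induction φ generalizing st <;>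
    simp_all [encodeFormula, formulaTerm, read_number, read_expr, readToken, top, Term.num]

theorem read_props (l : List ℕ) (st : List Term) :
    (l.flatMap fun p => Token.prop :: encodeNumber p).foldr readToken st =
      l.map (fun p => .node (.prop, false, p) .nil .nil) ++ st := by
  induction l with
  | nil => rfl
  | cons p l ih => simp [List.foldr_append, ih, read_number, readToken, top, Term.num]

/-- A bit belongs to a number exactly when the term to its right is a number. The hypothesis
excludes this for the last matrix entry; every other entry has a matrix entry to its right. -/
theorem read_bits (l : List Bool) {st : List Term} (h : (top st).tok.isFin = false) :
    (l.map Token.bit).foldr readToken st =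
      l.map (fun b => .node (.bit b, false, 0) .nil .nil) ++ st := by
  induction l with
  | nil => rfl
  | cons b l ih =>
    rw [List.map_cons, List.foldr_cons, ih]
    cases l with
    | nil =>
      change (bif (top st).tok.isFin then _ else _) = _
      rw [h]
      rfl
    | cons b' l => rfl

theorem isOperator_exprTerm {k : ℕ} (π : RegularExpression (Fin k)) :
    (exprTerm π).tok.isOperator = true := by
  cases π <;> rfl

theorem Token.isFin_of_isOperator {t : Token} (h : t.isOperator = true) : t.isFin = false := by
  cases t <;> first | rfl | cases h

theorem Token.bits_of_isOperator {t : Token} (h : t.isOperator = true) : t.bits = [] := by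
  cases t <;> first | rfl | cases h

theorem isOperator_formulaTerm {m k : ℕ} (φ : Formula (Fin m) ℕ (Fin k)) :
    (formulaTerm φ).tok.isOperator = false := by
  cases φ <;> rfl

theorem bits_formulaTerm {m k : ℕ} (φ : Formula (Fin m) ℕ (Fin k)) :
    (formulaTerm φ).tok.bits = [] := by
  cases φ <;> rfl

theorem read_infos {k : ℕ} {ι : Type} (val : ι → List ℕ) (exp : ι → RegularExpression (Fin k))
    (l : List ι) (st : List Term) :
    (l.flatMap fun s => ((val s).flatMap fun p => Token.prop :: encodeNumber p) ++
      encodeExpr (exp s)).foldr readToken st =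
      (l.flatMap fun s => infoTerms (val s, exprTerm (exp s))) ++ st := by
  induction l with
  | nil => rfl
  | cons s l ih =>
    simp [List.foldr_append, ih, read_props, read_expr, infoTerms]

theorem parse_encode (X : Instance) : parse X.encode =
    .node (.fin, false, X.numAgents) .nil .nil :: .node (.fin, false, X.numActions) .nil .nil ::
    .node (.fin, false, X.numWorlds) .nil .nil ::
    ((X.raw.mats.flatten.flatten.map fun b => .node (.bit b, false, 0) .nil .nil) ++
    (X.raw.infos.flatMap infoTerms ++
      [.node (.fin, false, X.point) .nil .nil, formulaTerm X.formula])) := by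
  have h1 : ((List.finRange X.numAgents).flatMap fun i => (List.finRange X.numWorlds).flatMap
      fun s => (List.finRange X.numWorlds).map fun t => Token.bit (X.rel i s t)) =
      X.raw.mats.flatten.flatten.map Token.bit := by
    simp [Instance.raw, List.flatMap, Function.comp_def, List.map_flatten, List.flatten_flatten]
  have h2 : X.raw.infos.flatMap infoTerms =
      (List.finRange X.numWorlds).flatMap fun s => infoTerms (X.val s, exprTerm (X.exp s)) := by
    simp [Instance.raw, List.flatMap_map]
  rw [parse, Instance.encode, h1, h2]
  simp only [List.foldr_append, read_number, read_infos, read_formula]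
  rw [read_bits]
  -- The point guarantees at least one world, so the matrices are followed by a proposition or an
  -- expression and not by the number of the point.
  have h3 : List.finRange X.numWorlds ≠ [] := fun h => by
    have := List.mem_finRange X.point
    rw [h] at this
    cases this
  obtain ⟨s, l, h3⟩ := List.exists_cons_of_ne_nil h3
  rw [h3, List.flatMap_cons, infoTerms]
  cases X.val s
  · exact Token.isFin_of_isOperator (isOperator_exprTerm _)
  · rfl

/-- Cutting from the end, a new piece starts exactly when the current one has `n` entries. With `n =
0` pieces would be empty and could not be recovered, hence the positivity. -/
theorem chunk_flatten {β : Type} {n : ℕ} (hn : 0 < n) {L : List (List β)}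
    (hL : ∀ r ∈ L, r.length = n) : chunk n L.flatten = L := by
  induction L with
  | nil => rfl
  | cons r L ih =>
    have ih := ih fun r hr => hL r (by simp [hr])
    rw [List.flatten_cons, chunk, List.foldr_append, ← chunk, ih]
    -- The first entry of a non-empty `r'` opens a new piece, since the head of `L` is full, and the
    -- others join it, since it has fewer than `n` entries.
    suffices h : ∀ r' : List β, r' ≠ [] → r'.length ≤ n → r'.foldr (fun b acc => match acc with
        | [] => [[b]]
        | c :: r => bif decide (c.length = n) then [b] :: c :: r else (b :: c) :: r) L
        = r' :: L by
      have := hL r (by simp)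
      exact h r (by rintro rfl; simp at this; omega) this.le
    intro r'
    induction r' with
    | nil => simp
    | cons b r' ih' =>
      intro _ h
      rcases r' with _ | ⟨b', r'⟩
      · cases L with
        | nil => rfl
        | cons c L => simp [hL c (by simp)]
      · rw [List.foldr_cons, ih' (by simp) (by simp at h ⊢; omega)]
        have : r'.length + 1 ≠ n := by simp at h; omega
        simp [this]

theorem foldr_addInfo_skip {l : List Term} (h : ∀ t ∈ l, t.tok.isOperator = false)
    (h' : ∀ t ∈ l, t.tok.hasNumber = false) (ws : List (List ℕ × Term)) :
    l.foldr addInfo ws = ws := by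
  induction l with
  | nil => rfl
  | cons t l ih =>
    rw [List.foldr_cons, ih (fun t ht => h t (by simp [ht])) fun t ht => h' t (by simp [ht])]
    simp [addInfo, h t, h' t]

theorem foldr_addInfo {l : List (List ℕ × Term)} (h : ∀ w ∈ l, w.2.tok.isOperator = true)
    (ws : List (List ℕ × Term)) : (l.flatMap infoTerms).foldr addInfo ws = l ++ ws := by
  induction l with
  | nil => rfl
  | cons w l ih =>
    rw [List.flatMap_cons, List.foldr_append, ih fun t ht => h t (by simp [ht])]
    obtain ⟨ps, t⟩ := w
    rw [infoTerms, List.foldr_append]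
    have : [t].foldr addInfo (l ++ ws) = ([], t) :: (l ++ ws) := by
      simp [addInfo, h (ps, t)]
    rw [this]
    induction ps with
    | nil => rfl
    | cons p ps ih' =>
      rw [List.map_cons, List.foldr_cons, ih' fun w hw => by
        rcases List.mem_cons.1 hw with rfl | hw
        · exact h (p :: ps, t) (by simp)
        · exact h w (by simp [hw])]
      rfl

theorem assemble_parse (X : Instance) : assemble (parse X.encode) = X.raw := by
  have hn : 0 < X.numWorlds := X.point.pos
  have h1 : (X.raw.mats.flatten.flatten.map fun b => Term.node (.bit b, false, 0) .nil .nil).flatMap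
      (fun t => t.tok.bits) = X.raw.mats.flatten.flatten := by
    induction X.raw.mats.flatten.flatten with
    | nil => rfl
    | cons b l ih =>
      rw [List.map_cons, List.flatMap_cons, ih]
      rfl
  have h2 : (X.raw.infos.flatMap infoTerms).flatMap (fun t => t.tok.bits) = [] := by
    simp only [List.flatMap_eq_nil_iff, List.mem_flatMap, infoTerms, List.mem_append, List.mem_map,
      List.mem_singleton, Instance.raw]
    rintro t ⟨w, ⟨s, -, rfl⟩, ⟨p, -, rfl⟩ | rfl⟩
    · rfl
    · exact Token.bits_of_isOperator (isOperator_exprTerm _)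
  have h3 : chunk X.numWorlds (chunk X.numWorlds X.raw.mats.flatten.flatten) = X.raw.mats := by
    rw [chunk_flatten hn, chunk_flatten hn]
    · simp [Instance.raw]
    · simp only [Instance.raw, List.mem_flatten, List.mem_map]
      rintro r ⟨_, ⟨i, -, rfl⟩, hr⟩
      obtain ⟨s, -, rfl⟩ := List.mem_map.1 hr
      simp
  -- A proposition or a knowledge formula carries a number, as the entries of a valuation do, but no
  -- expectation stands to its right, so `addInfo` discards it.
  have h4 : [formulaTerm X.formula].foldr addInfo [] = [] := by
    simp only [List.foldr_cons, List.foldr_nil, addInfo, isOperator_formulaTerm]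
    cases (formulaTerm X.formula).tok.hasNumber <;> rfl
  rw [parse_encode, assemble]
  simp only [top, Term.num, List.tail_cons, List.flatMap_cons, List.flatMap_append, h1, h2,
    List.flatMap_nil, bits_formulaTerm, List.append_nil]
  have h5 : ∀ (l : List Term) a b c d e, (a :: b :: c :: (l ++ (e ++ [d, formulaTerm X.formula]))).reverse =
      formulaTerm X.formula :: d :: (a :: b :: c :: (l ++ e)).reverse := by simp
  rw [h5]
  simp only [Term.tok, Token.bits, List.nil_append, List.append_nil, h3, List.tail_cons]
  have h6 : (Term.node (.fin, false, X.numAgents) .nil .nil ::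
      .node (.fin, false, X.numActions) .nil .nil :: .node (.fin, false, X.numWorlds) .nil .nil ::
      ((X.raw.mats.flatten.flatten.map fun b => .node (.bit b, false, 0) .nil .nil) ++
      (X.raw.infos.flatMap infoTerms ++
        [.node (.fin, false, X.point) .nil .nil, formulaTerm X.formula]))).foldr addInfo [] =
        X.raw.infos := by
    change addInfo _ (addInfo _ (addInfo _ (List.foldr addInfo [] (_ ++ (_ ++ [_, _]))))) = _
    rw [List.foldr_append, List.foldr_append, List.foldr_cons, h4, foldr_addInfo,
      foldr_addInfo_skip]
    · exact List.append_nil _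
    · intro t ht
      obtain ⟨b, -, rfl⟩ := List.mem_map.1 ht
      rfl
    · intro t ht
      obtain ⟨b, -, rfl⟩ := List.mem_map.1 ht
      rfl
    · simp [Instance.raw, isOperator_exprTerm]
  rw [h6]
  rfl

/-- A relation is an equivalence if and only if two elements are related exactly when their rows
coincide: rows of an equivalence are its classes, and having equal rows is always an equivalence.
This reduces the check to comparisons of lists. -/
theorem isEquivMatrix_iff {n : ℕ} (r : Fin n → Fin n → Bool) :
    isEquivMatrix ((List.finRange n).map fun s => (List.finRange n).map fun t => r s t) = true ↔
      Equivalence fun s t => r s t = true := by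
  have h : isEquivMatrix ((List.finRange n).map fun s => (List.finRange n).map fun t => r s t) = true
      ↔ ∀ s t, r s t = true ↔ r t = r s := by
    have h' : ∀ s t : Fin n, (List.finRange n).map (r s) = (List.finRange n).map (r t) ↔ r s = r t :=
      fun s t => by simp [List.map_inj_left, funext_iff]
    simp only [isEquivMatrix, List.all_map, List.all_eq_true, List.mem_finRange, true_imp_iff,
      Function.comp_apply, decide_eq_true_eq, List.map_map, List.map_inj_left]
    simp only [Bool.eq_iff_iff (b := decide _), decide_eq_true_eq,
      funext_iff]
  rw [h]
  constructor
  · intro H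
    exact ⟨fun s => (H s s).2 rfl, fun h => (H _ _).2 ((H _ _).1 h).symm,
      fun h h' => (H _ _).2 (((H _ _).1 h').trans ((H _ _).1 h))⟩
  · intro H s t
    refine ⟨fun h => funext fun u => Bool.eq_iff_iff.2 ⟨H.trans h, H.trans (H.symm h)⟩, fun h => ?_⟩
    rw [← h]
    exact H.refl t

theorem eq_map_finRange {α : Type} {n : ℕ} {l : List α} (h : l.length = n) (d : α) :
    l = (List.finRange n).map fun i : Fin n => l.getD i d := by
  subst h
  refine List.ext_getElem (by simp) fun i h1 h2 => ?_
  simp [List.getD]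

theorem valid_raw (X : Instance) (h : X.formula.IsWord) : X.raw.valid = true := by
  simp [Raw.valid, Instance.raw, isEquivMatrix_iff, X.rel_equiv, isExpr_exprTerm,
    nonempty_exprTerm, X.exp_nonempty, h.isForm]

/-- The checks cover every field of `Instance`, including the properties that relations are
equivalences and that expectations are not empty. -/
theorem Raw.exists_instance {R : Raw} (h : R.valid = true) :
    ∃ X : Instance, X.formula.IsWord ∧ X.raw = R := by
  obtain ⟨m, k, n, mats, infos, pt, f⟩ := R
  simp only [valid, Bool.and_eq_true, decide_eq_true_eq, List.all_eq_true] at h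
  obtain ⟨h1, h2, h3, h4, h5, h6⟩ := h
  obtain ⟨φ, hφ, rfl⟩ := Term.exists_formula h6
  have hinfos := eq_map_finRange h1 ([], Term.nil)
  generalize hI : (fun i : Fin n => infos.getD i ([], Term.nil)) = I at hinfos
  subst hinfos
  have h7 : ∀ s, ∃ π : RegularExpression (Fin k), exprTerm π = (I s).2 := fun s =>
    Term.exists_expr (h4 (I s) (List.mem_map.2 ⟨s, List.mem_finRange _, rfl⟩)).1
  choose E hE using h7
  have hmats := eq_map_finRange h2 []
  generalize (fun i : Fin m => mats.getD i []) = Ms at hmats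
  subst hmats
  have h8 : ∀ i, ∃ r : Fin n → Fin n → Bool,
      Ms i = (List.finRange n).map fun s => (List.finRange n).map fun t => r s t := fun i => by
    obtain ⟨h, h'⟩ := h3 (Ms i) (List.mem_map.2 ⟨i, List.mem_finRange _, rfl⟩)
    have hr := eq_map_finRange h []
    refine ⟨fun s t => ((Ms i).getD s []).getD t false, hr.trans ?_⟩
    refine List.map_congr_left fun s _ => eq_map_finRange ?_ _
    have hs : (Ms i).getD s [] ∈ Ms i := by
      rw [hr]
      simp
    rw [isEquivMatrix, List.all_eq_true] at h'
    -- The length of a row is not checked separately: the row equals a list indexed by the rows of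
    -- the matrix.
    rw [of_decide_eq_true (h' _ hs)]
    simpa using h
  choose r hr using h8
  refine ⟨⟨m, k, n, r, fun i => ?_, fun s => (I s).1, E, fun s => ?_, ⟨pt, h5⟩, φ⟩, hφ, ?_⟩
  · rw [← isEquivMatrix_iff, ← hr]
    exact (h3 (Ms i) (List.mem_map.2 ⟨i, List.mem_finRange _, rfl⟩)).2
  · rw [← nonempty_exprTerm, hE]
    exact (h4 (I s) (List.mem_map.2 ⟨s, List.mem_finRange _, rfl⟩)).2
  · simp [Instance.raw, hE, ← hr]

/-- Soundness does not require any understanding of how the parser treats malformed strings: the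
comparison with the re-encoding forces `x` to be the string of the rebuilt instance. Completeness
needs reading to invert encoding, which is `assemble_parse`. -/
theorem check_iff (x : List Token) : check x = true ↔ x ∈ wordModelChecking := by
  simp only [check, Bool.and_eq_true, decide_eq_true_eq]
  constructor
  · rintro ⟨h1, h2, h3⟩
    obtain ⟨X, hX, h⟩ := Raw.exists_instance h2
    rw [← h] at h1 h3
    exact ⟨X, hX, (eval_raw X hX).1 h3, by rw [← encode_raw, h1]⟩
  · rintro ⟨X, hX, h, rfl⟩
    rw [assemble_parse]
    exact ⟨encode_raw X, valid_raw X hX, (eval_raw X hX).2 h⟩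

end POL

namespace POL
open Turing Function Code

/-! ### The Turing machine -/

noncomputable instance : Fintype Token := ⟨Token.all.toFinset, fun t => by simp [Token.mem_all]⟩

instance : Fintype Stack :=
  ⟨{.input, .output, .main, .count, .aux false, .aux true}, by
    rintro (_ | _ | _ | _ | _ | _) <;> simp⟩

/-- The stacks with a string on the input stack and symbols on the first auxiliary stack. -/
def withInput (x : List Token) (a : List (Option Token)) : Mem
  | .input => x
  | .aux false => a
  | _ => []

/-- The stacks with a truth value on the output stack. -/
def withOutput (b : Bool) : Mem
  | .output => [b]
  | _ => []

namespace Prog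

/-- Move the input to the first auxiliary stack. -/
def takeInput : Prog :=
  .seq (pop .input fun o => o.map some)
    (loop Option.isSome (.seq (push (.aux false) regSymbol) (pop .input fun o => o.map some)))

/-- Move the input to the main stack, as a list of tokens. -/
def readInput : Prog :=
  .seq takeInput (.seq (pushMain (some .fin)) (drain false (.seq (push .main regSymbol)
    (pushMain none))))

/-- Move a truth value from the main stack to the output. -/
def writeOutput : Prog := .seq (pop .main id) (push .output Reg.isTrue)

end Prog

open Prog

theorem takeInput_exec (x : List Token) :
    Exec takeInput (withInput x []) (mem [] [] (x.map some).reverse []) (3 * x.length + 2) := by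
  have hpop : ∀ v (x : List Token) a, Run (pop .input fun o => o.map some) v (withInput x a)
      (x.head?.map some) (withInput x.tail a) 1 := by
    intro v x a
    have h : withInput x.tail a = update (withInput x a) .input x.tail := by
      funext k
      rcases k with _ | _ | _ | _ | _ | _ <;> rfl
    rw [h]
    exact Run.pop (k := .input) (f := fun o => o.map some)
  have hpush : ∀ t (x : List Token) a, Run (push (.aux false) regSymbol) (some (some t))
      (withInput x a) (some (some t)) (withInput x (some t :: a)) 1 := by
    intro t x a
    have h : withInput x (some t :: a) = update (withInput x a) (.aux false) (some t :: a) := by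
      funext k
      rcases k with _ | _ | _ | _ | _ | _ <;> rfl
    rw [h]
    exact Run.push (k := .aux false) (f := regSymbol)
  suffices h : ∀ (x : List Token) a, ∃ v', Run (loop Option.isSome (.seq (push (.aux false) regSymbol)
      (pop .input fun o => o.map some))) (x.head?.map some) (withInput x.tail a) v'
      (mem [] [] ((x.map some).reverse ++ a) []) (3 * x.length + 1) by
    intro v
    obtain ⟨v', h⟩ := h x []
    rw [List.append_nil] at h
    exact ⟨v', _, le_of_eq (by ring), (hpop v x []).seq h⟩
  intro x
  induction x with
  | nil =>
    intro a
    have : withInput [] a = mem [] [] a [] := by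
      funext k
      rcases k with _ | _ | _ | _ | _ | _ <;> rfl
    exact ⟨none, this ▸ Run.loopDone rfl⟩
  | cons t x ih =>
    intro a
    obtain ⟨v', h⟩ := ih (some t :: a)
    refine ⟨v', ?_⟩
    have := Run.loopStep (c := Option.isSome) rfl ((hpush t x a).seq (hpop _ x (some t :: a))) h
    rw [List.map_cons, List.reverse_cons, List.append_assoc, List.length_cons]
    exact (by ring : 1 + (1 + 1) + (3 * x.length + 1) = 3 * (x.length + 1) + 1) ▸ this

theorem ser_tokens (x : List Token) :
    (enc x : Tree).ser = (x.map some).flatMap (fun s => [none, s]) ++ [some .fin] := by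
  induction x with
  | nil => rfl
  | cons t x ih =>
    change none :: ([some t] ++ (enc x : Tree).ser) = _
    rw [ih]
    rfl

theorem sz_tokens (x : List Token) : sz x = 2 * x.length + 1 := by
  induction x with
  | nil => rfl
  | cons t x ih =>
    rw [sz_cons, ih, sz_token, List.length_cons]
    ring

/-- The list is built from its end: first its `fin` leaf, then for each token the leaf and the node
symbol above it. The detour over the auxiliary stack supplies the tokens in reverse. -/
theorem readInput_exec (x : List Token) :
    Exec readInput (withInput x []) (onMain (enc x : Tree).ser) (7 * x.length + 5) := by
  have h1 : Exec (pushMain (some .fin)) (mem [] [] (x.map some).reverse [])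
      (mem [some .fin] [] (x.map some).reverse []) 1 := fun v => by
    have := Run.push (k := .main) (f := fun _ => some .fin) (v := v)
      (S := mem [] [] (x.map some).reverse [])
    rw [update_main] at this
    exact ⟨v, 1, le_rfl, this⟩
  have h2 := drain_exec (b := false) (p := .seq (push .main regSymbol) (pushMain none)) (k := 2)
    (fun a d => mem (d.flatMap (fun s => [none, s]) ++ [some .fin]) [] a []) (fun _ _ => rfl)
    (by simp) (fun s a d => by
      simpa [regSymbol, pushMain] using
        (Run.push (k := .main) (f := regSymbol) (v := some s)
          (S := mem (d.flatMap (fun s => [none, s]) ++ [some .fin]) [] a [])).seq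
          (Run.push (k := .main) (f := fun _ => none))) (x.map some).reverse []
  rw [List.append_nil, List.reverse_reverse, ← ser_tokens] at h2
  refine ((takeInput_exec x).seq (h1.seq h2)).mono ?_
  simp
  omega

theorem writeOutput_exec (b : Bool) :
    Exec writeOutput (onMain (enc b : Tree).ser) (withOutput b) 2 := fun v => by
  have h : withOutput b = update (update (onMain (enc b : Tree).ser) .main
      ((onMain (enc b : Tree).ser) .main).tail) .output [b] := by
    funext k
    rcases k with _ | _ | _ | _ | _ | _ <;> rfl
  rw [h]
  have := Run.push (k := .output) (f := Reg.isTrue) (v := some (some (.bit b)))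
    (S := update (onMain (enc b : Tree).ser) .main ((onMain (enc b : Tree).ser) .main).tail)
  have hb : Reg.isTrue (some (some (.bit b))) = b := by cases b <;> rfl
  rw [hb] at this
  have hpop := Run.pop (k := .main) (f := id) (v := v) (S := onMain (enc b : Tree).ser)
  exact ⟨_, 2, le_rfl, hpop.seq this⟩

/-- The machine that runs a program once. -/
noncomputable def Prog.machine (p : Prog) : FinTM2 :=
  have := Fintype.ofFinite p.Label
  { K := Stack
    k₀ := .input
    k₁ := .output
    Γ := Symbol
    Λ := Option p.Label
    main := some p.entry
    σ := Reg
    initialState := none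
    Γk₀Fin := inferInstanceAs (Fintype Token)
    m := fun l => match l with
      -- A final configuration must contain the initial register value.
      | none => .load (fun _ => none) .halt
      | some l => p.code some none l }

theorem Poly.computable {f : List Token → Bool} (hf : Poly f) :
    Nonempty (TM2ComputableInPolyTime (fun x : List Token => x) Computability.encodeBool f) := by
  obtain ⟨p, q, hp⟩ := hf
  let P : Prog := .seq readInput (.seq p writeOutput)
  refine ⟨⟨⟨P.machine, Equiv.refl _, Equiv.refl _⟩,
    -- A list of `n` tokens has size `2 * n + 1`. The constant 8 consists of 5 for reading, 2 for
    -- writing and 1 for the halting step.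
    7 * Polynomial.X + q.comp (2 * Polynomial.X + 1) + 8, fun x => Classical.choice ?_⟩⟩
  have h1 := (hp x).2 []
  rw [List.append_nil, List.append_nil, sz_tokens] at h1
  obtain ⟨v, t, ht, hr⟩ := ((readInput_exec x).seq (h1.seq (writeOutput_exec (f x)))) none
  have h2 := hr.steps P.machine.m some none fun l => rfl
  refine ⟨⟨⟨t + 1, ?_⟩, ?_⟩⟩
  · have h3 : initList P.machine (x.map (Equiv.refl Token).invFun) =
        ⟨some (some P.entry), none, withInput x []⟩ := by
      refine (congrArg (initList P.machine) (List.map_id x)).trans ?_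
      refine congrArg (TM2.Cfg.mk (some (some P.entry)) none) (funext fun k => ?_)
      rcases k with _ | _ | _ | _ | _ | _ <;> rfl
    have h4 : haltList P.machine ((Computability.encodeBool (f x)).map (Equiv.refl Bool).invFun) =
        ⟨none, none, withOutput (f x)⟩ := by
      refine congrArg (TM2.Cfg.mk none none) (funext fun k => ?_)
      rcases k with _ | _ | _ | _ | _ | _ <;> rfl
    refine Eq.trans ?_ (congrArg some h4.symm)
    refine (congrArg (fun c => (flip bind P.machine.step)^[t + 1] (some c)) h3).trans ?_
    rw [iterate_succ_apply']
    exact congrArg (flip bind P.machine.step) h2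
  · simp
    omega

end POL

theorem theorem5 : POL.InP POL.wordModelChecking := by
  classical
  have h : (fun x => decide (x ∈ POL.wordModelChecking)) = POL.check :=
    funext fun x => Bool.eq_iff_iff.2 (by rw [decide_eq_true_eq, POL.check_iff])
  have := POL.Poly.check.computable
  rw [← h] at this
  exact this
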